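/- Let $n\ge 1$, let $\Omega\subset\mathbb R^n$ be a bounded domain (a nonempty connected open set) with $C^\infty$ boundary, and let $m\in(0,1)$. For a real function $u$ on $\mathbb R^n$, $(-\Delta)_D^{m/2}u$ is defined by the Fourier multiplier $|\xi|^m$ (in the sense of distributions). If $2m<n$, let $\mathcal D^m(\mathbb R^n)$ be the space of $u\in L^{2n/(n-2m)}(\mathbb R^n)$ with $(-\Delta)_D^{m/2}u\in L^2(\mathbb R^n)$; if $2m\ge n$ (that is, $n=1$ and $m\ge\frac12$), let $\mathcal D^m(\mathbb R^n)$ stand for the space of $u\in L^2(\mathbb R^n)$ with $(-\Delta)_D^{m/2}u\in L^2(\mathbb R^n)$. Put $$\widetilde H^m(\Omega)=\{u\in\mathcal D^m(\mathbb R^n): \operatorname{supp}u\subset\overline\Omega\},\qquad Q^D_m[u]=\int_{\mathbb R^n}|(-\Delta)_D^{m/2}u|^2\,dx .$$ Let $\lambda_j$, $\varphi_j$ ($j\ge1$) be the eigenvalues and the corresponding $L^2(\Omega)$-orthonormal eigenfunctions of $-\Delta$ on $H^1_0(\Omega)$, and for $u\in L^2(\Omega)$ put $$Q^N_m[u]=\int_\Omega|(-\Delta)_N^{m/2}u|^2\,dx=\sum_{j\ge1}\lambda_j^m\Big(\int_\Omega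 u\varphi_j\,dx\Big)^2\in[0,\infty].$$ Let $u\in\widetilde H^m(\Omega)$. Then $|u|\in\widetilde H^m(\Omega)$, $Q^N_m[u]<\infty$, and $$Q^D_m[\,|u|\,]\le Q^D_m[u],\qquad Q^N_m[\,|u|\,]\le Q^N_m[u].$$ If, in addition, neither the positive part nor the negative part of $u$ vanishes almost everywhere, then both inequalities are strict. -/

import Mathlib

open MeasureTheory Filter Topology
open scoped ENNReal ContDiff FourierTransform SchwartzMap

noncomputable section

/-- A bounded and smooth domain of `ℝⁿ`: a nonempty bounded connected open set which, near each of
its boundary points `x`, is the sublevel set `{ρ < 0}` of a `C^∞` function `ρ` with `ρ x = 0` and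
`dρ x ≠ 0`. -/
structure IsBoundedSmoothDomain {n : ℕ} (Ω : Set (EuclideanSpace ℝ (Fin n))) : Prop where
  isOpen : IsOpen Ω
  isConnected : IsConnected Ω
  isBounded : Bornology.IsBounded Ω
  smooth_boundary : ∀ x ∈ frontier Ω, ∃ ρ : EuclideanSpace ℝ (Fin n) → ℝ,
    ContDiff ℝ ∞ ρ ∧ ρ x = 0 ∧ fderiv ℝ ρ x ≠ 0 ∧ ∀ᶠ y in 𝓝 x, (y ∈ Ω ↔ ρ y < 0)

/-! ### The Dirichlet (restricted) fractional Laplacian -/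

/-- `(-Δ)^s φ` for a Schwartz function `φ`, as the Fourier multiplier of symbol `|ξ|^(2s)`.  With
Mathlib's normalisation `𝓕 φ (ξ) = ∫ exp (-2πi x·ξ) φ x`, the frequency is `2π ξ`. -/
def schwartzFracLaplacian {n : ℕ} (s : ℝ) (φ : 𝓢(EuclideanSpace ℝ (Fin n), ℂ)) :
    EuclideanSpace ℝ (Fin n) → ℂ :=
  𝓕⁻ (fun ξ : EuclideanSpace ℝ (Fin n) =>
    (((2 * Real.pi * ‖ξ‖) ^ (2 * s) : ℝ) : ℂ) *
      𝓕 (φ : EuclideanSpace ℝ (Fin n) → ℂ) ξ)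

/-- `(-Δ)^s u = g` in the sense of distributions on `ℝⁿ`. -/
def IsFracLaplacian {n : ℕ} (s : ℝ) (u g : EuclideanSpace ℝ (Fin n) → ℝ) : Prop :=
  ∀ φ : 𝓢(EuclideanSpace ℝ (Fin n), ℂ),
    ∫ x, (u x : ℂ) * schwartzFracLaplacian s φ x = ∫ x, (g x : ℂ) * φ x

open Classical in
/-- The function `(-Δ)^s u`, when it lies in `L²(ℝⁿ)` (it is then unique almost everywhere). -/
def fracLaplacian {n : ℕ} (s : ℝ) (u : EuclideanSpace ℝ (Fin n) → ℝ) :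
    EuclideanSpace ℝ (Fin n) → ℝ :=
  if h : ∃ g : EuclideanSpace ℝ (Fin n) → ℝ, MemLp g 2 ∧ IsFracLaplacian s u g then
    h.choose else 0

/-- The integrability exponent of `𝓓^m(ℝⁿ)`: the critical Sobolev exponent `2n / (n - 2m)` if
`2m < n`.  In the remaining case, where there is no critical exponent, it is `2`, so that the space
below is the usual `H^m(ℝⁿ)`. -/
def sobolevExponent (n : ℕ) (m : ℝ) : ℝ≥0∞ :=
  if 2 * m < n then ENNReal.ofReal (2 * n / (n - 2 * m)) else 2

/-- `u ∈ 𝓓^m(ℝⁿ)`: `u` has the integrability above and `(-Δ)^(m/2) u ∈ L²(ℝⁿ)`. -/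
def MemD {n : ℕ} (m : ℝ) (u : EuclideanSpace ℝ (Fin n) → ℝ) : Prop :=
  MemLp u (sobolevExponent n m) ∧
    ∃ g : EuclideanSpace ℝ (Fin n) → ℝ, MemLp g 2 ∧ IsFracLaplacian (m / 2) u g

/-- `u ∈ H̃^m(Ω)`: `u ∈ 𝓓^m(ℝⁿ)` with (essential) support in the closure of `Ω`. -/
def MemHTilde {n : ℕ} (m : ℝ) (Ω : Set (EuclideanSpace ℝ (Fin n)))
    (u : EuclideanSpace ℝ (Fin n) → ℝ) : Prop :=
  MemD m u ∧ ∀ᵐ x, x ∉ closure Ω → u x = 0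

/-- The Dirichlet form `∫_{ℝⁿ} |(-Δ)_D^(m/2) u|²`. -/
def dirichletForm {n : ℕ} (m : ℝ) (u : EuclideanSpace ℝ (Fin n) → ℝ) : ℝ :=
  ∫ x, |fracLaplacian (m / 2) u x| ^ 2

/-! ### The Navier (spectral) fractional Laplacian -/

/-- `ψ ∈ C_c^∞(Ω)`. -/
structure IsTestFunction {n : ℕ} (Ω : Set (EuclideanSpace ℝ (Fin n)))
    (ψ : EuclideanSpace ℝ (Fin n) → ℝ) : Prop where
  contDiff : ContDiff ℝ ∞ ψ
  hasCompactSupport : HasCompactSupport ψ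
  tsupport_subset : tsupport ψ ⊆ Ω

/-- `L²(Ω; F)`. -/
abbrev L2 {n : ℕ} (Ω : Set (EuclideanSpace ℝ (Fin n))) (F : Type) [NormedAddCommGroup F] : Type :=
  Lp F 2 (volume.restrict Ω)

/-- `v ∈ H¹₀(Ω)`, with gradient `G`: some sequence in `C_c^∞(Ω)` converges to `v` in `L²(Ω)` while
its gradients converge to `G` in `L²(Ω)`. -/
def HasH10Gradient {n : ℕ} (Ω : Set (EuclideanSpace ℝ (Fin n)))
    (v : L2 Ω ℝ) (G : L2 Ω (EuclideanSpace ℝ (Fin n))) : Prop :=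
  ∃ ψ : ℕ → EuclideanSpace ℝ (Fin n) → ℝ, (∀ k, IsTestFunction Ω (ψ k)) ∧
    Tendsto (fun k => eLpNorm (fun x => ψ k x - v x) 2 (volume.restrict Ω)) atTop (𝓝 0) ∧
    Tendsto (fun k => eLpNorm (fun x => gradient (ψ k) x - G x) 2 (volume.restrict Ω))
      atTop (𝓝 0)

/-- `v ∈ H¹₀(Ω)` and `-Δ v = μ v` weakly in `Ω`. -/
def IsDirichletEigenvector {n : ℕ} (Ω : Set (EuclideanSpace ℝ (Fin n))) (μ : ℝ)
    (v : L2 Ω ℝ) : Prop :=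
  ∃ G : L2 Ω (EuclideanSpace ℝ (Fin n)), HasH10Gradient Ω v G ∧
    ∀ ψ : EuclideanSpace ℝ (Fin n) → ℝ, IsTestFunction Ω ψ →
      ∫ x in Ω, inner ℝ (G x) (gradient ψ x) = μ * ∫ x in Ω, v x * ψ x

theorem IsTestFunction.continuous_gradient {n : ℕ} {Ω : Set (EuclideanSpace ℝ (Fin n))}
    {ψ : EuclideanSpace ℝ (Fin n) → ℝ} (h : IsTestFunction Ω ψ) : Continuous (gradient ψ) :=
  (InnerProductSpace.toDual ℝ (EuclideanSpace ℝ (Fin n))).symm.continuous.comp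
    (h.contDiff.continuous_fderiv (by simp))

theorem IsTestFunction.memLp {n : ℕ} {Ω : Set (EuclideanSpace ℝ (Fin n))}
    {ψ : EuclideanSpace ℝ (Fin n) → ℝ} (h : IsTestFunction Ω ψ) :
    MemLp ψ 2 (volume.restrict Ω) :=
  h.contDiff.continuous.memLp_of_hasCompactSupport h.hasCompactSupport

theorem IsTestFunction.memLp_gradient {n : ℕ} {Ω : Set (EuclideanSpace ℝ (Fin n))}
    {ψ : EuclideanSpace ℝ (Fin n) → ℝ} (h : IsTestFunction Ω ψ) :
    MemLp (gradient ψ) 2 (volume.restrict Ω) :=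
  h.continuous_gradient.memLp_of_hasCompactSupport
    (h.hasCompactSupport.fderiv (𝕜 := ℝ) |>.comp_left (map_zero _))

theorem IsTestFunction.integrable_inner_gradient {n : ℕ} {Ω : Set (EuclideanSpace ℝ (Fin n))}
    {ψ : EuclideanSpace ℝ (Fin n) → ℝ} (h : IsTestFunction Ω ψ)
    (G : L2 Ω (EuclideanSpace ℝ (Fin n))) :
    Integrable (fun x => inner ℝ (G x) (gradient ψ x)) (volume.restrict Ω) := by
  refine (MeasureTheory.L2.integrable_inner (𝕜 := ℝ) G h.memLp_gradient.toLp).congr ?_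
  filter_upwards [h.memLp_gradient.coeFn_toLp] with x hx
  rw [hx]

theorem IsTestFunction.zero {n : ℕ} (Ω : Set (EuclideanSpace ℝ (Fin n))) :
    IsTestFunction Ω (0 : EuclideanSpace ℝ (Fin n) → ℝ) where
  contDiff := contDiff_const
  hasCompactSupport := HasCompactSupport.zero
  tsupport_subset := by simp [tsupport]

theorem IsTestFunction.add {n : ℕ} {Ω : Set (EuclideanSpace ℝ (Fin n))}
    {ψ χ : EuclideanSpace ℝ (Fin n) → ℝ} (h : IsTestFunction Ω ψ) (h' : IsTestFunction Ω χ) :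
    IsTestFunction Ω (ψ + χ) where
  contDiff := h.contDiff.add h'.contDiff
  hasCompactSupport := h.hasCompactSupport.add h'.hasCompactSupport
  tsupport_subset := (tsupport_add ψ χ).trans
    (Set.union_subset h.tsupport_subset h'.tsupport_subset)

theorem IsTestFunction.smul {n : ℕ} {Ω : Set (EuclideanSpace ℝ (Fin n))}
    {ψ : EuclideanSpace ℝ (Fin n) → ℝ} (h : IsTestFunction Ω ψ) (c : ℝ) :
    IsTestFunction Ω (c • ψ) where
  contDiff := contDiff_const.smul h.contDiff
  hasCompactSupport := HasCompactSupport.smul_left (f := fun _ => c) h.hasCompactSupport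
  tsupport_subset := (tsupport_smul_subset_right (fun _ => c) ψ).trans h.tsupport_subset

theorem HasH10Gradient.zero {n : ℕ} (Ω : Set (EuclideanSpace ℝ (Fin n))) :
    HasH10Gradient Ω 0 0 := by
  refine ⟨fun _ => 0, fun _ => IsTestFunction.zero Ω, ?_, ?_⟩
  · refine tendsto_const_nhds.congr fun _ => Eq.symm ?_
    refine (eLpNorm_congr_ae ?_).trans (eLpNorm_zero (α := EuclideanSpace ℝ (Fin n)) (ε := ℝ))
    filter_upwards [Lp.coeFn_zero ℝ 2 (volume.restrict Ω)] with x hx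
    rw [hx]; simp
  · refine tendsto_const_nhds.congr fun _ => Eq.symm ?_
    refine (eLpNorm_congr_ae ?_).trans
      (eLpNorm_zero (α := EuclideanSpace ℝ (Fin n)) (ε := EuclideanSpace ℝ (Fin n)))
    filter_upwards [Lp.coeFn_zero (EuclideanSpace ℝ (Fin n)) 2 (volume.restrict Ω)] with x hx
    rw [hx]; simp [gradient]

theorem HasH10Gradient.add {n : ℕ} {Ω : Set (EuclideanSpace ℝ (Fin n))}
    {v w : L2 Ω ℝ} {G H : L2 Ω (EuclideanSpace ℝ (Fin n))}
    (hv : HasH10Gradient Ω v G) (hw : HasH10Gradient Ω w H) :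
    HasH10Gradient Ω (v + w) (G + H) := by
  obtain ⟨ψ, hψ, h1, h2⟩ := hv
  obtain ⟨χ, hχ, h3, h4⟩ := hw
  refine ⟨fun k => ψ k + χ k, fun k => (hψ k).add (hχ k), ?_, ?_⟩
  · refine tendsto_of_tendsto_of_tendsto_of_le_of_le tendsto_const_nhds
      (by simpa using h1.add h3) (fun _ => zero_le) fun k => ?_
    refine le_trans (le_of_eq (eLpNorm_congr_ae ?_))
      (eLpNorm_add_le ((hψ k).memLp.sub (Lp.memLp v)).1 ((hχ k).memLp.sub (Lp.memLp w)).1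
        (by norm_num))
    filter_upwards [Lp.coeFn_add v w] with x hx
    rw [hx]; simp only [Pi.add_apply]; ring
  · refine tendsto_of_tendsto_of_tendsto_of_le_of_le tendsto_const_nhds
      (by simpa using h2.add h4) (fun _ => zero_le) fun k => ?_
    refine le_trans (le_of_eq (eLpNorm_congr_ae ?_))
      (eLpNorm_add_le ((hψ k).memLp_gradient.sub (Lp.memLp G)).1
        ((hχ k).memLp_gradient.sub (Lp.memLp H)).1 (by norm_num))
    filter_upwards [Lp.coeFn_add G H] with x hx
    have : gradient (ψ k + χ k) x = gradient (ψ k) x + gradient (χ k) x := by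
      simp only [gradient]
      rw [fderiv_add ((hψ k).contDiff.differentiable (by simp) x)
        ((hχ k).contDiff.differentiable (by simp) x), map_add]
    rw [hx, this]; simp only [Pi.add_apply]; abel

theorem IsTestFunction.gradient_smul {n : ℕ} {Ω : Set (EuclideanSpace ℝ (Fin n))}
    {ψ : EuclideanSpace ℝ (Fin n) → ℝ} (h : IsTestFunction Ω ψ) (c : ℝ)
    (x : EuclideanSpace ℝ (Fin n)) : gradient (c • ψ) x = c • gradient ψ x := by
  simp only [gradient]
  rw [fderiv_const_smul (h.contDiff.differentiable (by simp) x)]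
  simp

theorem HasH10Gradient.smul {n : ℕ} {Ω : Set (EuclideanSpace ℝ (Fin n))}
    {v : L2 Ω ℝ} {G : L2 Ω (EuclideanSpace ℝ (Fin n))}
    (hv : HasH10Gradient Ω v G) (c : ℝ) : HasH10Gradient Ω (c • v) (c • G) := by
  obtain ⟨ψ, hψ, h1, h2⟩ := hv
  refine ⟨fun k => c • ψ k, fun k => (hψ k).smul c, ?_, ?_⟩
  · have h := ENNReal.Tendsto.const_mul (a := ‖c‖ₑ) h1 (Or.inr (by simp))
    rw [mul_zero] at h
    refine h.congr fun k => ?_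
    rw [← eLpNorm_const_smul]
    refine eLpNorm_congr_ae ?_
    filter_upwards [Lp.coeFn_smul c v] with x hx
    simp [hx, mul_sub]
  · have h := ENNReal.Tendsto.const_mul (a := ‖c‖ₑ) h2 (Or.inr (by simp))
    rw [mul_zero] at h
    refine h.congr fun k => ?_
    rw [← eLpNorm_const_smul]
    refine eLpNorm_congr_ae ?_
    filter_upwards [Lp.coeFn_smul c G] with x hx
    simp [hx, smul_sub, (hψ k).gradient_smul]

/-- The eigenspace of `-Δ` on `H¹₀(Ω)` for `μ`, as a subspace of `L²(Ω)` (zero if `μ` is not an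
eigenvalue). -/
def dirichletEigenspace {n : ℕ} (Ω : Set (EuclideanSpace ℝ (Fin n))) (μ : ℝ) :
    Submodule ℝ (L2 Ω ℝ) where
  carrier := {v | IsDirichletEigenvector Ω μ v}
  zero_mem' := by
    refine ⟨0, HasH10Gradient.zero Ω, fun ψ _ => ?_⟩
    have e1 : ∫ x in Ω, inner ℝ ((0 : L2 Ω (EuclideanSpace ℝ (Fin n))) x) (gradient ψ x) = 0 := by
      refine integral_eq_zero_of_ae ?_
      filter_upwards [Lp.coeFn_zero (EuclideanSpace ℝ (Fin n)) 2 (volume.restrict Ω)] with x hx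
      rw [hx]; simp
    have e2 : ∫ x in Ω, (0 : L2 Ω ℝ) x * ψ x = 0 := by
      refine integral_eq_zero_of_ae ?_
      filter_upwards [Lp.coeFn_zero ℝ 2 (volume.restrict Ω)] with x hx
      rw [hx]; simp
    rw [e1, e2, mul_zero]
  add_mem' := by
    rintro v w ⟨G, hG, hv⟩ ⟨H, hH, hw⟩
    refine ⟨G + H, hG.add hH, fun ψ hψ => ?_⟩
    have e1 : ∫ x in Ω, inner ℝ ((G + H : L2 Ω (EuclideanSpace ℝ (Fin n))) x) (gradient ψ x)
        = ∫ x in Ω, (inner ℝ (G x) (gradient ψ x) + inner ℝ (H x) (gradient ψ x)) := by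
      refine integral_congr_ae ?_
      filter_upwards [Lp.coeFn_add G H] with x hx
      rw [hx, Pi.add_apply, inner_add_left]
    have e2 : ∫ x in Ω, (v + w : L2 Ω ℝ) x * ψ x = ∫ x in Ω, (v x * ψ x + w x * ψ x) := by
      refine integral_congr_ae ?_
      filter_upwards [Lp.coeFn_add v w] with x hx
      rw [hx, Pi.add_apply, add_mul]
    have i1 : Integrable (fun x => v x * ψ x) (volume.restrict Ω) :=
      (Lp.memLp v).integrable_mul hψ.memLp
    have i2 : Integrable (fun x => w x * ψ x) (volume.restrict Ω) :=
      (Lp.memLp w).integrable_mul hψ.memLp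
    rw [e1, e2, integral_add (hψ.integrable_inner_gradient G) (hψ.integrable_inner_gradient H),
      integral_add i1 i2, hv ψ hψ, hw ψ hψ, mul_add]
  smul_mem' := by
    rintro c v ⟨G, hG, hv⟩
    refine ⟨c • G, hG.smul c, fun ψ hψ => ?_⟩
    have e1 : ∫ x in Ω, inner ℝ ((c • G : L2 Ω (EuclideanSpace ℝ (Fin n))) x) (gradient ψ x)
        = ∫ x in Ω, c * inner ℝ (G x) (gradient ψ x) := by
      refine integral_congr_ae ?_
      filter_upwards [Lp.coeFn_smul c G] with x hx
      rw [hx, Pi.smul_apply, real_inner_smul_left]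
    have e2 : ∫ x in Ω, (c • v : L2 Ω ℝ) x * ψ x = ∫ x in Ω, c * (v x * ψ x) := by
      refine integral_congr_ae ?_
      filter_upwards [Lp.coeFn_smul c v] with x hx
      rw [hx, Pi.smul_apply, smul_eq_mul, mul_assoc]
    rw [e1, e2, integral_const_mul, integral_const_mul, hv ψ hψ]
    ring

open Classical in
/-- The Navier form `∫_Ω |(-Δ)_N^(m/2) u|² = ∑ⱼ λⱼ^m (∫_Ω u φⱼ)²`, where the `λⱼ`, `φⱼ` are the
eigenvalues and `L²(Ω)`-normalised eigenfunctions of `-Δ` on `H¹₀(Ω)`.  The terms with the same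
eigenvalue `μ` are grouped: they add up to `μ^m ‖P_μ u‖²` with `P_μ` the orthogonal projection of
`L²(Ω)` onto the eigenspace, and `P_μ = 0` if `μ` is not an eigenvalue.  (The eigenspaces are
closed; taking the closure only makes the projection available.)  The value is `∞` if the series
diverges or if `u ∉ L²(Ω)`. -/
def navierForm {n : ℕ} (m : ℝ) (Ω : Set (EuclideanSpace ℝ (Fin n)))
    (u : EuclideanSpace ℝ (Fin n) → ℝ) : ℝ≥0∞ :=
  if h : MemLp u 2 (volume.restrict Ω) then
    ∑' μ : ℝ, ENNReal.ofReal
      (μ ^ m * ‖(dirichletEigenspace Ω μ).topologicalClosure.starProjection (h.toLp u)‖ ^ 2)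
  else ⊤

end

/-!
Both quadratic forms are superpositions, over scales `s > 0`, of forms attached to a
positivity-preserving operator. With `(e^{tΔ})` the heat semigroup of `ℝⁿ` and
`R_s = (1 - sΔ)⁻¹` the resolvent of the Dirichlet Laplacian of `Ω`, one has, up to constants
depending only on `m`,

* `Q^D_m[u] = ∫₀^∞ s^(-1-m) (‖u‖² - ⟪e^{csΔ} u, u⟫) ds` for a constant `c > 0`
  (`gagliardo_eq_dirichletForm`),
* `Q^N_m[u] = ∫₀^∞ s^(-1-m) (‖u‖² - ⟪R_s u, u⟫) ds` (`navierConst_mul_navierForm`),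

because `∫₀^∞ s^(-1-m) Φ(sμ) ds` is a multiple of `μ^m` for every profile `Φ`; here
`Φ(s) = 1 - e^{-s}` and `Φ(s) = s / (1 + s)`. The norm `‖u‖²` does not see the sign of `u`, so that
everything rests on the positivity of the two families of operators.

**The Dirichlet form.** The Gaussian being explicit, the form at scale `s` is
`½ ∬ k_s(z) |u (x + z) - u x|² dx dz` with `k_s > 0`, and it decreases under `u ↦ |u|`. If equality
held, `u x` and `u (x + z)` would almost never have opposite signs, whereas two sets of positive
measure have translates which overlap (`gagliardo_abs_lt`). Finiteness of this energy characterises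
the functions `u` with `(-Δ)^(m/2) u ∈ L²` (`exists_isFracLaplacian_iff`), whence
`|u| ∈ H̃^m(Ω)`.

**The Navier form.** The resolvent is the orthogonal projection of `(u, 0)` onto the closure of the
pairs `(ψ, √s ∇ψ)`. Averaging over grids shows that it is compact (`isCompactOperator_resolvent`),
so that the eigenspaces of the Dirichlet Laplacian span `L²(Ω)` and the sum defining `Q^N_m` can be
compared with the resolvents. Since `|ψ|` competes as well as `ψ` in the variational problem, the
resolvent preserves positivity (`abs_resolvent_eq`), which is the inequality. On a connected set it
improves positivity (`ae_pos_resolvent`): if `v ≥ 0` solves `v - sΔv = f ≥ 0`, testing the equation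
with `χ² / v` bounds the gradient of `log v` locally, so that `log (1 + v / ε) / log (1 / ε)`, which
tends to the indicator function of `{v > 0}`, has a gradient tending to zero. That indicator is
therefore constant. Hence `⟪R_s u⁺, u⁻⟫ > 0` when both parts are nonzero, and the inequality is
strict at every scale (`resolventEnergy_abs_lt`).

**Finiteness of the Navier form.** `‖u‖² - ⟪R_s u, u⟫` is the minimum of `‖u - ψ‖² + s ‖∇ψ‖²`, so
that it suffices to exhibit a competitor. A smooth domain satisfies an interior cone condition
(`IsBoundedSmoothDomain.exists_cone`). After localisation by a partition of unity, mollifying `u` at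
scale `√s` with a kernel supported in the cone gives a test function on `Ω`, with error bounded by
the heat energy of `u` at scale `s` (`exists_resolventEnergy_le_heatEnergy`); integrating over `s`
bounds `Q^N_m[u]` by `Q^D_m[u]` and `‖u‖²` (`navierForm_lt_top`). The same cones show that the
boundary is negligible, so that a part of `u` which is nonzero on `ℝⁿ` is nonzero on `Ω`.
-/

noncomputable section

/-! ### Integrals against the power weight `s ^ (-1 - m)` -/

/-- Scaling `s ↦ s c` turns the weight `s ^ (-1 - m)` into the power `c ^ m`: fractional powers are
superpositions of `Φ (s c)` for any profile `Φ`. -/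
theorem lintegral_Ioi_rpow_mul_comp_mul {m c : ℝ} (hc : 0 < c) (Φ : ℝ → ℝ≥0∞) :
    ∫⁻ s in Set.Ioi (0 : ℝ), ENNReal.ofReal (s ^ (-1 - m)) * Φ (s * c) =
      ENNReal.ofReal (c ^ m) * ∫⁻ s in Set.Ioi (0 : ℝ), ENNReal.ofReal (s ^ (-1 - m)) * Φ s := by
  have hmeas : MeasurableEmbedding (fun s : ℝ => s * c) :=
    (Homeomorph.mulRight₀ c hc.ne').measurableEmbedding
  have hpre : (fun s : ℝ => s * c) ⁻¹' Set.Ioi 0 = Set.Ioi 0 := by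
    ext s; simp [hc]
  have hmap : Measure.map (fun s : ℝ => s * c) (volume.restrict (Set.Ioi 0)) =
      ENNReal.ofReal c⁻¹ • volume.restrict (Set.Ioi 0) := by
    conv_lhs => rw [← hpre]
    rw [← hmeas.restrict_map, Real.map_volume_mul_right hc.ne', Measure.restrict_smul,
      abs_of_pos (inv_pos.2 hc)]
  have key : ∫⁻ s in Set.Ioi (0 : ℝ), ENNReal.ofReal (s ^ (-1 - m)) * Φ s =
      ENNReal.ofReal c * ∫⁻ s in Set.Ioi (0 : ℝ),
        ENNReal.ofReal ((s * c) ^ (-1 - m)) * Φ (s * c) := by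
    have h := hmeas.lintegral_map (μ := volume.restrict (Set.Ioi 0))
      (fun s => ENNReal.ofReal (s ^ (-1 - m)) * Φ s)
    rw [hmap, lintegral_smul_measure] at h
    rw [← h, smul_eq_mul, ← mul_assoc, ← ENNReal.ofReal_mul hc.le, mul_inv_cancel₀ hc.ne',
      ENNReal.ofReal_one, one_mul]
  have h2 : ∫⁻ s in Set.Ioi (0 : ℝ), ENNReal.ofReal ((s * c) ^ (-1 - m)) * Φ (s * c) =
      ∫⁻ s in Set.Ioi (0 : ℝ), ENNReal.ofReal (c ^ (-1 - m)) *
        (ENNReal.ofReal (s ^ (-1 - m)) * Φ (s * c)) := by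
    refine setLIntegral_congr_fun measurableSet_Ioi fun s hs => ?_
    have hs' : 0 ≤ s ^ (-1 - m) := Real.rpow_nonneg (le_of_lt hs) _
    rw [Real.mul_rpow (le_of_lt hs) hc.le, ENNReal.ofReal_mul hs']
    ring
  rw [key, h2, lintegral_const_mul' _ _ ENNReal.ofReal_ne_top, ← mul_assoc, ← mul_assoc,
    ← ENNReal.ofReal_mul (by positivity), ← ENNReal.ofReal_mul (by positivity)]
  have : c ^ m * c * c ^ (-1 - m) = 1 := by
    rw [← Real.rpow_add_one hc.ne', ← Real.rpow_add hc, show m + 1 + (-1 - m) = 0 by ring,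
      Real.rpow_zero]
  rw [this, ENNReal.ofReal_one, one_mul]

/-- The bound by `s` gives convergence at `0` because `m < 1`, the bound by `1` gives it at `∞`
because `0 < m`. -/
theorem lintegral_Ioi_rpow_mul_min_lt_top {m : ℝ} (hm0 : 0 < m) (hm1 : m < 1) :
    ∫⁻ s in Set.Ioi (0 : ℝ), ENNReal.ofReal (s ^ (-1 - m)) * ENNReal.ofReal (min 1 s) < ⊤ := by
  rw [← Set.Ioc_union_Ioi_eq_Ioi (zero_le_one' ℝ)]
  refine (lintegral_union_le _ _ _).trans_lt (ENNReal.add_lt_top.2 ⟨?_, ?_⟩)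
  · have h1 : IntegrableOn (fun s : ℝ => s ^ (-m)) (Set.Ioc 0 1) :=
      (intervalIntegrable_iff_integrableOn_Ioc_of_le zero_le_one).1
        (intervalIntegral.intervalIntegrable_rpow' (by linarith))
    refine (setLIntegral_mono_ae' measurableSet_Ioc (ae_of_all _ fun s hs => ?_)).trans_lt
      h1.lintegral_lt_top
    rw [← ENNReal.ofReal_mul (Real.rpow_nonneg hs.1.le _), min_eq_right hs.2]
    refine ENNReal.ofReal_le_ofReal (le_of_eq ?_)
    nth_rw 2 [← Real.rpow_one s]
    rw [← Real.rpow_add hs.1]; ring_nf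
  · have h1 : IntegrableOn (fun s : ℝ => s ^ (-1 - m)) (Set.Ioi 1) :=
      integrableOn_Ioi_rpow_of_lt (by linarith) one_pos
    refine (setLIntegral_mono_ae' measurableSet_Ioi (ae_of_all _ fun s hs => ?_)).trans_lt
      h1.lintegral_lt_top
    rw [min_eq_left (le_of_lt hs), ENNReal.ofReal_one, mul_one]

theorem lintegral_Ioi_rpow_mul_ne_zero {m : ℝ} {Φ : ℝ → ℝ≥0∞} (hΦ : Measurable Φ)
    (hpos : ∀ s, 0 < s → 0 < Φ s) :
    ∫⁻ s in Set.Ioi (0 : ℝ), ENNReal.ofReal (s ^ (-1 - m)) * Φ s ≠ 0 := by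
  have hpos' : ∀ s ∈ Set.Ioi (0 : ℝ), 0 < ENNReal.ofReal (s ^ (-1 - m)) * Φ s := fun s hs =>
    ENNReal.mul_pos (ENNReal.ofReal_pos.2 (Real.rpow_pos_of_pos hs _)).ne' (hpos s hs).ne'
  refine ((setLIntegral_pos_iff (by fun_prop)).2 ?_).ne'
  refine lt_of_lt_of_le (b := volume (Set.Ioi (0 : ℝ))) (by simp) (measure_mono fun s hs => ?_)
  exact ⟨(hpos' s hs).ne', hs⟩

theorem lintegral_Ioi_rpow_mul_lt_top {m : ℝ} (hm0 : 0 < m) (hm1 : m < 1) {Φ : ℝ → ℝ≥0∞}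
    (hle : ∀ s, 0 < s → Φ s ≤ ENNReal.ofReal (min 1 s)) :
    ∫⁻ s in Set.Ioi (0 : ℝ), ENNReal.ofReal (s ^ (-1 - m)) * Φ s < ⊤ :=
  (setLIntegral_mono_ae' measurableSet_Ioi (ae_of_all _ fun s hs => by
    gcongr; exact hle s hs)).trans_lt (lintegral_Ioi_rpow_mul_min_lt_top hm0 hm1)

/-! ### The fractional Laplacian in Fourier variables -/

section Symbol

variable {V : Type*} [NormedAddCommGroup V]

/-- The symbol `|2πξ|^(2s)` of `(-Δ)^s`. -/
def fracSymbol (s : ℝ) (ξ : V) : ℝ := (2 * Real.pi * ‖ξ‖) ^ (2 * s)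

theorem fracSymbol_nonneg (s : ℝ) (ξ : V) : 0 ≤ fracSymbol s ξ :=
  Real.rpow_nonneg (by positivity) _

theorem continuous_fracSymbol {s : ℝ} (hs : 0 ≤ s) : Continuous (fracSymbol s : V → ℝ) :=
  Continuous.rpow_const (by fun_prop) fun _ => Or.inr (by linarith)

end Symbol

section Fourier

variable {V : Type*} [NormedAddCommGroup V] [InnerProductSpace ℝ V] [FiniteDimensional ℝ V]
  [MeasurableSpace V] [BorelSpace V]

theorem integral_fourierInv_mul_eq_of_integrable {f g : V → ℂ} (hf : Integrable f)
    (hg : Integrable g) : ∫ ξ, 𝓕⁻ f ξ * g ξ = ∫ x, f x * 𝓕⁻ g x := by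
  have h := VectorFourier.integral_fourierIntegral_smul_eq_flip (L := -innerₗ V)
    (e := Real.fourierChar) (μ := volume) (ν := volume) Real.continuous_fourierChar
    (by simpa using! continuous_inner.neg) hf hg
  have hflip : (-innerₗ V).flip = -innerₗ V := by
    ext x y; simp [real_inner_comm]
  rw [hflip] at h
  exact h

theorem continuous_fourierInv {f : V → ℂ} (hf : Integrable f) : Continuous (𝓕⁻ f) :=
  VectorFourier.fourierIntegral_continuous (L := -innerₗ V) (e := Real.fourierChar)
    (μ := volume) Real.continuous_fourierChar (by simpa using! continuous_inner.neg) hf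

/-- On `L¹ ∩ L²` the inverse Fourier transform of `L²` is given by the Fourier integral. -/
theorem fourierInv_toLp_ae_eq {f : V → ℂ} (hf : Integrable f) (hf2 : MemLp f 2) :
    ((𝓕⁻ (hf2.toLp f) : Lp ℂ 2 (volume : Measure V)) : V → ℂ) =ᵐ[volume] 𝓕⁻ f := by
  refine ae_eq_of_integral_contDiff_smul_eq ((Lp.memLp _).locallyIntegrable (by norm_num))
    (continuous_fourierInv hf).locallyIntegrable fun ψ hψ hψc => ?_
  have hc : HasCompactSupport (fun x => (ψ x : ℂ)) := hψc.comp_left (g := Complex.ofReal) rfl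
  have hd : ContDiff ℝ ∞ (fun x => (ψ x : ℂ)) := Complex.ofRealCLM.contDiff.comp hψ
  set Ψ : 𝓢(V, ℂ) := hc.toSchwartzMap hd with hΨ
  have h1 := congrArg (fun T => T Ψ) (Lp.fourierInv_toTemperedDistribution_eq (hf2.toLp f))
  simp only [TemperedDistribution.fourierInv_apply, Lp.toTemperedDistribution_apply] at h1
  have h2 : ∫ x, (𝓕⁻ Ψ) x • (hf2.toLp f : V → ℂ) x = ∫ x, f x * 𝓕⁻ (Ψ : V → ℂ) x := by
    refine integral_congr_ae ?_
    filter_upwards [hf2.coeFn_toLp] with x hx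
    rw [hx, SchwartzMap.fourierInv_coe, smul_eq_mul, mul_comm]
  rw [h2, ← integral_fourierInv_mul_eq_of_integrable hf Ψ.integrable] at h1
  have h3 : ∀ x, Ψ x = (ψ x : ℂ) := fun x => rfl
  simp only [h3, smul_eq_mul] at h1
  simp only [Complex.real_smul]
  rw [← h1]
  exact integral_congr_ae (ae_of_all _ fun x => mul_comm _ _)

theorem eLpNorm_fourierInv {f : V → ℂ} (hf : Integrable f) (hf2 : MemLp f 2) :
    eLpNorm (𝓕⁻ f) 2 volume = eLpNorm f 2 volume := by
  rw [← eLpNorm_congr_ae (fourierInv_toLp_ae_eq hf hf2), ← Lp.enorm_def,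
    ← Lp.enorm_toLp hf2, ← ofReal_norm, ← ofReal_norm]
  congr 1
  exact (Lp.fourierTransformₗᵢ V ℂ).symm.norm_map _

/-- The symbol grows at most linearly, which rapid decay compensates. -/
theorem integrable_fracSymbol_mul {s : ℝ} (hs : 0 ≤ s) (hs1 : 2 * s ≤ 1) (φ : 𝓢(V, ℂ)) :
    Integrable (fun ξ => (fracSymbol s ξ : ℂ) * φ ξ) := by
  have h : Integrable (fun ξ => ‖φ ξ‖ + 2 * Real.pi * (‖ξ‖ ^ 1 * ‖φ ξ‖)) :=
    φ.integrable.norm.add ((φ.integrable_pow_mul volume 1).const_mul _)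
  refine h.mono' ((Complex.continuous_ofReal.comp (continuous_fracSymbol hs)).mul
    φ.continuous).aestronglyMeasurable (ae_of_all _ fun ξ => ?_)
  have h0 : 0 ≤ 2 * Real.pi * ‖ξ‖ := by positivity
  have h1 : fracSymbol s ξ ≤ 1 + 2 * Real.pi * ‖ξ‖ := by
    rcases le_total (2 * Real.pi * ‖ξ‖) 1 with h | h
    · exact (Real.rpow_le_one h0 h (by linarith)).trans (by linarith)
    · exact (Real.rpow_le_rpow_of_exponent_le h hs1).trans (by rw [Real.rpow_one]; linarith)
  rw [norm_mul, Complex.norm_real, Real.norm_of_nonneg (fracSymbol_nonneg _ _)]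
  nlinarith [norm_nonneg (φ ξ)]

end Fourier

section FracLaplacian

variable {n : ℕ}

local notation "𝔼" => EuclideanSpace ℝ (Fin n)

/-- `(-Δ)^s` is a multiplier in Fourier variables, the definition being applied to `𝓕⁻ ψ`. -/
theorem schwartzFracLaplacian_fourierInv (s : ℝ) (ψ : 𝓢(𝔼, ℂ)) :
    schwartzFracLaplacian s (𝓕⁻ ψ) = 𝓕⁻ (fun ξ => (fracSymbol s ξ : ℂ) * ψ ξ) := by
  have : 𝓕 ((𝓕⁻ ψ : 𝓢(𝔼, ℂ)) : 𝔼 → ℂ) = ψ := by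
    rw [← SchwartzMap.fourier_coe, FourierTransform.fourier_fourierInv_eq]
  unfold schwartzFracLaplacian
  rw [this]
  rfl

/-- Passing to Fourier variables, `(-Δ)^s u = g` tested against `𝓕⁻ ψ`. -/
theorem integral_mul_schwartzFracLaplacian_fourierInv {s : ℝ} (hs : 0 ≤ s) (hs1 : 2 * s ≤ 1)
    {u : 𝔼 → ℝ} (hu : Integrable u) (ψ : 𝓢(𝔼, ℂ)) :
    ∫ x, (u x : ℂ) * schwartzFracLaplacian s (𝓕⁻ ψ) x =
      ∫ ξ, ((fracSymbol s ξ : ℂ) * 𝓕⁻ (fun x => (u x : ℂ)) ξ) * ψ ξ := by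
  have hu' : Integrable (fun x => (u x : ℂ)) := hu.ofReal
  rw [schwartzFracLaplacian_fourierInv,
    ← integral_fourierInv_mul_eq_of_integrable hu' (integrable_fracSymbol_mul hs hs1 ψ)]
  refine integral_congr_ae (ae_of_all _ fun ξ => ?_)
  ring

/-- The `L²` Fourier transform agrees with that of tempered distributions. -/
theorem integral_Lp_mul_fourierInv (G : Lp ℂ 2 (volume : Measure 𝔼)) (ψ : 𝓢(𝔼, ℂ)) :
    ∫ x, G x * (𝓕⁻ ψ) x = ∫ ξ, (𝓕⁻ G : Lp ℂ 2 (volume : Measure 𝔼)) ξ * ψ ξ := by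
  have h1 := congrArg (fun T => T ψ) (Lp.fourierInv_toTemperedDistribution_eq G)
  simp only [TemperedDistribution.fourierInv_apply, Lp.toTemperedDistribution_apply,
    smul_eq_mul] at h1
  simpa only [mul_comm] using h1

/-- The distributional relation `(-Δ)^s u = g` with `g ∈ L²` becomes a pointwise one in Fourier
variables. The inverse transform `𝓕⁻` is used throughout; the symbol is even. -/
theorem IsFracLaplacian.fourierInv_ae_eq {s : ℝ} (hs : 0 ≤ s) (hs1 : 2 * s ≤ 1)
    {u g : 𝔼 → ℝ} (hu : Integrable u) (hg : MemLp g 2) (h : IsFracLaplacian s u g) :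
    ((𝓕⁻ (hg.ofReal (K := ℂ)).toLp : Lp ℂ 2 (volume : Measure 𝔼)) : 𝔼 → ℂ) =ᵐ[volume]
      fun ξ => (fracSymbol s ξ : ℂ) * 𝓕⁻ (fun x => (u x : ℂ)) ξ := by
  refine ae_eq_of_integral_contDiff_smul_eq ((Lp.memLp _).locallyIntegrable (by norm_num))
    ((Complex.continuous_ofReal.comp (continuous_fracSymbol hs)).mul
      (continuous_fourierInv hu.ofReal)).locallyIntegrable fun ψ hψ hψc => ?_
  have hc : HasCompactSupport (fun x => (ψ x : ℂ)) := hψc.comp_left (g := Complex.ofReal) rfl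
  have hd : ContDiff ℝ ∞ (fun x => (ψ x : ℂ)) := Complex.ofRealCLM.contDiff.comp hψ
  set Ψ : 𝓢(𝔼, ℂ) := hc.toSchwartzMap hd with hΨ
  have h1 := h (𝓕⁻ Ψ)
  have h2 : ∫ x, (g x : ℂ) * (𝓕⁻ Ψ) x = ∫ x, (hg.ofReal (K := ℂ)).toLp _ x * (𝓕⁻ Ψ) x := by
    refine integral_congr_ae ?_
    filter_upwards [(hg.ofReal (K := ℂ)).coeFn_toLp] with x hx
    rw [hx]; rfl
  rw [integral_mul_schwartzFracLaplacian_fourierInv hs hs1 hu, h2,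
    integral_Lp_mul_fourierInv] at h1
  have h3 : ∀ x, Ψ x = (ψ x : ℂ) := fun x => rfl
  simp only [h3] at h1
  simp only [Complex.real_smul]
  refine Eq.trans (integral_congr_ae (ae_of_all _ fun x => mul_comm _ _)) (h1.symm.trans ?_)
  exact integral_congr_ae (ae_of_all _ fun x => mul_comm _ _)

/-- Plancherel's identity for `(-Δ)^s u`. -/
theorem IsFracLaplacian.eLpNorm_eq {s : ℝ} (hs : 0 ≤ s) (hs1 : 2 * s ≤ 1)
    {u g : 𝔼 → ℝ} (hu : Integrable u) (hg : MemLp g 2) (h : IsFracLaplacian s u g) :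
    eLpNorm g 2 volume =
      eLpNorm (fun ξ => (fracSymbol s ξ : ℂ) * 𝓕⁻ (fun x => (u x : ℂ)) ξ) 2 volume := by
  rw [← eLpNorm_congr_ae (h.fourierInv_ae_eq hs hs1 hu hg), ← Lp.enorm_def]
  have h1 : ‖(𝓕⁻ (hg.ofReal (K := ℂ)).toLp : Lp ℂ 2 (volume : Measure 𝔼))‖ₑ =
      ‖(hg.ofReal (K := ℂ)).toLp‖ₑ := by
    rw [← ofReal_norm, ← ofReal_norm]
    congr 1
    exact (Lp.fourierTransformₗᵢ 𝔼 ℂ).symm.norm_map _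
  rw [h1, Lp.enorm_toLp]
  exact eLpNorm_congr_norm_ae (ae_of_all _ fun x => by simp)

theorem fourier_conj_comp (f : 𝔼 → ℂ) (ξ : 𝔼) :
    𝓕 (fun x => starRingEnd ℂ (f x)) ξ = starRingEnd ℂ (𝓕⁻ f ξ) := by
  rw [Real.fourier_eq', Real.fourierInv_eq', ← integral_conj]
  refine integral_congr_ae (ae_of_all _ fun x => ?_)
  simp [← Complex.exp_conj, Complex.conj_ofNat]

/-- `(-Δ)^s` commutes with complex conjugation, its symbol being real and even. -/
theorem schwartzFracLaplacian_conj (s : ℝ) (φ : 𝓢(𝔼, ℂ)) (x : 𝔼) :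
    schwartzFracLaplacian s (φ.postcompCLM (Complex.conjCLE : ℂ →L[ℝ] ℂ)) x =
      starRingEnd ℂ (schwartzFracLaplacian s φ x) := by
  have h1 : (φ.postcompCLM (Complex.conjCLE : ℂ →L[ℝ] ℂ) : 𝔼 → ℂ) =
      fun x => starRingEnd ℂ (φ x) := rfl
  unfold schwartzFracLaplacian
  rw [h1, Real.fourierInv_eq_fourier_comp_neg (f := fun ξ => _ * _), ← fourier_conj_comp]
  refine congrFun (congrArg 𝓕 (funext fun ξ => ?_)) x
  simp only [fourier_conj_comp, map_mul, Complex.conj_ofReal, norm_neg, neg_neg,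
    Real.fourierInv_eq_fourier_neg]

/-- A square integrable product of the symbol with the transform of `u` yields `(-Δ)^s u ∈ L²`. The
transform is only complex-valued; its real part works as `(-Δ)^s` commutes with conjugation. -/
theorem exists_isFracLaplacian {s : ℝ} (hs : 0 ≤ s) (hs1 : 2 * s ≤ 1)
    {u : 𝔼 → ℝ} (hu : Integrable u)
    (h : MemLp (fun ξ => (fracSymbol s ξ : ℂ) * 𝓕⁻ (fun x => (u x : ℂ)) ξ) 2 volume) :
    ∃ g : 𝔼 → ℝ, MemLp g 2 ∧ IsFracLaplacian s u g := by
  set G : Lp ℂ 2 (volume : Measure 𝔼) := 𝓕 (h.toLp _) with hG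
  have hGφ : ∀ φ : 𝓢(𝔼, ℂ),
      ∫ x, (u x : ℂ) * schwartzFracLaplacian s φ x = ∫ x, G x * φ x := by
    intro φ
    obtain ⟨ψ, rfl⟩ : ∃ ψ : 𝓢(𝔼, ℂ), φ = 𝓕⁻ ψ := ⟨𝓕 φ, by simp⟩
    rw [integral_mul_schwartzFracLaplacian_fourierInv hs hs1 hu, integral_Lp_mul_fourierInv, hG,
      FourierTransform.fourierInv_fourier_eq]
    refine integral_congr_ae ?_
    filter_upwards [h.coeFn_toLp] with x hx
    rw [hx]
  have hGconj : ∀ φ : 𝓢(𝔼, ℂ),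
      ∫ x, (u x : ℂ) * schwartzFracLaplacian s φ x = ∫ x, starRingEnd ℂ (G x) * φ x := by
    intro φ
    have h1 := congrArg (starRingEnd ℂ) (hGφ (φ.postcompCLM (Complex.conjCLE : ℂ →L[ℝ] ℂ)))
    rw [← integral_conj, ← integral_conj] at h1
    simpa [schwartzFracLaplacian_conj] using h1
  refine ⟨fun x => (G x).re, (Lp.memLp G).re, fun φ => ?_⟩
  have hi : Integrable (fun x => G x * φ x) := (Lp.memLp G).integrable_mul (φ.memLp 2)
  have hi' : Integrable (fun x => starRingEnd ℂ (G x) * φ x) :=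
    MemLp.integrable_mul (p := 2) (q := 2) (Lp.memLp G).star (φ.memLp 2)
  have h2 : ∫ x, ((G x).re : ℂ) * φ x =
      2⁻¹ * (∫ x, G x * φ x) + 2⁻¹ * ∫ x, starRingEnd ℂ (G x) * φ x := by
    rw [← integral_const_mul, ← integral_const_mul, ← integral_add (hi.const_mul _)
      (hi'.const_mul _)]
    refine integral_congr_ae (ae_of_all _ fun x => ?_)
    simp only [Complex.re_eq_add_conj]
    ring
  rw [h2, ← hGφ, ← hGconj]
  ring

end FracLaplacian

/-! ### Heat energy and Gagliardo energy -/

section Energy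

variable {V : Type*} [NormedAddCommGroup V] [InnerProductSpace ℝ V] [FiniteDimensional ℝ V]
  [MeasurableSpace V] [BorelSpace V]

theorem eLpNorm_two_sq {α F : Type*} [MeasurableSpace α] [NormedAddCommGroup F]
    (f : α → F) (μ : Measure α) : eLpNorm f 2 μ ^ 2 = ∫⁻ x, ‖f x‖ₑ ^ 2 ∂μ := by
  have h := eLpNorm_nnreal_pow_eq_lintegral (f := f) (μ := μ) (p := 2) two_ne_zero
  have e : ((2 : NNReal) : ℝ≥0∞) = 2 := rfl
  have e' : ((2 : NNReal) : ℝ) = (2 : ℕ) := rfl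
  simpa only [e, e', ENNReal.rpow_natCast] using h

/-- The squared `L²` distance between `u` and its translate by `z`. -/
def transEnergy (u : V → ℝ) (z : V) : ℝ≥0∞ := ∫⁻ x, ‖u (x + z) - u x‖ₑ ^ 2

/-- The Gaussian of total mass one whose Fourier transform is `exp (-π s ‖ξ‖ ^ 2)`; it is the heat
kernel up to the normalisation of time. -/
def heatKernel (s : ℝ) (z : V) : ℝ :=
  s ^ (-(Module.finrank ℝ V / 2 : ℝ)) * Real.exp (-(Real.pi / s) * ‖z‖ ^ 2)

/-- The Dirichlet energy at time scale `s`: with `P_s` the convolution by `heatKernel s`, this is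
`2 (‖u‖² - ⟪P_s u, u⟫)`. -/
def heatEnergy (u : V → ℝ) (s : ℝ) : ℝ≥0∞ :=
  ∫⁻ z, ENNReal.ofReal (heatKernel s z) * transEnergy u z

/-- The Gagliardo energy of order `m`: up to a constant it is
`∬ |u x - u y|² / ‖x - y‖ ^ (d + 2m)`, the singular kernel being written as a superposition of
Gaussians. -/
def gagliardo (m : ℝ) (u : V → ℝ) : ℝ≥0∞ :=
  ∫⁻ s in Set.Ioi (0 : ℝ), ENNReal.ofReal (s ^ (-1 - m)) * heatEnergy u s

omit [FiniteDimensional ℝ V] [MeasurableSpace V] [BorelSpace V] in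
theorem heatKernel_pos {s : ℝ} (hs : 0 < s) (z : V) : 0 < heatKernel s z :=
  mul_pos (Real.rpow_pos_of_pos hs _) (Real.exp_pos _)

omit [FiniteDimensional ℝ V] in
@[fun_prop]
theorem measurable_heatKernel : Measurable (fun p : ℝ × V => heatKernel p.1 p.2) := by
  unfold heatKernel; fun_prop

omit [FiniteDimensional ℝ V] in
theorem measurable_heatKernel_right (s : ℝ) : Measurable (fun z : V => heatKernel s z) := by
  unfold heatKernel; fun_prop

/-- The Fourier transform of the Gaussian, in real form. -/
theorem integral_heatKernel_mul_cos {s : ℝ} (hs : 0 < s) (ξ : V) :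
    ∫ z, heatKernel s z * Real.cos (2 * Real.pi * inner ℝ z ξ) =
      Real.exp (-(Real.pi * s * ‖ξ‖ ^ 2)) := by
  have hb : 0 < ((Real.pi / s : ℝ) : ℂ).re := by simpa using div_pos Real.pi_pos hs
  have h := fourier_gaussian_innerProductSpace hb ξ
  have hint : Integrable (fun v : V => Complex.exp (↑(-2 * Real.pi * inner ℝ v ξ) * Complex.I) •
      Complex.exp (-((Real.pi / s : ℝ) : ℂ) * ‖v‖ ^ 2)) := by
    have h1 := (GaussianFourier.integrable_cexp_neg_mul_sq_norm_add hb 0 (0 : V))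
    simp only [zero_mul, add_zero] at h1
    refine h1.norm.mono' (by fun_prop) (ae_of_all _ fun v => ?_)
    rw [norm_smul, Complex.norm_exp_ofReal_mul_I, one_mul]
  rw [Real.fourier_eq'] at h
  have hre := congrArg Complex.re h
  rw [← Complex.reCLM_apply, ← Complex.reCLM.integral_comp_comm hint] at hre
  have e1 : ∀ v : V, Complex.reCLM (Complex.exp (↑(-2 * Real.pi * inner ℝ v ξ) * Complex.I) •
      Complex.exp (-((Real.pi / s : ℝ) : ℂ) * ‖v‖ ^ 2)) =
      Real.exp (-(Real.pi / s) * ‖v‖ ^ 2) * Real.cos (2 * Real.pi * inner ℝ v ξ) := by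
    intro v
    have : Complex.exp (-((Real.pi / s : ℝ) : ℂ) * ‖v‖ ^ 2) =
        (Real.exp (-(Real.pi / s) * ‖v‖ ^ 2) : ℂ) := by push_cast; rfl
    rw [this, Complex.reCLM_apply, smul_eq_mul, Complex.re_mul_ofReal, Complex.exp_ofReal_mul_I_re,
      mul_comm, ← Real.cos_neg]
    ring_nf
  have e2 : ((Real.pi / ((Real.pi / s : ℝ) : ℂ)) ^ (Module.finrank ℝ V / 2 : ℂ) *
      Complex.exp (-Real.pi ^ 2 * ‖ξ‖ ^ 2 / ((Real.pi / s : ℝ) : ℂ))) =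
      ((s ^ (Module.finrank ℝ V / 2 : ℝ) * Real.exp (-(Real.pi * s * ‖ξ‖ ^ 2)) : ℝ) : ℂ) := by
    have hpi : (Real.pi : ℂ) ≠ 0 := by exact_mod_cast Real.pi_ne_zero
    have hs' : (s : ℂ) ≠ 0 := by exact_mod_cast hs.ne'
    rw [Complex.ofReal_mul, Complex.ofReal_cpow hs.le]
    push_cast
    congr 2
    · field_simp
    · field_simp
  rw [e2, Complex.ofReal_re] at hre
  simp only [e1] at hre
  unfold heatKernel
  simp only [mul_assoc]
  rw [integral_const_mul]
  simp only [mul_assoc] at hre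
  rw [hre, ← mul_assoc, ← Real.rpow_add hs]
  simp

theorem integral_heatKernel {s : ℝ} (hs : 0 < s) : ∫ z : V, heatKernel s z = 1 := by
  have h := integral_heatKernel_mul_cos hs (0 : V)
  simpa using h

theorem integrable_heatKernel {s : ℝ} (hs : 0 < s) : Integrable (fun z : V => heatKernel s z) := by
  by_contra h
  have h1 := integral_heatKernel (V := V) hs
  rw [integral_undef h] at h1
  exact zero_ne_one h1

theorem lintegral_heatKernel {s : ℝ} (hs : 0 < s) :
    ∫⁻ z : V, ENNReal.ofReal (heatKernel s z) = 1 := by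
  rw [← ofReal_integral_eq_lintegral_ofReal (integrable_heatKernel hs)
    (ae_of_all _ fun z => (heatKernel_pos hs z).le), integral_heatKernel hs, ENNReal.ofReal_one]

/-- The Gaussian average of `|exp (2πi⟪z, ξ⟫) - 1|² = 2 (1 - cos (2π⟪z, ξ⟫))`. -/
theorem lintegral_heatKernel_mul_cos {s : ℝ} (hs : 0 < s) (ξ : V) :
    ∫⁻ z, ENNReal.ofReal (heatKernel s z) *
        ENNReal.ofReal (2 - 2 * Real.cos (2 * Real.pi * inner ℝ z ξ)) =
      2 * ENNReal.ofReal (1 - Real.exp (-(s * (Real.pi * ‖ξ‖ ^ 2)))) := by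
  have hi := integrable_heatKernel (V := V) hs
  have hic : Integrable (fun z => heatKernel s z * Real.cos (2 * Real.pi * inner ℝ z ξ)) := by
    refine hi.mono' ((measurable_heatKernel_right s).mul (by fun_prop)).aestronglyMeasurable
      (ae_of_all _ fun z => ?_)
    rw [norm_mul, Real.norm_of_nonneg (heatKernel_pos hs z).le]
    exact mul_le_of_le_one_right (heatKernel_pos hs z).le (Real.abs_cos_le_one _)
  have h0 : ∀ z : V, 0 ≤ 2 - 2 * Real.cos (2 * Real.pi * inner ℝ z ξ) := fun z => by
    linarith [Real.cos_le_one (2 * Real.pi * inner ℝ z ξ)]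
  have e : ∀ z : V, heatKernel s z * (2 - 2 * Real.cos (2 * Real.pi * inner ℝ z ξ)) =
      2 * (heatKernel s z - heatKernel s z * Real.cos (2 * Real.pi * inner ℝ z ξ)) := fun z => by
    ring
  simp_rw [← ENNReal.ofReal_mul (heatKernel_pos hs _).le]
  rw [← ofReal_integral_eq_lintegral_ofReal]
  · simp_rw [e]
    rw [integral_const_mul, integral_sub hi hic, integral_heatKernel hs,
      integral_heatKernel_mul_cos hs, ENNReal.ofReal_mul zero_le_two, ENNReal.ofReal_ofNat]
    ring_nf
  · simp_rw [e]
    exact (hi.sub hic).const_mul 2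
  · exact ae_of_all _ fun z => mul_nonneg (heatKernel_pos hs z).le (h0 z)

theorem transEnergy_congr_ae {u v : V → ℝ} (h : u =ᵐ[volume] v) (z : V) :
    transEnergy u z = transEnergy v z := by
  refine lintegral_congr_ae ?_
  have h2 : (fun x => u (x + z)) =ᵐ[volume] fun x => v (x + z) :=
    (measurePreserving_add_right volume z).quasiMeasurePreserving.ae_eq h
  filter_upwards [h, h2] with x h1 h2
  rw [h1, h2]

theorem gagliardo_congr_ae {u v : V → ℝ} (h : u =ᵐ[volume] v) (m : ℝ) :
    gagliardo m u = gagliardo m v := by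
  simp only [gagliardo, heatEnergy, transEnergy_congr_ae h]

theorem measurable_transEnergy {u : V → ℝ} (hu : Measurable u) : Measurable (transEnergy u) :=
  Measurable.lintegral_prod_right' (f := fun p : V × V => ‖u (p.2 + p.1) - u p.2‖ₑ ^ 2)
    (by fun_prop)

theorem measurable_heatEnergy {u : V → ℝ} (hu : Measurable u) : Measurable (heatEnergy u) :=
  Measurable.lintegral_prod_right'
    (f := fun p : ℝ × V => ENNReal.ofReal (heatKernel p.1 p.2) * transEnergy u p.2)
    (measurable_heatKernel.ennreal_ofReal.mul ((measurable_transEnergy hu).comp measurable_snd))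

theorem fourierInv_comp_add_right (f : V → ℂ) (z ξ : V) :
    𝓕⁻ (fun x => f (x + z)) ξ =
      Complex.exp (↑(-(2 * Real.pi * inner ℝ z ξ)) * Complex.I) * 𝓕⁻ f ξ := by
  rw [Real.fourierInv_eq', Real.fourierInv_eq',
    ← integral_add_right_eq_self (μ := volume) (fun v => Complex.exp _ • f v) z,
    ← integral_const_mul]
  refine integral_congr_ae (ae_of_all _ fun x => ?_)
  simp only [smul_eq_mul]
  rw [← mul_assoc, ← Complex.exp_add]
  congr 2
  rw [inner_add_left]
  push_cast
  ring

theorem enorm_exp_mul_I_sub_one_sq (θ : ℝ) :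
    ‖Complex.exp (↑(-θ) * Complex.I) - 1‖ₑ ^ 2 = ENNReal.ofReal (2 - 2 * Real.cos θ) := by
  rw [← ofReal_norm, ← ENNReal.ofReal_pow (norm_nonneg _), ← Complex.normSq_eq_norm_sq,
    Complex.normSq_apply]
  congr 1
  simp only [Complex.sub_re, Complex.exp_ofReal_mul_I_re, Complex.one_re, Complex.sub_im,
    Complex.exp_ofReal_mul_I_im, Complex.one_im, Real.cos_neg, Real.sin_neg]
  nlinarith [Real.sin_sq_add_cos_sq θ]

/-- Translation by `z` multiplies the Fourier transform by a character, and Plancherel applies. -/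
theorem transEnergy_eq {u : V → ℝ} (hu : Integrable u) (hu2 : MemLp u 2) (z : V) :
    transEnergy u z = ∫⁻ ξ, ENNReal.ofReal (2 - 2 * Real.cos (2 * Real.pi * inner ℝ z ξ)) *
      ‖𝓕⁻ (fun x => (u x : ℂ)) ξ‖ₑ ^ 2 := by
  have hmp := measurePreserving_add_right (volume : Measure V) z
  have h1 : Integrable (fun x => (u (x + z) : ℂ)) := (hmp.integrable_comp_of_integrable hu).ofReal
  have h1' : Integrable (fun x => (u x : ℂ)) := hu.ofReal
  have h2 : MemLp (fun x => (u (x + z) : ℂ)) 2 volume := (hu2.comp_measurePreserving hmp).ofReal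
  have h2' : MemLp (fun x => (u x : ℂ)) 2 volume := hu2.ofReal
  have hF : ∀ ξ, 𝓕⁻ (fun x => (u (x + z) : ℂ) - u x) ξ =
      (Complex.exp (↑(-(2 * Real.pi * inner ℝ z ξ)) * Complex.I) - 1) *
        𝓕⁻ (fun x => (u x : ℂ)) ξ := by
    intro ξ
    rw [sub_mul, one_mul, ← fourierInv_comp_add_right (fun x => (u x : ℂ)), Real.fourierInv_eq,
      Real.fourierInv_eq, Real.fourierInv_eq, ← integral_sub]
    · simp only [smul_sub]
    · have := (Real.fourierIntegral_convergent_iff (-ξ)).2 h1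
      simpa using this
    · have := (Real.fourierIntegral_convergent_iff (-ξ)).2 h1'
      simpa using this
  have h := congrArg (· ^ 2) (eLpNorm_fourierInv (h1.sub h1') (h2.sub h2'))
  simp only [eLpNorm_two_sq] at h
  refine Eq.trans ?_ (h.symm.trans ?_)
  · refine lintegral_congr fun x => ?_
    simp only [Pi.sub_apply, ← Complex.ofReal_sub]
    rw [← ofReal_norm, ← ofReal_norm, Complex.norm_real]
  · refine lintegral_congr fun ξ => ?_
    change ‖𝓕⁻ (fun x => (u (x + z) : ℂ) - u x) ξ‖ₑ ^ 2 = _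
    rw [hF, enorm_mul, mul_pow, enorm_exp_mul_I_sub_one_sq]

/-- In Fourier variables the energy at scale `s` is the multiplier `2 (1 - exp (-π s ‖ξ‖²))`. -/
theorem heatEnergy_eq {u : V → ℝ} (hu : Integrable u) (hu2 : MemLp u 2) {s : ℝ} (hs : 0 < s) :
    heatEnergy u s = 2 * ∫⁻ ξ, ENNReal.ofReal (1 - Real.exp (-(s * (Real.pi * ‖ξ‖ ^ 2)))) *
      ‖𝓕⁻ (fun x => (u x : ℂ)) ξ‖ₑ ^ 2 := by
  have hc : Continuous (𝓕⁻ (fun x => (u x : ℂ))) := continuous_fourierInv hu.ofReal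
  have hk := measurable_heatKernel_right (V := V) s
  unfold heatEnergy
  simp_rw [transEnergy_eq hu hu2]
  have hm := hc.measurable
  clear hc
  generalize 𝓕⁻ (fun x => (u x : ℂ)) = w at hm ⊢
  simp_rw [← lintegral_const_mul' _ _ ENNReal.ofReal_ne_top]
  rw [lintegral_lintegral_swap, ← lintegral_const_mul' _ _ ENNReal.ofNat_ne_top]
  · refine lintegral_congr fun ξ => ?_
    simp_rw [← mul_assoc (ENNReal.ofReal (heatKernel s _))]
    rw [lintegral_mul_const, lintegral_heatKernel_mul_cos hs, mul_assoc]
    refine hk.ennreal_ofReal.mul ?_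
    fun_prop
  · refine Measurable.aemeasurable ?_
    simp only [Function.uncurry_def]
    refine (hk.comp measurable_fst).ennreal_ofReal.mul ?_
    fun_prop

/-- The constant relating `gagliardo m` to the Fourier multiplier `|2πξ|^(2m)`. -/
def gagliardoConst (m : ℝ) : ℝ≥0∞ :=
  2 * ENNReal.ofReal ((4 * Real.pi) ^ (-m)) *
    ∫⁻ s in Set.Ioi (0 : ℝ), ENNReal.ofReal (s ^ (-1 - m)) * ENNReal.ofReal (1 - Real.exp (-s))

theorem gagliardoConst_ne_zero (m : ℝ) : gagliardoConst m ≠ 0 := by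
  refine mul_ne_zero (mul_ne_zero two_ne_zero ?_) ?_
  · exact (ENNReal.ofReal_pos.2 (by positivity)).ne'
  · refine lintegral_Ioi_rpow_mul_ne_zero (by fun_prop) fun s hs => ?_
    simpa using hs

theorem gagliardoConst_ne_top {m : ℝ} (hm0 : 0 < m) (hm1 : m < 1) : gagliardoConst m ≠ ⊤ := by
  refine ENNReal.mul_ne_top (ENNReal.mul_ne_top (by simp) (by simp)) (ne_of_lt ?_)
  refine lintegral_Ioi_rpow_mul_lt_top hm0 hm1 fun s _ => ENNReal.ofReal_le_ofReal ?_
  exact le_min (by linarith [Real.exp_pos (-s)]) (by linarith [Real.add_one_le_exp (-s)])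

/-- Integrating `1 - exp (-π s ‖ξ‖²)` against `s ^ (-1 - m)` gives the symbol `|2πξ|^(2m)` up to a
constant. -/
theorem gagliardo_eq {m : ℝ} (hm0 : 0 < m) {u : V → ℝ} (hu : Integrable u) (hu2 : MemLp u 2) :
    gagliardo m u = gagliardoConst m *
      eLpNorm (fun ξ => (fracSymbol (m / 2) ξ : ℂ) * 𝓕⁻ (fun x => (u x : ℂ)) ξ) 2 volume ^ 2 := by
  have hc : Continuous (𝓕⁻ (fun x => (u x : ℂ))) := continuous_fourierInv hu.ofReal
  have hs : Continuous (fracSymbol (m / 2) : V → ℝ) := continuous_fracSymbol (by linarith)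
  rw [eLpNorm_two_sq, ← lintegral_const_mul _ (by fun_prop)]
  have h1 : gagliardo m u = ∫⁻ s in Set.Ioi (0 : ℝ), ∫⁻ ξ : V, ENNReal.ofReal (s ^ (-1 - m)) *
      (2 * (ENNReal.ofReal (1 - Real.exp (-(s * (Real.pi * ‖ξ‖ ^ 2)))) *
      ‖𝓕⁻ (fun x => (u x : ℂ)) ξ‖ₑ ^ 2)) := by
    refine setLIntegral_congr_fun measurableSet_Ioi fun s hs => ?_
    rw [heatEnergy_eq hu hu2 hs, ← lintegral_const_mul' _ _ ENNReal.ofNat_ne_top,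
      ← lintegral_const_mul' _ _ ENNReal.ofReal_ne_top]
  rw [h1, lintegral_lintegral_swap (by simp only [Function.uncurry_def]; fun_prop)]
  refine lintegral_congr fun ξ => ?_
  have h2 : ∀ s : ℝ, ENNReal.ofReal (s ^ (-1 - m)) *
      (2 * (ENNReal.ofReal (1 - Real.exp (-(s * (Real.pi * ‖ξ‖ ^ 2)))) *
      ‖𝓕⁻ (fun x => (u x : ℂ)) ξ‖ₑ ^ 2)) = (ENNReal.ofReal (s ^ (-1 - m)) *
      ENNReal.ofReal (1 - Real.exp (-(s * (Real.pi * ‖ξ‖ ^ 2))))) *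
      (2 * ‖𝓕⁻ (fun x => (u x : ℂ)) ξ‖ₑ ^ 2) := fun s => by ring
  simp_rw [h2]
  rw [lintegral_mul_const' _ _ (by finiteness), enorm_mul, mul_pow]
  rcases eq_or_ne ξ 0 with rfl | hξ
  · simp [fracSymbol, Real.zero_rpow (show (2 * (m / 2) : ℝ) ≠ 0 by linarith)]
  · have hpos : 0 < Real.pi * ‖ξ‖ ^ 2 := by positivity
    rw [lintegral_Ioi_rpow_mul_comp_mul hpos (fun s => ENNReal.ofReal (1 - Real.exp (-s)))]
    have e : (Real.pi * ‖ξ‖ ^ 2) ^ m = (4 * Real.pi) ^ (-m) * fracSymbol (m / 2) ξ ^ 2 := by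
      have : fracSymbol (m / 2) ξ ^ 2 = ((2 * Real.pi * ‖ξ‖) ^ 2) ^ m := by
        rw [fracSymbol, ← Real.rpow_natCast, ← Real.rpow_natCast, ← Real.rpow_mul (by positivity),
          ← Real.rpow_mul (by positivity)]
        congr 1; push_cast; ring
      rw [this, Real.rpow_neg (by positivity), ← Real.inv_rpow (by positivity),
        ← Real.mul_rpow (by positivity) (by positivity)]
      congr 1
      field_simp
      ring
    have e' : ‖(fracSymbol (m / 2) ξ : ℂ)‖ₑ ^ 2 = ENNReal.ofReal (fracSymbol (m / 2) ξ ^ 2) := by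
      rw [← ofReal_norm, ← ENNReal.ofReal_pow (norm_nonneg _), Complex.norm_real, Real.norm_eq_abs,
        sq_abs]
    rw [e, e', ENNReal.ofReal_mul (by positivity), gagliardoConst]
    ring

end Energy

/-! ### The Dirichlet form of the absolute value -/

section Abs

variable {V : Type*} [NormedAddCommGroup V] [InnerProductSpace ℝ V] [FiniteDimensional ℝ V]
  [MeasurableSpace V] [BorelSpace V]

theorem enorm_abs_sub_abs_sq_le (a b : ℝ) : ‖|a| - |b|‖ₑ ^ 2 ≤ ‖a - b‖ₑ ^ 2 := by
  gcongr
  rw [enorm_le_iff_norm_le, Real.norm_eq_abs, Real.norm_eq_abs]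
  exact abs_abs_sub_abs_le a b

theorem transEnergy_abs_le (u : V → ℝ) (z : V) :
    transEnergy (fun x => |u x|) z ≤ transEnergy u z :=
  lintegral_mono fun _ => enorm_abs_sub_abs_sq_le _ _

theorem heatEnergy_abs_le (u : V → ℝ) (s : ℝ) :
    heatEnergy (fun x => |u x|) s ≤ heatEnergy u s :=
  lintegral_mono fun _ => by gcongr; exact transEnergy_abs_le u _

theorem gagliardo_abs_le (m : ℝ) (u : V → ℝ) :
    gagliardo m (fun x => |u x|) ≤ gagliardo m u :=
  lintegral_mono fun _ => by gcongr; exact heatEnergy_abs_le u _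

/-- Two nonnegligible sets can be translated so as to overlap. -/
theorem measure_eq_zero_of_ae_ae_translate {A B : Set V} (hA : MeasurableSet A)
    (hB : MeasurableSet B) (h : ∀ᵐ z, ∀ᵐ x, ¬ (x ∈ A ∧ x + z ∈ B)) :
    volume A = 0 ∨ volume B = 0 := by
  by_contra! hne
  have hm : MeasurableSet {p : V × V | ¬ (p.2 ∈ A ∧ p.2 + p.1 ∈ B)} :=
    ((measurable_snd hA).inter ((measurable_snd.add measurable_fst) hB)).compl
  have h2 : ∀ᵐ x, ∀ᵐ z, ¬ (x ∈ A ∧ x + z ∈ B) := (Measure.ae_ae_comm hm).1 h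
  obtain ⟨x, hx, hxA⟩ := (h2.and_frequently (frequently_ae_mem_iff.2 hne.1)).exists
  refine hne.2 ?_
  have h3 : ∀ᵐ z, x + z ∉ B := by
    filter_upwards [hx] with z hz hB using hz ⟨hxA, hB⟩
  have h4 := (measurePreserving_add_left volume x).measure_preimage hB.nullMeasurableSet
  rw [← h4]
  exact measure_eq_zero_iff_ae_notMem.2 h3

/-- The Gagliardo energy decreases strictly when a sign-changing function is replaced by its
absolute value: equality would force `u x` and `u (x + z)` to have the same sign for almost all
`x` and `z`, the kernel being positive. -/
theorem gagliardo_abs_lt {m : ℝ} {u : V → ℝ} (hu : Measurable u) (hfin : gagliardo m u ≠ ⊤)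
    (hpos : volume {x | 0 < u x} ≠ 0) (hneg : volume {x | u x < 0} ≠ 0) :
    gagliardo m (fun x => |u x|) < gagliardo m u := by
  refine lt_of_le_of_ne (gagliardo_abs_le m u) fun heq => ?_
  have hu' : Measurable fun x => |u x| := hu.norm
  -- equality of the integrals over `s` forces equality of the energies at some scale `s`, then of
  -- the translation energies at almost every `z`, then of the integrands at almost every `x`
  have hs := ae_eq_of_ae_le_of_lintegral_le (μ := volume.restrict (Set.Ioi (0 : ℝ)))
    (f := fun s => ENNReal.ofReal (s ^ (-1 - m)) * heatEnergy (fun x => |u x|) s)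
    (g := fun s => ENNReal.ofReal (s ^ (-1 - m)) * heatEnergy u s)
    (ae_of_all _ fun s => by dsimp only; gcongr; exact heatEnergy_abs_le u s)
    (by rw [← gagliardo, heq]; exact hfin)
    ((Measurable.mul (by fun_prop) (measurable_heatEnergy hu)).aemeasurable) heq.ge
  have hfin' := ae_lt_top' (μ := volume.restrict (Set.Ioi (0 : ℝ)))
    ((Measurable.mul (f := fun s : ℝ => ENNReal.ofReal (s ^ (-1 - m))) (by fun_prop)
      (measurable_heatEnergy hu)).aemeasurable) hfin
  have hne : (volume.restrict (Set.Ioi (0 : ℝ))) ≠ 0 := by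
    rw [Ne, Measure.restrict_eq_zero]; simp
  have : (ae (volume.restrict (Set.Ioi (0 : ℝ)))).NeBot := ae_neBot.2 hne
  obtain ⟨s, ⟨hs1, hs2⟩, hs0⟩ := ((hs.and hfin').and (ae_restrict_mem measurableSet_Ioi)).exists
  have hc : ENNReal.ofReal (s ^ (-1 - m)) ≠ 0 :=
    (ENNReal.ofReal_pos.2 (Real.rpow_pos_of_pos hs0 _)).ne'
  have hs3 : heatEnergy (fun x => |u x|) s = heatEnergy u s :=
    (ENNReal.mul_right_inj hc ENNReal.ofReal_ne_top).1 hs1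
  have hs4 : heatEnergy u s ≠ ⊤ := fun h => by
    rw [Pi.mul_apply, h, ENNReal.mul_top hc] at hs2
    exact lt_irrefl _ hs2
  have hk := (measurable_heatKernel_right (V := V) s).ennreal_ofReal
  have hz := ae_eq_of_ae_le_of_lintegral_le (μ := volume)
    (f := fun z : V => ENNReal.ofReal (heatKernel s z) * transEnergy (fun x => |u x|) z)
    (g := fun z : V => ENNReal.ofReal (heatKernel s z) * transEnergy u z)
    (ae_of_all _ fun s => by dsimp only; gcongr; exact transEnergy_abs_le u s)
    (by rw [← heatEnergy, hs3]; exact hs4)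
    (hk.mul (measurable_transEnergy hu)).aemeasurable hs3.ge
  have hzfin := ae_lt_top' (hk.mul (measurable_transEnergy hu)).aemeasurable hs4
  refine (measure_eq_zero_of_ae_ae_translate (measurableSet_lt measurable_const hu)
    (measurableSet_lt hu measurable_const) ?_).elim hpos hneg
  filter_upwards [hz, hzfin] with z hz1 hz2
  have hc : ENNReal.ofReal (heatKernel s z) ≠ 0 := (ENNReal.ofReal_pos.2 (heatKernel_pos hs0 z)).ne'
  have hz3 : transEnergy (fun x => |u x|) z = transEnergy u z :=
    (ENNReal.mul_right_inj hc ENNReal.ofReal_ne_top).1 hz1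
  have hz4 : transEnergy u z ≠ ⊤ := fun h => by
    rw [Pi.mul_apply, h, ENNReal.mul_top hc] at hz2
    exact lt_irrefl _ hz2
  have hx := ae_eq_of_ae_le_of_lintegral_le (μ := volume)
    (f := fun x : V => ‖|u (x + z)| - |u x|‖ₑ ^ 2) (g := fun x : V => ‖u (x + z) - u x‖ₑ ^ 2)
    (ae_of_all _ fun x => enorm_abs_sub_abs_sq_le _ _)
    (by rw [← transEnergy.eq_1 (fun x => |u x|), hz3]; exact hz4)
    (by fun_prop) hz3.ge
  filter_upwards [hx] with x hx ⟨h1, h2⟩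
  change 0 < u x at h1
  change u (x + z) < 0 at h2
  rw [abs_of_neg h2, abs_of_pos h1, ← ofReal_norm, ← ofReal_norm,
    ← ENNReal.ofReal_pow (norm_nonneg _), ← ENNReal.ofReal_pow (norm_nonneg _),
    ENNReal.ofReal_eq_ofReal_iff (by positivity) (by positivity), Real.norm_eq_abs,
    Real.norm_eq_abs, sq_abs, sq_abs] at hx
  nlinarith

end Abs

section DirichletForm

variable {n : ℕ}

local notation "𝔼" => EuclideanSpace ℝ (Fin n)

/-- For `u ∈ L¹ ∩ L²`, membership in the domain of `(-Δ)^(m/2)` is finiteness of the Gagliardo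
energy. -/
theorem exists_isFracLaplacian_iff {m : ℝ} (hm0 : 0 < m) (hm1 : m < 1) {u : 𝔼 → ℝ}
    (hu : Integrable u) (hu2 : MemLp u 2) :
    (∃ g : 𝔼 → ℝ, MemLp g 2 ∧ IsFracLaplacian (m / 2) u g) ↔ gagliardo m u ≠ ⊤ := by
  have hc : Continuous (𝓕⁻ (fun x => (u x : ℂ))) := continuous_fourierInv hu.ofReal
  have hs : Continuous (fracSymbol (m / 2) : 𝔼 → ℝ) := continuous_fracSymbol (by linarith)
  rw [gagliardo_eq hm0 hu hu2]
  constructor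
  · rintro ⟨g, hg, h⟩
    rw [← h.eLpNorm_eq (by linarith) (by linarith) hu hg]
    exact ENNReal.mul_ne_top (gagliardoConst_ne_top hm0 hm1) (by finiteness [hg.2.ne])
  · intro h
    refine exists_isFracLaplacian (by linarith) (by linarith) hu
      ⟨(by fun_prop : Continuous _).aestronglyMeasurable, lt_top_iff_ne_top.2 fun htop => ?_⟩
    rw [htop] at h
    simp [ENNReal.mul_top (gagliardoConst_ne_zero m)] at h

/-- The assumption `h` excludes the functions to which `fracLaplacian` assigns the junk value `0`.
-/
theorem gagliardo_eq_dirichletForm {m : ℝ} (hm0 : 0 < m) (hm1 : m < 1) {u : 𝔼 → ℝ}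
    (hu : Integrable u) (hu2 : MemLp u 2)
    (h : ∃ g : 𝔼 → ℝ, MemLp g 2 ∧ IsFracLaplacian (m / 2) u g) :
    gagliardo m u = gagliardoConst m * ENNReal.ofReal (dirichletForm m u) := by
  have h1 : MemLp (fracLaplacian (m / 2) u) 2 ∧
      IsFracLaplacian (m / 2) u (fracLaplacian (m / 2) u) := by
    rw [fracLaplacian, dif_pos h]
    exact h.choose_spec
  rw [gagliardo_eq hm0 hu hu2, ← h1.2.eLpNorm_eq (by linarith) (by linarith) hu h1.1,
    eLpNorm_two_sq, dirichletForm, ofReal_integral_eq_lintegral_ofReal]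
  · congr 1
    refine lintegral_congr fun x => ?_
    rw [← ofReal_norm, ← ENNReal.ofReal_pow (norm_nonneg _), Real.norm_eq_abs]
  · simpa using h1.1.integrable_norm_pow two_ne_zero
  · exact ae_of_all _ fun x => by positivity

theorem two_le_sobolevExponent {m : ℝ} (hm0 : 0 < m) : 2 ≤ sobolevExponent n m := by
  unfold sobolevExponent
  split_ifs with h
  · rw [← ENNReal.ofReal_ofNat]
    refine ENNReal.ofReal_le_ofReal ?_
    rw [le_div_iff₀ (by linarith)]
    linarith
  · exact le_rfl

/-- Functions in `H̃^m(Ω)` have compact support, so that they are in `L¹ ∩ L²`. -/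
theorem MemHTilde.integrable_and_memLp {m : ℝ} (hm0 : 0 < m) {Ω : Set 𝔼}
    (hΩ : Bornology.IsBounded Ω) {u : 𝔼 → ℝ} (hu : MemHTilde m Ω u) :
    Integrable u ∧ MemLp u 2 := by
  have hK : IsCompact (closure Ω) := hΩ.isCompact_closure
  have : IsFiniteMeasure (volume.restrict (closure Ω)) :=
    ⟨by simpa using hK.measure_lt_top⟩
  have hi : (closure Ω).indicator u =ᵐ[volume] u := by
    filter_upwards [hu.2] with x hx
    by_cases h : x ∈ closure Ω
    · simp [h]
    · simp [h, hx h]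
  have hp := hu.1.1.restrict (closure Ω)
  have h2 : MemLp u 2 (volume.restrict (closure Ω)) :=
    hp.mono_exponent (two_le_sobolevExponent hm0)
  have h1 : MemLp u 1 (volume.restrict (closure Ω)) := h2.mono_exponent (by norm_num)
  have h1' : IntegrableOn u (closure Ω) := memLp_one_iff_integrable.1 h1
  exact ⟨(h1'.integrable_indicator hK.measurableSet).congr hi,
    ((memLp_indicator_iff_restrict hK.measurableSet).2 h2).ae_eq hi⟩

end DirichletForm

/-! ### The resolvent of the Dirichlet Laplacian -/

section Resolvent

variable {n : ℕ}

local notation "𝔼" => EuclideanSpace ℝ (Fin n)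

theorem IsTestFunction.gradient_add {Ω : Set 𝔼} {ψ χ : 𝔼 → ℝ} (hψ : IsTestFunction Ω ψ)
    (hχ : IsTestFunction Ω χ) (x : 𝔼) :
    gradient (ψ + χ) x = gradient ψ x + gradient χ x := by
  simp only [gradient]
  rw [fderiv_add (hψ.contDiff.differentiable (by simp) x)
    (hχ.contDiff.differentiable (by simp) x), map_add]

/-- The Hilbert space `L²(Ω) ⊕ L²(Ω; ℝⁿ)`, in which `H¹₀(Ω)` is realised as the space of pairs
`(v, √s ∇v)`. -/
abbrev L2Pair (Ω : Set 𝔼) : Type := WithLp 2 (L2 Ω ℝ × L2 Ω 𝔼)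

/-- The element `(ψ, √s ∇ψ)` of `L²(Ω) ⊕ L²(Ω; ℝⁿ)` for a test function `ψ`. -/
def IsTestFunction.toPair {Ω : Set 𝔼} {ψ : 𝔼 → ℝ} (h : IsTestFunction Ω ψ) (s : ℝ) : L2Pair Ω :=
  WithLp.toLp 2 (h.memLp.toLp ψ, Real.sqrt s • h.memLp_gradient.toLp (gradient ψ))

/-- The pairs `(ψ, √s ∇ψ)` with `ψ ∈ C_c^∞(Ω)`. -/
def testPairs (Ω : Set 𝔼) (s : ℝ) : Submodule ℝ (L2Pair Ω) where
  carrier := {p | ∃ (ψ : 𝔼 → ℝ) (h : IsTestFunction Ω ψ), h.toPair s = p}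
  zero_mem' := by
    refine ⟨0, IsTestFunction.zero Ω, ?_⟩
    have h1 : (IsTestFunction.zero Ω).memLp.toLp 0 = (0 : L2 Ω ℝ) := MemLp.toLp_zero _
    have h2 : (IsTestFunction.zero Ω).memLp_gradient.toLp (gradient 0) = (0 : L2 Ω 𝔼) := by
      rw [← MemLp.toLp_zero (MemLp.zero : MemLp (0 : 𝔼 → 𝔼) 2 (volume.restrict Ω))]
      exact MemLp.toLp_congr _ _ (ae_of_all _ fun x => by simp [gradient])
    rw [IsTestFunction.toPair, h1, h2, smul_zero]
    rfl
  add_mem' := by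
    rintro _ _ ⟨ψ, hψ, rfl⟩ ⟨χ, hχ, rfl⟩
    refine ⟨ψ + χ, hψ.add hχ, ?_⟩
    have h1 : (hψ.add hχ).memLp.toLp (ψ + χ) = hψ.memLp.toLp ψ + hχ.memLp.toLp χ :=
      MemLp.toLp_add _ _
    have h2 : (hψ.add hχ).memLp_gradient.toLp (gradient (ψ + χ)) =
        hψ.memLp_gradient.toLp (gradient ψ) + hχ.memLp_gradient.toLp (gradient χ) := by
      rw [← MemLp.toLp_add]
      exact MemLp.toLp_congr _ _ (ae_of_all _ fun x => hψ.gradient_add hχ x)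
    rw [IsTestFunction.toPair, h1, h2, smul_add]
    rfl
  smul_mem' := by
    rintro c _ ⟨ψ, hψ, rfl⟩
    refine ⟨c • ψ, hψ.smul c, ?_⟩
    have h1 : (hψ.smul c).memLp.toLp (c • ψ) = c • hψ.memLp.toLp ψ := MemLp.toLp_const_smul _ _
    have h2 : (hψ.smul c).memLp_gradient.toLp (gradient (c • ψ)) =
        c • hψ.memLp_gradient.toLp (gradient ψ) := by
      rw [← MemLp.toLp_const_smul]
      exact MemLp.toLp_congr _ _ (ae_of_all _ fun x => hψ.gradient_smul c x)
    rw [IsTestFunction.toPair, h1, h2, smul_comm]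
    rfl

/-- The closed subspace of the pairs `(v, √s ∇v)` with `v ∈ H¹₀(Ω)`. -/
def formDomain (Ω : Set 𝔼) (s : ℝ) : Submodule ℝ (L2Pair Ω) := (testPairs Ω s).topologicalClosure

instance (Ω : Set 𝔼) (s : ℝ) : CompleteSpace (formDomain Ω s) :=
  (testPairs Ω s).isClosed_topologicalClosure.completeSpace_coe

theorem IsTestFunction.toPair_mem {Ω : Set 𝔼} {ψ : 𝔼 → ℝ} (h : IsTestFunction Ω ψ) (s : ℝ) :
    h.toPair s ∈ formDomain Ω s :=
  (testPairs Ω s).le_topologicalClosure ⟨ψ, h, rfl⟩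

theorem exists_seq_of_mem_formDomain {Ω : Set 𝔼} {s : ℝ} {p : L2Pair Ω} (hp : p ∈ formDomain Ω s) :
    ∃ (ψ : ℕ → 𝔼 → ℝ) (h : ∀ k, IsTestFunction Ω (ψ k)),
      Tendsto (fun k => (h k).toPair s) atTop (𝓝 p) := by
  obtain ⟨x, hx, hxp⟩ := mem_closure_iff_seq_limit.1 hp
  choose ψ h hψ using hx
  exact ⟨ψ, h, by simpa only [hψ] using hxp⟩

/-- The pair `(f, 0)`. -/
def L2Pair.inl (Ω : Set 𝔼) : L2 Ω ℝ →L[ℝ] L2Pair Ω :=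
  ((WithLp.prodContinuousLinearEquiv 2 ℝ (L2 Ω ℝ) (L2 Ω 𝔼)).symm : _ →L[ℝ] L2Pair Ω) ∘L
    ContinuousLinearMap.inl ℝ (L2 Ω ℝ) (L2 Ω 𝔼)

@[simp] theorem L2Pair.inl_fst {Ω : Set 𝔼} (f : L2 Ω ℝ) : (L2Pair.inl Ω f).fst = f := rfl

@[simp] theorem L2Pair.inl_snd {Ω : Set 𝔼} (f : L2 Ω ℝ) : (L2Pair.inl Ω f).snd = 0 := rfl

theorem L2Pair.inner_eq {Ω : Set 𝔼} (p q : L2Pair Ω) :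
    inner ℝ p q = inner ℝ p.fst q.fst + inner ℝ p.snd q.snd := WithLp.prod_inner_apply p q

theorem L2Pair.norm_sq_eq {Ω : Set 𝔼} (p : L2Pair Ω) :
    ‖p‖ ^ 2 = ‖p.fst‖ ^ 2 + ‖p.snd‖ ^ 2 := WithLp.prod_norm_sq_eq_of_L2 p

/-- The pair `(v, √s ∇v)` where `v = (1 - sΔ)⁻¹ f`: it is the orthogonal projection of `(f, 0)`. -/
def resolventPair (Ω : Set 𝔼) (s : ℝ) (f : L2 Ω ℝ) : L2Pair Ω :=
  (formDomain Ω s).starProjection (L2Pair.inl Ω f)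

/-- The resolvent `(1 - sΔ)⁻¹` of the Dirichlet Laplacian on `L²(Ω)`. -/
def resolvent₀ (Ω : Set 𝔼) (s : ℝ) : L2 Ω ℝ →L[ℝ] L2 Ω ℝ :=
  (WithLp.fstL 2 ℝ (L2 Ω ℝ) (L2 Ω 𝔼)) ∘L (formDomain Ω s).starProjection ∘L L2Pair.inl Ω

variable {Ω : Set (EuclideanSpace ℝ (Fin n))} {s : ℝ}

theorem resolventPair_fst (f : L2 Ω ℝ) : (resolventPair Ω s f).fst = resolvent₀ Ω s f := rfl

theorem resolventPair_mem (f : L2 Ω ℝ) : resolventPair Ω s f ∈ formDomain Ω s :=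
  Submodule.starProjection_apply_mem _ _

theorem inner_resolvent_eq (f g : L2 Ω ℝ) :
    inner ℝ (resolvent₀ Ω s f) g = inner ℝ (resolventPair Ω s f) (L2Pair.inl Ω g) := by
  rw [L2Pair.inner_eq, L2Pair.inl_fst, L2Pair.inl_snd, inner_zero_right, add_zero,
    resolventPair_fst]

theorem resolvent_isSymmetric : (resolvent₀ Ω s).IsSymmetric := fun f g => by
  change inner ℝ (resolvent₀ Ω s f) g = inner ℝ f (resolvent₀ Ω s g)
  rw [inner_resolvent_eq, ← real_inner_comm f, inner_resolvent_eq]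
  exact (Submodule.inner_starProjection_left_eq_right (formDomain Ω s) _ _).trans
    (real_inner_comm _ _)

/-- The resolvent is a compression of an orthogonal projection, hence nonnegative. -/
theorem inner_resolvent_self (f : L2 Ω ℝ) :
    inner ℝ (resolvent₀ Ω s f) f = ‖resolventPair Ω s f‖ ^ 2 := by
  rw [inner_resolvent_eq, ← real_inner_self_eq_norm_sq, ← sub_eq_zero, ← inner_sub_right,
    real_inner_comm]
  exact Submodule.starProjection_inner_eq_zero _ _ (resolventPair_mem f)

theorem norm_inl (f : L2 Ω ℝ) : ‖L2Pair.inl Ω f‖ = ‖f‖ := by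
  rw [← sq_eq_sq₀ (norm_nonneg _) (norm_nonneg _), L2Pair.norm_sq_eq]
  simp

/-- The Pythagorean identity behind the variational characterisation of the resolvent. -/
theorem norm_inl_sub_sq (f : L2 Ω ℝ) {q : L2Pair Ω} (hq : q ∈ formDomain Ω s) :
    ‖L2Pair.inl Ω f - q‖ ^ 2 =
      (‖f‖ ^ 2 - inner ℝ (resolvent₀ Ω s f) f) + ‖resolventPair Ω s f - q‖ ^ 2 := by
  have h1 : ∀ r ∈ formDomain Ω s, inner ℝ (L2Pair.inl Ω f - resolventPair Ω s f) r = 0 :=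
    fun r hr => Submodule.starProjection_inner_eq_zero _ _ hr
  have h2 : L2Pair.inl Ω f - q =
      (L2Pair.inl Ω f - resolventPair Ω s f) + (resolventPair Ω s f - q) := by abel
  have h3 : L2Pair.inl Ω f = (L2Pair.inl Ω f - resolventPair Ω s f) + resolventPair Ω s f := by abel
  have h4 := norm_add_sq_real (L2Pair.inl Ω f - resolventPair Ω s f) (resolventPair Ω s f)
  rw [← h3, norm_inl, h1 _ (resolventPair_mem f)] at h4
  rw [h2, norm_add_sq_real, h1 _ (Submodule.sub_mem _ (resolventPair_mem f) hq),
    inner_resolvent_self]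
  linarith

theorem inner_resolvent_self_nonneg (f : L2 Ω ℝ) : 0 ≤ inner ℝ (resolvent₀ Ω s f) f := by
  rw [inner_resolvent_self]; positivity

theorem inner_resolvent_self_le (f : L2 Ω ℝ) : inner ℝ (resolvent₀ Ω s f) f ≤ ‖f‖ ^ 2 := by
  have h := norm_inl_sub_sq (s := s) f (resolventPair_mem f)
  rw [sub_self, norm_zero] at h
  nlinarith [sq_nonneg ‖L2Pair.inl Ω f - resolventPair Ω s f‖]

/-- The weak form of the equation `v - sΔv = f` satisfied by `v = (1 - sΔ)⁻¹ f`. -/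
theorem inner_sub_resolvent (f : L2 Ω ℝ) {ψ : 𝔼 → ℝ} (hψ : IsTestFunction Ω ψ) :
    inner ℝ (f - resolvent₀ Ω s f) (hψ.memLp.toLp ψ) =
      Real.sqrt s * inner ℝ (resolventPair Ω s f).snd (hψ.memLp_gradient.toLp (gradient ψ)) := by
  have h := Submodule.starProjection_inner_eq_zero (K := formDomain Ω s) (L2Pair.inl Ω f) _
    (hψ.toPair_mem s)
  rw [L2Pair.inner_eq] at h
  have h' : inner ℝ (f - resolvent₀ Ω s f) (hψ.memLp.toLp ψ) +
    inner ℝ (0 - (resolventPair Ω s f).snd)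
      (Real.sqrt s • hψ.memLp_gradient.toLp (gradient ψ)) = 0 := h
  rw [zero_sub, inner_neg_left, real_inner_smul_right] at h'
  linarith

theorem inner_toLp_eq {F : Type} [NormedAddCommGroup F] [InnerProductSpace ℝ F] (f : L2 Ω F)
    {g : 𝔼 → F} (hg : MemLp g 2 (volume.restrict Ω)) :
    inner ℝ f (hg.toLp g) = ∫ x in Ω, inner ℝ (f x) (g x) := by
  rw [L2.inner_def]
  refine integral_congr_ae ?_
  filter_upwards [hg.coeFn_toLp] with x hx
  rw [hx]

theorem inner_test_eq (v : L2 Ω ℝ) {ψ : 𝔼 → ℝ} (hψ : IsTestFunction Ω ψ) :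
    inner ℝ v (hψ.memLp.toLp ψ) = ∫ x in Ω, v x * ψ x := by
  rw [inner_toLp_eq]
  refine integral_congr_ae (ae_of_all _ fun x => ?_)
  simp [mul_comm]

theorem eLpNorm_sub_eq_norm {F : Type} [NormedAddCommGroup F] (v : L2 Ω F) {g : 𝔼 → F}
    (hg : MemLp g 2 (volume.restrict Ω)) :
    eLpNorm (fun x => g x - v x) 2 (volume.restrict Ω) = ENNReal.ofReal ‖hg.toLp g - v‖ := by
  rw [ofReal_norm, Lp.enorm_def]
  refine eLpNorm_congr_ae ?_
  filter_upwards [Lp.coeFn_sub (hg.toLp g) v, hg.coeFn_toLp] with x h1 h2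
  rw [h1, Pi.sub_apply, h2]

theorem tendsto_eLpNorm_sub_iff {F : Type} [NormedAddCommGroup F] (v : L2 Ω F) {g : ℕ → 𝔼 → F}
    (hg : ∀ k, MemLp (g k) 2 (volume.restrict Ω)) :
    Tendsto (fun k => eLpNorm (fun x => g k x - v x) 2 (volume.restrict Ω)) atTop (𝓝 0) ↔
      Tendsto (fun k => (hg k).toLp (g k)) atTop (𝓝 v) := by
  simp only [eLpNorm_sub_eq_norm v (hg _)]
  rw [tendsto_iff_norm_sub_tendsto_zero, ← ENNReal.ofReal_zero]
  constructor
  · intro h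
    have := (ENNReal.tendsto_toReal ENNReal.ofReal_ne_top).comp h
    simpa [Function.comp_def, ENNReal.toReal_ofReal (norm_nonneg _)] using this
  · exact fun h => ENNReal.tendsto_ofReal h

/-- Weak gradients of `H¹₀(Ω)` functions define elements of the form domain, for every `s`. -/
theorem HasH10Gradient.mem_formDomain {v : L2 Ω ℝ} {G : L2 Ω 𝔼} (h : HasH10Gradient Ω v G) :
    WithLp.toLp 2 (v, Real.sqrt s • G) ∈ formDomain Ω s := by
  obtain ⟨ψ, hψ, h1, h2⟩ := h
  rw [tendsto_eLpNorm_sub_iff v fun k => (hψ k).memLp] at h1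
  rw [tendsto_eLpNorm_sub_iff G fun k => (hψ k).memLp_gradient] at h2
  refine mem_closure_of_tendsto (b := atTop) (f := fun k => (hψ k).toPair s) ?_
    (Eventually.of_forall fun k => ⟨ψ k, hψ k, rfl⟩)
  exact ((WithLp.prodContinuousLinearEquiv 2 ℝ (L2 Ω ℝ) (L2 Ω 𝔼)).symm.continuous.tendsto _).comp
    (h1.prodMk_nhds (h2.const_smul _))

theorem tendsto_fst_of_toPair {ψ : ℕ → 𝔼 → ℝ} {h : ∀ k, IsTestFunction Ω (ψ k)} {p : L2Pair Ω}
    (hp : Tendsto (fun k => (h k).toPair s) atTop (𝓝 p)) :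
    Tendsto (fun k => (h k).memLp.toLp (ψ k)) atTop (𝓝 p.fst) :=
  ((WithLp.fstL 2 ℝ (L2 Ω ℝ) (L2 Ω 𝔼)).continuous.tendsto _).comp hp

theorem tendsto_snd_of_toPair {ψ : ℕ → 𝔼 → ℝ} {h : ∀ k, IsTestFunction Ω (ψ k)} {p : L2Pair Ω}
    (hp : Tendsto (fun k => (h k).toPair s) atTop (𝓝 p)) :
    Tendsto (fun k => Real.sqrt s • (h k).memLp_gradient.toLp (gradient (ψ k))) atTop
      (𝓝 p.snd) :=
  ((WithLp.sndL 2 ℝ (L2 Ω ℝ) (L2 Ω 𝔼)).continuous.tendsto _).comp hp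

/-- At `s = 1` the form domain is exactly the graph of the gradient on `H¹₀(Ω)`. -/
theorem hasH10Gradient_of_mem_formDomain {p : L2Pair Ω} (hp : p ∈ formDomain Ω 1) :
    HasH10Gradient Ω p.fst p.snd := by
  obtain ⟨ψ, h, hψ⟩ := exists_seq_of_mem_formDomain hp
  refine ⟨ψ, h, (tendsto_eLpNorm_sub_iff _ fun k => (h k).memLp).2 (tendsto_fst_of_toPair hψ),
    (tendsto_eLpNorm_sub_iff _ fun k => (h k).memLp_gradient).2 ?_⟩
  simpa using tendsto_snd_of_toPair hψ

theorem mem_formDomain_orthogonal {q : L2Pair Ω}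
    (h : ∀ (ψ : 𝔼 → ℝ) (hψ : IsTestFunction Ω ψ), inner ℝ q (hψ.toPair s) = 0) :
    q ∈ (formDomain Ω s)ᗮ := by
  rw [formDomain, Submodule.orthogonal_closure, Submodule.mem_orthogonal']
  rintro _ ⟨ψ, hψ, rfl⟩
  exact h ψ hψ

/-- An eigenfunction for `μ` is an eigenvector of the resolvent for `1 / (1 + s μ)`. Division is
avoided since `μ` is not known to be nonnegative. -/
theorem IsDirichletEigenvector.smul_resolvent {μ : ℝ} {v : L2 Ω ℝ}
    (hv : IsDirichletEigenvector Ω μ v) (hs : 0 < s) :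
    (1 + s * μ) • resolvent₀ Ω s v = v := by
  obtain ⟨G, hG, hw⟩ := hv
  have key : resolventPair Ω s ((1 + s * μ) • v) = WithLp.toLp 2 (v, Real.sqrt s • G) := by
    refine (Submodule.eq_starProjection_of_mem_orthogonal hG.mem_formDomain
      (mem_formDomain_orthogonal fun ψ hψ => ?_))
    have e : inner ℝ ((1 + s * μ) • v - v) (hψ.memLp.toLp ψ) +
      inner ℝ (0 - Real.sqrt s • G) (Real.sqrt s • hψ.memLp_gradient.toLp (gradient ψ)) = 0 := by
      have h1 := hw ψ hψ
      rw [← inner_test_eq v hψ, ← inner_toLp_eq G hψ.memLp_gradient] at h1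
      rw [zero_sub, inner_neg_left, real_inner_smul_left, real_inner_smul_right, h1,
        inner_sub_left, real_inner_smul_left]
      linear_combination (-(μ * inner ℝ v (hψ.memLp.toLp ψ))) * Real.mul_self_sqrt hs.le
    rw [L2Pair.inner_eq]
    exact e
  rw [← map_smul, ← resolventPair_fst, key]
  rfl

/-- Nonzero eigenvalues `κ = 1 / (1 + μ)` of the resolvent come from eigenvalues `μ` of `-Δ`. -/
theorem isDirichletEigenvector_of_resolvent {κ : ℝ} (hκ : κ ≠ 0) {v : L2 Ω ℝ}
    (hv : resolvent₀ Ω 1 v = κ • v) : IsDirichletEigenvector Ω ((1 - κ) / κ) v := by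
  have h1 := hasH10Gradient_of_mem_formDomain (resolventPair_mem (s := 1) v)
  rw [resolventPair_fst, hv] at h1
  have h2 := h1.smul κ⁻¹
  rw [inv_smul_smul₀ hκ] at h2
  refine ⟨_, h2, fun ψ hψ => ?_⟩
  have h3 := inner_sub_resolvent (s := 1) v hψ
  rw [hv, Real.sqrt_one, one_mul, inner_sub_left, real_inner_smul_left] at h3
  rw [← inner_test_eq v hψ, ← inner_toLp_eq _ hψ.memLp_gradient, real_inner_smul_left, ← h3]
  field_simp

/-- The resolvent is injective: if `v = (1 - sΔ)⁻¹ f` vanishes, the weak equation says that `f` is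
orthogonal to all test functions. -/
theorem eq_zero_of_resolvent_eq_zero (hΩ : IsOpen Ω) {f : L2 Ω ℝ}
    (hf : resolvent₀ Ω s f = 0) : f = 0 := by
  have h0 : resolventPair Ω s f = 0 := by
    have := inner_resolvent_self (s := s) f
    rw [hf, inner_zero_left] at this
    exact norm_eq_zero.1 (pow_eq_zero_iff two_ne_zero |>.1 this.symm)
  have h1 : ∀ᵐ x, x ∈ Ω → f x = 0 := by
    refine hΩ.ae_eq_zero_of_integral_contDiff_smul_eq_zero ?_ fun ψ h1 h2 h3 => ?_
    · exact locallyIntegrableOn_of_locallyIntegrable_restrict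
        ((Lp.memLp f).locallyIntegrable (by norm_num))
    · have hψ : IsTestFunction Ω ψ := ⟨h1, h2, h3⟩
      have h := inner_sub_resolvent (s := s) f hψ
      rw [h0, hf, sub_zero, WithLp.zero_snd, inner_zero_left, mul_zero, inner_test_eq f hψ] at h
      rw [← h, ← setIntegral_eq_integral_of_forall_compl_eq_zero (s := Ω)]
      · exact integral_congr_ae (ae_of_all _ fun x => by simp [mul_comm])
      · intro x hx
        rw [image_eq_zero_of_notMem_tsupport fun h => hx (h3 h), zero_smul]
  refine Lp.ext ?_
  filter_upwards [ae_restrict_of_ae h1, ae_restrict_mem hΩ.measurableSet,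
    Lp.coeFn_zero ℝ 2 (volume.restrict Ω)] with x hx hxΩ h0
  rw [hx hxΩ, h0, Pi.zero_apply]

end Resolvent

/-! ### Averages of test functions over grids -/

section CauchySchwarz

variable {α : Type*} [MeasurableSpace α] {μ : Measure α}

theorem lintegral_sq_le_measure_univ_mul {b : α → ℝ≥0∞} (hb : AEMeasurable b μ) :
    (∫⁻ x, b x ∂μ) ^ 2 ≤ μ Set.univ * ∫⁻ x, b x ^ 2 ∂μ := by
  have h := ENNReal.lintegral_mul_le_Lp_mul_Lq μ Real.HolderConjugate.two_two
    (aemeasurable_const (b := (1 : ℝ≥0∞))) hb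
  simp only [Pi.mul_apply, one_mul, ENNReal.one_rpow, lintegral_const] at h
  calc (∫⁻ x, b x ∂μ) ^ 2
      ≤ (μ Set.univ ^ (1 / 2 : ℝ) * (∫⁻ x, b x ^ (2 : ℝ) ∂μ) ^ (1 / 2 : ℝ)) ^ 2 := by gcongr
    _ = μ Set.univ * ∫⁻ x, b x ^ 2 ∂μ := by
      rw [mul_pow, ← ENNReal.rpow_natCast, ← ENNReal.rpow_natCast, ← ENNReal.rpow_mul,
        ← ENNReal.rpow_mul]
      norm_num

/-- The Cauchy-Schwarz inequality with a weight `a`. -/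
theorem lintegral_mul_sq_le {a b : α → ℝ≥0∞} (ha : AEMeasurable a μ) (hb : Measurable b) :
    (∫⁻ x, a x * b x ∂μ) ^ 2 ≤ (∫⁻ x, a x ∂μ) * ∫⁻ x, a x * b x ^ 2 ∂μ := by
  have h := lintegral_sq_le_measure_univ_mul (μ := μ.withDensity a) hb.aemeasurable
  rw [lintegral_withDensity_eq_lintegral_mul₀ ha hb.aemeasurable,
    lintegral_withDensity_eq_lintegral_mul₀ ha (hb.pow_const 2).aemeasurable, withDensity_apply _ .univ,
    setLIntegral_univ] at h
  exact h

end CauchySchwarz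

section Rellich

variable {n : ℕ}

local notation "𝔼" => EuclideanSpace ℝ (Fin n)

theorem norm_gradient_eq (ψ : 𝔼 → ℝ) (x : 𝔼) : ‖gradient ψ x‖ = ‖fderiv ℝ ψ x‖ := by
  simp [gradient]

theorem fderiv_eq_inner_gradient (ψ : 𝔼 → ℝ) (x z : 𝔼) :
    fderiv ℝ ψ x z = inner ℝ (gradient ψ x) z := by
  simp [gradient]

/-- Translations move a smooth function in `L²` at most as fast as its gradient allows. -/
theorem transEnergy_le_gradient {Ω : Set 𝔼} {ψ : 𝔼 → ℝ} (hψ : IsTestFunction Ω ψ) (z : 𝔼) :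
    transEnergy ψ z ≤ ‖z‖ₑ ^ 2 * ∫⁻ x, ‖gradient ψ x‖ₑ ^ 2 := by
  have hg : Continuous (gradient ψ) := hψ.continuous_gradient
  have hd : ∀ (x : 𝔼) (t : ℝ), HasDerivAt (fun t : ℝ => ψ (x + t • z))
      (inner ℝ (gradient ψ (x + t • z)) z) t := by
    intro x t
    have h1 : HasDerivAt (fun t : ℝ => x + t • z) z t := by
      simpa using ((hasDerivAt_id t).smul_const z).const_add x
    have h2 := (hψ.contDiff.differentiable (by simp) (x + t • z)).hasFDerivAt.comp_hasDerivAt t h1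
    rwa [fderiv_eq_inner_gradient] at h2
  generalize gradient ψ = g at hg hd ⊢
  have hgm : Measurable g := hg.measurable
  have hpt : ∀ x, ‖ψ (x + z) - ψ x‖ₑ ^ 2 ≤
      ‖z‖ₑ ^ 2 * ∫⁻ t in Set.Ioc (0 : ℝ) 1, ‖g (x + t • z)‖ₑ ^ 2 := by
    intro x
    have hcont : Continuous fun t : ℝ => inner ℝ (g (x + t • z)) z := by fun_prop
    have h3 := intervalIntegral.integral_eq_sub_of_hasDerivAt (fun t _ => hd x t)
      (hcont.intervalIntegrable 0 1)
    simp only [one_smul, zero_smul, add_zero] at h3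
    rw [← h3, intervalIntegral.integral_of_le zero_le_one]
    have h4 : ‖∫ t in Set.Ioc (0 : ℝ) 1, inner ℝ (g (x + t • z)) z‖ₑ ≤
        ∫⁻ t in Set.Ioc (0 : ℝ) 1, ‖z‖ₑ * ‖g (x + t • z)‖ₑ := by
      refine (enorm_integral_le_lintegral_enorm _).trans (lintegral_mono fun t => ?_)
      rw [← ofReal_norm, ← ofReal_norm, ← ofReal_norm, ← ENNReal.ofReal_mul (norm_nonneg _),
        mul_comm]
      exact ENNReal.ofReal_le_ofReal (norm_inner_le_norm _ _)
    rw [lintegral_const_mul _ (by fun_prop)] at h4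
    calc _ ≤ (‖z‖ₑ * ∫⁻ t in Set.Ioc (0 : ℝ) 1, ‖g (x + t • z)‖ₑ) ^ 2 := by gcongr
      _ ≤ _ := by
        rw [mul_pow]
        gcongr
        refine (lintegral_sq_le_measure_univ_mul (by fun_prop)).trans ?_
        simp
  refine (lintegral_mono hpt).trans ?_
  rw [lintegral_const_mul' _ _ (by finiteness), lintegral_lintegral_swap (by fun_prop)]
  gcongr
  have : ∀ t : ℝ, ∫⁻ x, ‖g (x + t • z)‖ₑ ^ 2 = ∫⁻ x, ‖g x‖ₑ ^ 2 := fun t =>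
    lintegral_add_right_eq_self (fun x => ‖g x‖ₑ ^ 2) (t • z)
  simp [this]

theorem IsTestFunction.eq_zero_of_notMem {Ω : Set 𝔼} {ψ : 𝔼 → ℝ} (hψ : IsTestFunction Ω ψ) {x : 𝔼}
    (hx : x ∉ Ω) : ψ x = 0 :=
  image_eq_zero_of_notMem_tsupport fun h => hx (hψ.tsupport_subset h)

theorem IsTestFunction.gradient_eq_zero_of_notMem {Ω : Set 𝔼} {ψ : 𝔼 → ℝ}
    (hψ : IsTestFunction Ω ψ) {x : 𝔼} (hx : x ∉ Ω) : gradient ψ x = 0 := by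
  have : fderiv ℝ ψ x = 0 := by
    by_contra h
    exact hx (hψ.tsupport_subset (support_fderiv_subset ℝ h))
  simp [gradient, this]

theorem lintegral_gradient_eq {Ω : Set 𝔼} {ψ : 𝔼 → ℝ} (hψ : IsTestFunction Ω ψ) :
    ∫⁻ x, ‖gradient ψ x‖ₑ ^ 2 = ENNReal.ofReal (‖hψ.memLp_gradient.toLp (gradient ψ)‖ ^ 2) := by
  rw [ENNReal.ofReal_pow (norm_nonneg _), ofReal_norm, Lp.enorm_toLp, eLpNorm_two_sq]
  refine (setLIntegral_eq_of_support_subset fun x hx => ?_).symm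
  by_contra h
  simp [hψ.gradient_eq_zero_of_notMem h] at hx

/-- The half-open cube of side `ε` with lower corner `ε k`. -/
def gridCell (ε : ℝ) (k : Fin n → ℤ) : Set 𝔼 := {x | ∀ i, ⌊x i / ε⌋ = k i}

theorem gridCell_eq_preimage {ε : ℝ} (hε : 0 < ε) (k : Fin n → ℤ) :
    gridCell ε k = (WithLp.ofLp : 𝔼 → Fin n → ℝ) ⁻¹'
      Set.univ.pi fun i => Set.Ico (k i * ε) ((k i + 1) * ε) := by
  ext x
  simp only [gridCell, Int.floor_eq_iff, Set.mem_preimage, Set.mem_pi, Set.mem_univ, true_imp_iff,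
    Set.mem_Ico, le_div_iff₀ hε, div_lt_iff₀ hε]
  rfl

theorem measurableSet_gridCell {ε : ℝ} (hε : 0 < ε) (k : Fin n → ℤ) :
    MeasurableSet (gridCell ε k : Set 𝔼) := by
  rw [gridCell_eq_preimage hε]
  exact (PiLp.volume_preserving_ofLp (Fin n)).measurable
    (MeasurableSet.univ_pi fun i => measurableSet_Ico)

theorem volume_gridCell {ε : ℝ} (hε : 0 < ε) (k : Fin n → ℤ) :
    volume (gridCell ε k : Set 𝔼) = ENNReal.ofReal (ε ^ n) := by
  rw [gridCell_eq_preimage hε, (PiLp.volume_preserving_ofLp (Fin n)).measure_preimage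
    (MeasurableSet.univ_pi fun i => measurableSet_Ico).nullMeasurableSet, Real.volume_pi_Ico]
  have : ∀ i, (k i + 1) * ε - k i * ε = ε := fun i => by ring
  simp [this, ENNReal.ofReal_pow hε.le]

theorem norm_sub_le_of_mem_gridCell {ε : ℝ} (hε : 0 < ε) {k : Fin n → ℤ} {x y : 𝔼}
    (hx : x ∈ gridCell ε k) (hy : y ∈ gridCell ε k) : ‖y - x‖ ≤ n * ε := by
  have hi : ∀ i, ‖(y - x) i‖ ^ 2 ≤ ε ^ 2 := by
    intro i
    rw [gridCell_eq_preimage hε] at hx hy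
    have h1 := hx i (Set.mem_univ i)
    have h2 := hy i (Set.mem_univ i)
    rw [Real.norm_eq_abs, sq_abs]
    refine sq_le_sq' ?_ ?_ <;> simp only [PiLp.sub_apply] <;> linarith [h1.1, h1.2, h2.1, h2.2]
  refine abs_le_of_sq_le_sq' ?_ (by positivity) |>.2
  rw [EuclideanSpace.norm_sq_eq]
  refine (Finset.sum_le_sum fun i _ => hi i).trans ?_
  rw [Finset.sum_const, Finset.card_univ, Fintype.card_fin, nsmul_eq_mul, mul_pow]
  have : (n : ℝ) ≤ (n : ℝ) ^ 2 := by exact_mod_cast Nat.le_self_pow two_ne_zero n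
  gcongr

/-- A bounded set meets finitely many cubes of a grid. -/
theorem exists_finset_gridCell {ε : ℝ} (hε : 0 < ε) {Ω : Set 𝔼} (hΩ : Bornology.IsBounded Ω) :
    ∃ K : Finset (Fin n → ℤ), ∀ x ∈ Ω, (fun i => ⌊x i / ε⌋) ∈ K := by
  obtain ⟨R, hR⟩ := hΩ.exists_norm_le
  refine ⟨Fintype.piFinset fun _ => Finset.Icc ⌊-R / ε⌋ ⌊R / ε⌋, fun x hx => ?_⟩
  rw [Fintype.mem_piFinset]
  intro i
  have h := abs_le.1 ((PiLp.norm_apply_le x i).trans (hR x hx))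
  rw [Finset.mem_Icc]
  exact ⟨Int.floor_mono (by gcongr; exact h.1), Int.floor_mono (by gcongr; exact h.2)⟩

/-- Averaging over the cubes of a grid approximates test functions in `L²`, with an error
controlled by the gradient. -/
theorem lintegral_sub_average_sq_le {ε : ℝ} (hε : 0 < ε) {Ω : Set 𝔼} {ψ : 𝔼 → ℝ}
    (hψ : IsTestFunction Ω ψ) :
    ∫⁻ x, ‖ψ x - (ε ^ n)⁻¹ * ∫ y in gridCell ε (fun i => ⌊x i / ε⌋), ψ y‖ₑ ^ 2 ≤
      ENNReal.ofReal (n ^ n * (n * ε) ^ 2) * volume (Metric.ball (0 : 𝔼) 1) *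
        ∫⁻ x, ‖gradient ψ x‖ₑ ^ 2 := by
  have hm : Measurable ψ := hψ.contDiff.continuous.measurable
  have hεn : 0 < ε ^ n := by positivity
  set B : Set 𝔼 := Metric.closedBall 0 (n * ε) with hB
  -- a cube of side `ε` containing `x` lies in the ball of radius `n ε` about `x`, so that the
  -- deviation from the average at `x` is controlled by translations by vectors of this ball
  have hpt : ∀ x, ‖ψ x - (ε ^ n)⁻¹ * ∫ y in gridCell ε (fun i => ⌊x i / ε⌋), ψ y‖ₑ ^ 2 ≤
      ENNReal.ofReal (ε ^ n)⁻¹ * ∫⁻ z in B, ‖ψ (x + z) - ψ x‖ₑ ^ 2 := by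
    intro x
    set Q : Set 𝔼 := gridCell ε (fun i => ⌊x i / ε⌋) with hQ
    have hvol : volume Q = ENNReal.ofReal (ε ^ n) := volume_gridCell hε _
    have hxQ : x ∈ Q := fun i => rfl
    have hfin : IsFiniteMeasure (volume.restrict Q) := ⟨by simp [hvol]⟩
    have hint : Integrable ψ (volume.restrict Q) :=
      (hψ.contDiff.continuous.integrable_of_hasCompactSupport hψ.hasCompactSupport).restrict
    have e1 : ψ x - (ε ^ n)⁻¹ * ∫ y in Q, ψ y = -((ε ^ n)⁻¹ * ∫ y in Q, (ψ y - ψ x)) := by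
      rw [integral_sub hint (integrable_const _), integral_const]
      have : (volume.restrict Q).real Set.univ = ε ^ n := by
        rw [measureReal_restrict_apply_univ, measureReal_def, hvol, ENNReal.toReal_ofReal hεn.le]
      rw [this, smul_eq_mul]
      field_simp
      ring
    have e2 : ‖∫ y in Q, (ψ y - ψ x)‖ₑ ^ 2 ≤
        ENNReal.ofReal (ε ^ n) * ∫⁻ y in Q, ‖ψ y - ψ x‖ₑ ^ 2 := by
      calc _ ≤ (∫⁻ y in Q, ‖ψ y - ψ x‖ₑ) ^ 2 := by
            gcongr; exact enorm_integral_le_lintegral_enorm _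
        _ ≤ _ := by
            refine (lintegral_sq_le_measure_univ_mul (by fun_prop)).trans (le_of_eq ?_)
            rw [Measure.restrict_apply_univ, hvol]
    have e3 : ∫⁻ y in Q, ‖ψ y - ψ x‖ₑ ^ 2 ≤ ∫⁻ z in B, ‖ψ (x + z) - ψ x‖ₑ ^ 2 := by
      have := (measurePreserving_add_left volume x).setLIntegral_comp_preimage
        (s := Metric.closedBall x (n * ε)) (f := fun y => ‖ψ y - ψ x‖ₑ ^ 2)
        Metric.isClosed_closedBall.measurableSet (by fun_prop)
      have hpre : (fun z => x + z) ⁻¹' Metric.closedBall x (n * ε) = B := by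
        ext z; simp [hB]
      rw [hpre] at this
      rw [this]
      refine lintegral_mono_set fun y hy => ?_
      rw [Metric.mem_closedBall, dist_eq_norm]
      exact norm_sub_le_of_mem_gridCell hε hxQ hy
    rw [e1, enorm_neg, enorm_mul, mul_pow]
    have e4 : ‖(ε ^ n)⁻¹‖ₑ = ENNReal.ofReal (ε ^ n)⁻¹ := Real.enorm_of_nonneg (by positivity)
    calc _ ≤ ENNReal.ofReal (ε ^ n)⁻¹ ^ 2 * (ENNReal.ofReal (ε ^ n) *
          ∫⁻ z in B, ‖ψ (x + z) - ψ x‖ₑ ^ 2) := by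
            rw [e4]; gcongr; exact e2.trans (by gcongr)
      _ = _ := by
        rw [← mul_assoc, sq, mul_assoc (ENNReal.ofReal _), ← ENNReal.ofReal_mul (by positivity),
          inv_mul_cancel₀ hεn.ne', ENNReal.ofReal_one, mul_one]
  calc _ ≤ ∫⁻ x, ENNReal.ofReal (ε ^ n)⁻¹ * ∫⁻ z in B, ‖ψ (x + z) - ψ x‖ₑ ^ 2 := lintegral_mono hpt
    _ = ENNReal.ofReal (ε ^ n)⁻¹ * ∫⁻ z in B, transEnergy ψ z := by
      rw [lintegral_const_mul' _ _ ENNReal.ofReal_ne_top, lintegral_lintegral_swap (by fun_prop)]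
      rfl
    _ ≤ ENNReal.ofReal (ε ^ n)⁻¹ * ∫⁻ z in B, ENNReal.ofReal ((n * ε) ^ 2) *
          ∫⁻ x, ‖gradient ψ x‖ₑ ^ 2 := by
      refine mul_le_mul_right ?_ _
      refine setLIntegral_mono_ae' Metric.isClosed_closedBall.measurableSet
        (ae_of_all _ fun z hz => (transEnergy_le_gradient hψ z).trans ?_)
      gcongr
      rw [← ofReal_norm, ← ENNReal.ofReal_pow (norm_nonneg _)]
      refine ENNReal.ofReal_le_ofReal ?_
      gcongr
      simpa [hB] using hz
    _ = _ := by
      rw [setLIntegral_const, hB, Measure.addHaar_closedBall _ _ (by positivity),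
        finrank_euclideanSpace_fin]
      have : ENNReal.ofReal (ε ^ n)⁻¹ * ENNReal.ofReal ((n * ε) ^ n) =
          ENNReal.ofReal (n ^ n) := by
        rw [← ENNReal.ofReal_mul (by positivity), mul_pow]
        congr 1
        field_simp
      rw [ENNReal.ofReal_mul (by positivity), ← this]
      ring

end Rellich

/-! ### Compactness of the resolvent -/

section Compactness

variable {n : ℕ}

local notation "𝔼" => EuclideanSpace ℝ (Fin n)

/-- The operator on `L²(Ω)` replacing a function by its averages over finitely many cubes of a
grid. -/
def gridAverage (Ω : Set 𝔼) {ε : ℝ} (hε : 0 < ε) (K : Finset (Fin n → ℤ)) :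
    L2 Ω ℝ →L[ℝ] L2 Ω ℝ :=
  ∑ k ∈ K, (ε ^ n)⁻¹ • (innerSL ℝ (indicatorConstLp (μ := volume.restrict Ω) 2
    (measurableSet_gridCell hε k)
    ((Measure.restrict_apply_le _ _).trans_lt (by simp [volume_gridCell hε])).ne
      (1 : ℝ))).smulRight (indicatorConstLp (μ := volume.restrict Ω) 2 (measurableSet_gridCell hε k)
    ((Measure.restrict_apply_le _ _).trans_lt (by simp [volume_gridCell hε])).ne (1 : ℝ))

theorem isCompactOperator_gridAverage (Ω : Set 𝔼) {ε : ℝ} (hε : 0 < ε) (K : Finset (Fin n → ℤ)) :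
    IsCompactOperator (gridAverage Ω hε K) := by
  refine Submodule.sum_mem (compactOperator (RingHom.id ℝ) (L2 Ω ℝ) (L2 Ω ℝ))
    fun k _ => ?_
  have h : ∀ c : L2 Ω ℝ, IsCompactOperator (innerSL ℝ c : L2 Ω ℝ → ℝ) := fun c =>
    isCompactOperator_of_locallyCompactSpace_dom (innerSL ℝ c)
  have h' : ∀ c d : L2 Ω ℝ,
      IsCompactOperator ((innerSL ℝ c).smulRight d : L2 Ω ℝ → L2 Ω ℝ) := fun c d =>
    (h c).clm_comp (ContinuousLinearMap.toSpanSingleton ℝ d)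
  exact (h' _ _).smul ((ε ^ n)⁻¹ : ℝ)

theorem gridAverage_toLp_ae_eq {Ω : Set 𝔼} (hΩ : MeasurableSet Ω) {ε : ℝ} (hε : 0 < ε)
    {K : Finset (Fin n → ℤ)} (hK : ∀ x ∈ Ω, (fun i => ⌊x i / ε⌋) ∈ K) {ψ : 𝔼 → ℝ}
    (hψ : IsTestFunction Ω ψ) :
    gridAverage Ω hε K (hψ.memLp.toLp ψ) =ᵐ[volume.restrict Ω]
      fun x => (ε ^ n)⁻¹ * ∫ y in gridCell ε (fun i => ⌊x i / ε⌋), ψ y := by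
  have hcoef : ∀ k, ∫ y in gridCell ε k, hψ.memLp.toLp ψ y ∂(volume.restrict Ω) =
      ∫ y in gridCell ε k, ψ y := by
    intro k
    have hm := measurableSet_gridCell (n := n) hε k
    rw [integral_congr_ae (ae_restrict_of_ae hψ.memLp.coeFn_toLp), Measure.restrict_restrict hm]
    exact (setIntegral_eq_of_subset_of_forall_sdiff_eq_zero hm Set.inter_subset_left
      fun x hx => hψ.eq_zero_of_notMem fun h => hx.2 ⟨hx.1, h⟩).symm
  simp only [gridAverage, _root_.sum_apply, _root_.smul_apply,
    ContinuousLinearMap.smulRight_apply, innerSL_apply_apply, L2.inner_indicatorConstLp_one, hcoef]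
  have hterm : ∀ k ∈ K, (((ε ^ n)⁻¹ • (∫ y in gridCell ε k, ψ y) •
      indicatorConstLp (μ := volume.restrict Ω) 2 (measurableSet_gridCell hε k)
        ((Measure.restrict_apply_le _ _).trans_lt (by simp [volume_gridCell hε])).ne (1 : ℝ) :
      L2 Ω ℝ) : 𝔼 → ℝ) =ᵐ[volume.restrict Ω]
      fun x => (ε ^ n)⁻¹ * ((∫ y in gridCell ε k, ψ y) * (gridCell ε k).indicator 1 x) := by
    intro k _
    refine (Lp.coeFn_smul _ _).trans ?_
    filter_upwards [Lp.coeFn_smul (∫ y in gridCell ε k, ψ y) (indicatorConstLp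
      (μ := volume.restrict Ω) 2 (measurableSet_gridCell hε k)
        ((Measure.restrict_apply_le _ _).trans_lt (by simp [volume_gridCell hε])).ne (1 : ℝ)),
      indicatorConstLp_coeFn (μ := volume.restrict Ω) (p := 2) (hs := measurableSet_gridCell hε k)
        (hμs := ((Measure.restrict_apply_le _ _).trans_lt
          (by simp [volume_gridCell hε])).ne) (c := (1 : ℝ))] with x h1 h2
    rw [Pi.smul_apply, h1, Pi.smul_apply, h2]
    rfl
  refine (Lp.coeFn_finsetSum _ _).trans ?_
  have hall := (Finset.eventually_all K).2 hterm
  filter_upwards [hall, ae_restrict_mem hΩ] with x hx hxΩ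
  rw [Finset.sum_apply, Finset.sum_congr rfl hx, Finset.sum_eq_single_of_mem _ (hK x hxΩ)]
  · rw [Set.indicator_of_mem (show x ∈ gridCell ε (fun i => ⌊x i / ε⌋) from fun i => rfl)]
    simp
  · intro k _ hk
    rw [Set.indicator_of_notMem, mul_zero, mul_zero]
    exact fun h => hk (funext fun i => (h i).symm)

/-- Passing to the limit, averaging over cubes of side `ε` approximates `H¹₀(Ω)` functions in `L²`
with an error of order `ε` times the norm of the gradient. -/
theorem norm_sub_gridAverage_sq_le {Ω : Set 𝔼} (hΩ : MeasurableSet Ω) {ε : ℝ} (hε : 0 < ε)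
    {K : Finset (Fin n → ℤ)} (hK : ∀ x ∈ Ω, (fun i => ⌊x i / ε⌋) ∈ K) {p : L2Pair Ω}
    (hp : p ∈ formDomain Ω 1) :
    ‖p.fst - gridAverage Ω hε K p.fst‖ ^ 2 ≤
      (n ^ n * (n * ε) ^ 2 * (volume (Metric.ball (0 : 𝔼) 1)).toReal) * ‖p.snd‖ ^ 2 := by
  obtain ⟨ψ, h, hψ⟩ := exists_seq_of_mem_formDomain hp
  have h1 := tendsto_fst_of_toPair hψ
  have h2 := tendsto_snd_of_toPair hψ
  have hA := ((gridAverage Ω hε K).continuous.tendsto _).comp h1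
  refine le_of_tendsto_of_tendsto' ((h1.sub hA).norm.pow 2) ((h2.norm.pow 2).const_mul _)
    fun k => ?_
  have hball : volume (Metric.ball (0 : 𝔼) 1) ≠ ⊤ := measure_ball_lt_top.ne
  rw [← ENNReal.ofReal_le_ofReal_iff (by positivity), Real.sqrt_one, one_smul,
    ENNReal.ofReal_mul (by positivity), ← lintegral_gradient_eq (h k), ENNReal.ofReal_mul (by positivity),
    ENNReal.ofReal_toReal hball]
  refine le_trans ?_ (lintegral_sub_average_sq_le hε (h k))
  rw [ENNReal.ofReal_pow (norm_nonneg _), Function.comp_apply,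
    ← eLpNorm_sub_eq_norm _ (h k).memLp, eLpNorm_two_sq]
  refine le_trans (le_of_eq (lintegral_congr_ae ?_)) (setLIntegral_le_lintegral Ω _)
  filter_upwards [gridAverage_toLp_ae_eq hΩ hε hK (h k)] with x hx
  rw [hx]

/-- Rellich's theorem: on a bounded domain the resolvent is compact, being a limit of the finite
rank operators obtained by averaging over cubes. -/
theorem isCompactOperator_resolvent {Ω : Set 𝔼} (hΩ : MeasurableSet Ω)
    (hb : Bornology.IsBounded Ω) : IsCompactOperator (resolvent₀ Ω 1) := by
  have hε : ∀ k : ℕ, (0 : ℝ) < 1 / ((k : ℝ) + 1) := fun k => by positivity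
  choose K hK using fun k => exists_finset_gridCell (hε k) hb
  refine isCompactOperator_of_tendsto (l := atTop)
    (F := fun k => gridAverage Ω (hε k) (K k) ∘L resolvent₀ Ω 1) ?_
    (Eventually.of_forall fun k => (isCompactOperator_gridAverage Ω (hε k) (K k)).comp_clm _)
  rw [tendsto_iff_norm_sub_tendsto_zero]
  set C : ℝ := n ^ n * n ^ 2 * (volume (Metric.ball (0 : 𝔼) 1)).toReal with hC
  have hC0 : 0 ≤ C := by positivity
  have hle : ∀ k : ℕ, ‖gridAverage Ω (hε k) (K k) ∘L resolvent₀ Ω 1 - resolvent₀ Ω 1‖ ≤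
      Real.sqrt C * (1 / ((k : ℝ) + 1)) := by
    intro k
    refine ContinuousLinearMap.opNorm_le_bound _ (by positivity) fun f => ?_
    have h1 := norm_sub_gridAverage_sq_le hΩ (hε k) (hK k) (resolventPair_mem (s := 1) f)
    have h2 : ‖resolventPair Ω 1 f‖ ≤ ‖f‖ := by
      rw [← norm_inl f]
      exact Submodule.norm_starProjection_apply_le _ _
    have h3 : ‖(resolventPair Ω 1 f).snd‖ ^ 2 ≤ ‖f‖ ^ 2 := by
      have h4 := L2Pair.norm_sq_eq (resolventPair Ω 1 f)
      have h5 : ‖resolventPair Ω 1 f‖ ^ 2 ≤ ‖f‖ ^ 2 := by gcongr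
      nlinarith [sq_nonneg ‖(resolventPair Ω 1 f).fst‖]
    rw [resolventPair_fst] at h1
    rw [_root_.sub_apply, ContinuousLinearMap.comp_apply, norm_sub_rev]
    refine abs_le_of_sq_le_sq' (h1.trans ?_) (by positivity) |>.2
    rw [mul_pow (Real.sqrt C * _), mul_pow (Real.sqrt C), Real.sq_sqrt hC0]
    calc _ = C * (1 / ((k : ℝ) + 1)) ^ 2 * ‖(resolventPair Ω 1 f).snd‖ ^ 2 := by rw [hC]; ring
      _ ≤ _ := by gcongr
  refine squeeze_zero (fun _ => norm_nonneg _) hle ?_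
  simpa using tendsto_one_div_add_atTop_nhds_zero_nat.const_mul (Real.sqrt C)

end Compactness

/-! ### Spectral decomposition of the Navier form -/

section Spectral

variable {n : ℕ} {Ω : Set (EuclideanSpace ℝ (Fin n))} {s : ℝ}

local notation "𝔼" => EuclideanSpace ℝ (Fin n)

/-- The closed eigenspace of the Dirichlet Laplacian for the eigenvalue `μ`. -/
def closedEigenspace (Ω : Set 𝔼) (μ : ℝ) : Submodule ℝ (L2 Ω ℝ) :=
  (dirichletEigenspace Ω μ).topologicalClosure

instance (μ : ℝ) : CompleteSpace (closedEigenspace Ω μ) :=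
  (dirichletEigenspace Ω μ).isClosed_topologicalClosure.completeSpace_coe

/-- The relation with the resolvent is a closed condition, so that it holds on the closure of the
eigenspace. -/
theorem smul_resolvent_of_mem_closedEigenspace {μ : ℝ} {v : L2 Ω ℝ}
    (hv : v ∈ closedEigenspace Ω μ) (hs : 0 < s) : (1 + s * μ) • resolvent₀ Ω s v = v := by
  have hclosed : IsClosed {w : L2 Ω ℝ | (1 + s * μ) • resolvent₀ Ω s w = w} :=
    isClosed_eq (by fun_prop) continuous_id
  exact closure_minimal (fun w hw => IsDirichletEigenvector.smul_resolvent hw hs) hclosed hv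

/-- The Dirichlet Laplacian has no negative eigenvalue. -/
theorem eq_zero_of_mem_closedEigenspace_of_neg {μ : ℝ} (hμ : μ < 0) {v : L2 Ω ℝ}
    (hv : v ∈ closedEigenspace Ω μ) : v = 0 := by
  -- `s = -1/μ` turns the eigenvalue of the resolvent into `1/0`
  have h := smul_resolvent_of_mem_closedEigenspace (s := -μ⁻¹) hv (by simpa using hμ)
  rwa [neg_mul, inv_mul_cancel₀ hμ.ne, add_neg_cancel, zero_smul, eq_comm] at h

/-- Eigenspaces for different eigenvalues are orthogonal, being eigenspaces of the symmetric
resolvent. -/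
theorem orthogonalFamily_closedEigenspace :
    OrthogonalFamily ℝ (fun μ : ℝ => closedEigenspace Ω μ)
      fun μ => (closedEigenspace Ω μ).subtypeₗᵢ := by
  intro μ ν hμν v w
  have hv := smul_resolvent_of_mem_closedEigenspace v.2 one_pos
  have hw := smul_resolvent_of_mem_closedEigenspace w.2 one_pos
  have hsymm : inner ℝ (resolvent₀ Ω 1 v) (w : L2 Ω ℝ) = inner ℝ (v : L2 Ω ℝ) (resolvent₀ Ω 1 w) :=
    resolvent_isSymmetric _ _
  have h1 : inner ℝ (v : L2 Ω ℝ) (w : L2 Ω ℝ) =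
      (1 + 1 * μ) * inner ℝ (v : L2 Ω ℝ) (resolvent₀ Ω 1 w) := by
    rw [← hsymm, ← real_inner_smul_left, hv]
  have h2 : inner ℝ (v : L2 Ω ℝ) (w : L2 Ω ℝ) =
      (1 + 1 * ν) * inner ℝ (v : L2 Ω ℝ) (resolvent₀ Ω 1 w) := by
    rw [← real_inner_smul_right, hw]
  have h3 : (μ - ν) * inner ℝ (v : L2 Ω ℝ) (resolvent₀ Ω 1 w) = 0 := by linarith
  change inner ℝ (v : L2 Ω ℝ) (w : L2 Ω ℝ) = 0
  rw [h1, (mul_eq_zero.1 h3).resolve_left (sub_ne_zero.2 hμν), mul_zero]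

/-- The spectral theorem for the compact resolvent, which is injective: the eigenspaces of the
Dirichlet Laplacian span a dense subspace. -/
theorem top_le_iSup_closedEigenspace (hΩ : IsOpen Ω) (hb : Bornology.IsBounded Ω) :
    ⊤ ≤ (⨆ μ, closedEigenspace Ω μ).topologicalClosure := by
  rw [Submodule.topologicalClosure_eq_top_iff.2]
  have h := ContinuousLinearMap.orthogonalComplement_iSup_eigenspaces_eq_bot
    (isCompactOperator_resolvent hΩ.measurableSet hb) resolvent_isSymmetric
  refine eq_bot_iff.2 (le_trans (Submodule.orthogonal_le (iSup_le fun κ => ?_)) h.le)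
  intro v hv
  have hv' : resolvent₀ Ω 1 v = κ • v := Module.End.mem_eigenspace_iff.1 hv
  rcases eq_or_ne κ 0 with rfl | hκ
  · rw [zero_smul] at hv'
    rw [eq_zero_of_resolvent_eq_zero hΩ hv']
    exact zero_mem _
  · exact le_iSup (fun μ => closedEigenspace Ω μ) ((1 - κ) / κ)
      (Submodule.le_topologicalClosure _ (isDirichletEigenvector_of_resolvent hκ hv'))

theorem hasSum_starProjection_closedEigenspace (hΩ : IsOpen Ω) (hb : Bornology.IsBounded Ω)
    (f : L2 Ω ℝ) : HasSum (fun μ => (closedEigenspace Ω μ).starProjection f) f := by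
  have hH := IsHilbertSum.mkInternal (F := fun μ : ℝ => closedEigenspace Ω μ)
    orthogonalFamily_closedEigenspace (top_le_iSup_closedEigenspace hΩ hb)
  have h1 := hH.hasSum_linearIsometryEquiv_symm (hH.linearIsometryEquiv f)
  rw [LinearIsometryEquiv.symm_apply_apply] at h1
  have h2 : ∀ μ, (closedEigenspace Ω μ).starProjection f = hH.linearIsometryEquiv f μ := by
    intro μ
    refine Submodule.eq_starProjection_of_mem_of_inner_eq_zero (Subtype.coe_prop _)
      fun w hw => ?_
    have h3 : HasSum (fun ν => inner ℝ ((hH.linearIsometryEquiv f ν : L2 Ω ℝ)) w) (inner ℝ f w) :=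
      h1.mapL ((innerSL ℝ).flip w)
    have h4 : HasSum (fun ν => inner ℝ ((hH.linearIsometryEquiv f ν : L2 Ω ℝ)) w)
        (inner ℝ (hH.linearIsometryEquiv f μ : L2 Ω ℝ) w) :=
      hasSum_single μ fun ν hν => orthogonalFamily_closedEigenspace hν _ ⟨w, hw⟩
    rw [inner_sub_left, h3.unique h4, sub_self]
  simp only [h2]
  exact h1

theorem inner_starProjection_self (μ : ℝ) (f : L2 Ω ℝ) :
    inner ℝ ((closedEigenspace Ω μ).starProjection f) f =
      ‖(closedEigenspace Ω μ).starProjection f‖ ^ 2 := by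
  rw [← real_inner_self_eq_norm_sq, ← sub_eq_zero, ← inner_sub_right, real_inner_comm]
  exact Submodule.starProjection_inner_eq_zero _ _ (Submodule.starProjection_apply_mem _ _)

theorem hasSum_norm_sq_starProjection (hΩ : IsOpen Ω) (hb : Bornology.IsBounded Ω)
    (f : L2 Ω ℝ) : HasSum (fun μ => ‖(closedEigenspace Ω μ).starProjection f‖ ^ 2) (‖f‖ ^ 2) := by
  have h : HasSum (fun μ => inner ℝ ((closedEigenspace Ω μ).starProjection f) f) (inner ℝ f f) :=
    (hasSum_starProjection_closedEigenspace hΩ hb f).mapL ((innerSL ℝ).flip f)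
  simpa only [inner_starProjection_self, real_inner_self_eq_norm_sq] using h

/-- The spectral representation of the form of `1 - (1 - sΔ)⁻¹`. -/
theorem hasSum_norm_sq_sub_inner_resolvent (hΩ : IsOpen Ω) (hb : Bornology.IsBounded Ω)
    (hs : 0 < s) (f : L2 Ω ℝ) :
    HasSum (fun μ => s * μ / (1 + s * μ) * ‖(closedEigenspace Ω μ).starProjection f‖ ^ 2)
      (‖f‖ ^ 2 - inner ℝ (resolvent₀ Ω s f) f) := by
  have h1 := hasSum_norm_sq_starProjection hΩ hb f
  have h2 : HasSum (fun μ => inner ℝ (resolvent₀ Ω s ((closedEigenspace Ω μ).starProjection f)) f)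
      (inner ℝ (resolvent₀ Ω s f) f) :=
    ((hasSum_starProjection_closedEigenspace hΩ hb f).mapL (resolvent₀ Ω s)).mapL
      ((innerSL ℝ).flip f)
  have e : ∀ μ, s * μ / (1 + s * μ) * ‖(closedEigenspace Ω μ).starProjection f‖ ^ 2 =
      ‖(closedEigenspace Ω μ).starProjection f‖ ^ 2 -
        inner ℝ (resolvent₀ Ω s ((closedEigenspace Ω μ).starProjection f)) f := by
    intro μ
    have hP := Submodule.starProjection_apply_mem (closedEigenspace Ω μ) f
    rcases lt_or_ge μ 0 with hμ | hμ
    · rw [eq_zero_of_mem_closedEigenspace_of_neg hμ hP]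
      simp
    · have hne : 1 + s * μ ≠ 0 := by positivity
      have h3 := congrArg (fun w => inner ℝ w f) (smul_resolvent_of_mem_closedEigenspace hP hs)
      simp only [real_inner_smul_left, inner_starProjection_self] at h3
      rw [← h3]
      field_simp
      ring
  simp_rw [e]
  exact h1.sub h2

/-- The constant `∫₀^∞ s ^ (-1 - m) · s / (1 + s) ds` relating resolvents to fractional powers. -/
def navierConst (m : ℝ) : ℝ≥0∞ :=
  ∫⁻ s in Set.Ioi (0 : ℝ), ENNReal.ofReal (s ^ (-1 - m)) * ENNReal.ofReal (s / (1 + s))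

theorem navierConst_ne_zero (m : ℝ) : navierConst m ≠ 0 :=
  lintegral_Ioi_rpow_mul_ne_zero (by fun_prop) fun s hs => ENNReal.ofReal_pos.2 (by positivity)

theorem navierConst_ne_top {m : ℝ} (hm0 : 0 < m) (hm1 : m < 1) : navierConst m ≠ ⊤ := by
  refine (lintegral_Ioi_rpow_mul_lt_top hm0 hm1 fun s hs => ENNReal.ofReal_le_ofReal ?_).ne
  exact le_min ((div_le_one (by linarith)).2 (by linarith)) (div_le_self hs.le (by linarith))

/-- The spectral density of the Navier form at the scale `s`: the form of `1 - (1 - sΔ)⁻¹`. -/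
def resolventEnergy (Ω : Set 𝔼) (f : L2 Ω ℝ) (s : ℝ) : ℝ≥0∞ :=
  ENNReal.ofReal (‖f‖ ^ 2 - inner ℝ (resolvent₀ Ω s f) f)

theorem resolventEnergy_eq_tsum (hΩ : IsOpen Ω) (hb : Bornology.IsBounded Ω)
    (hs : 0 < s) (f : L2 Ω ℝ) : resolventEnergy Ω f s =
      ∑' μ : {μ : ℝ | (closedEigenspace Ω μ).starProjection f ≠ 0}, ENNReal.ofReal
        (s * μ / (1 + s * μ) * ‖(closedEigenspace Ω μ).starProjection f‖ ^ 2) := by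
  have h := hasSum_norm_sq_sub_inner_resolvent hΩ hb hs f
  have hnn : ∀ μ, 0 ≤ s * μ / (1 + s * μ) * ‖(closedEigenspace Ω μ).starProjection f‖ ^ 2 := by
    intro μ
    rcases lt_or_ge μ 0 with hμ | hμ
    · rw [eq_zero_of_mem_closedEigenspace_of_neg hμ (Submodule.starProjection_apply_mem _ f)]
      simp
    · positivity
  rw [resolventEnergy, ← h.tsum_eq, ENNReal.ofReal_tsum_of_nonneg hnn h.summable]
  refine (tsum_subtype_eq_of_support_subset
    (f := fun μ => ENNReal.ofReal
      (s * μ / (1 + s * μ) * ‖(closedEigenspace Ω μ).starProjection f‖ ^ 2)) fun μ hμ => ?_).symm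
  contrapose! hμ
  have : (closedEigenspace Ω μ).starProjection f = 0 := not_not.1 hμ
  simp [this]

theorem countable_starProjection_ne_zero (hΩ : IsOpen Ω) (hb : Bornology.IsBounded Ω)
    (f : L2 Ω ℝ) : {μ : ℝ | (closedEigenspace Ω μ).starProjection f ≠ 0}.Countable := by
  refine (hasSum_norm_sq_starProjection hΩ hb f).summable.countable_support.mono fun μ hμ => ?_
  have : (closedEigenspace Ω μ).starProjection f ≠ 0 := hμ
  simpa using this

/-- The integrand below only depends on the resolvents up to a null set of scales. -/
theorem aemeasurable_resolventEnergy (hΩ : IsOpen Ω) (hb : Bornology.IsBounded Ω) (f : L2 Ω ℝ) :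
    AEMeasurable (resolventEnergy Ω f) (volume.restrict (Set.Ioi 0)) := by
  have := (countable_starProjection_ne_zero hΩ hb f).to_subtype
  refine AEMeasurable.congr (Measurable.aemeasurable ?_)
    ((ae_restrict_mem measurableSet_Ioi).mono fun s hs =>
      (resolventEnergy_eq_tsum hΩ hb hs f).symm)
  fun_prop

/-- The Navier form as a superposition of the forms of `1 - (1 - sΔ)⁻¹`. -/
theorem navierConst_mul_navierForm (hΩ : IsOpen Ω) (hb : Bornology.IsBounded Ω) {m : ℝ}
    (hm0 : 0 < m) {u : 𝔼 → ℝ} (hu : MemLp u 2 (volume.restrict Ω)) :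
    navierConst m * navierForm m Ω u =
      ∫⁻ s in Set.Ioi (0 : ℝ), ENNReal.ofReal (s ^ (-1 - m)) *
        resolventEnergy Ω (hu.toLp u) s := by
  set f := hu.toLp u
  have := (countable_starProjection_ne_zero hΩ hb f).to_subtype
  have h1 : ∫⁻ s in Set.Ioi (0 : ℝ), ENNReal.ofReal (s ^ (-1 - m)) * resolventEnergy Ω f s =
      ∫⁻ s in Set.Ioi (0 : ℝ), ∑' μ : {μ : ℝ | (closedEigenspace Ω μ).starProjection f ≠ 0},
        ENNReal.ofReal (s ^ (-1 - m)) * ENNReal.ofReal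
        (s * μ / (1 + s * μ) * ‖(closedEigenspace Ω μ).starProjection f‖ ^ 2) := by
    refine setLIntegral_congr_fun measurableSet_Ioi fun s hs => ?_
    rw [resolventEnergy_eq_tsum hΩ hb hs f, ENNReal.tsum_mul_left]
  have h2 : navierForm m Ω u =
      ∑' μ : {μ : ℝ | (closedEigenspace Ω μ).starProjection f ≠ 0}, ENNReal.ofReal
        ((μ : ℝ) ^ m * ‖(closedEigenspace Ω μ).starProjection f‖ ^ 2) := by
    rw [navierForm, dif_pos hu]
    refine (tsum_subtype_eq_of_support_subset (f := fun μ : ℝ => ENNReal.ofReal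
      (μ ^ m * ‖(closedEigenspace Ω μ).starProjection f‖ ^ 2)) fun μ hμ => ?_).symm
    contrapose! hμ
    have : (closedEigenspace Ω μ).starProjection f = 0 := not_not.1 hμ
    simp [this]
  rw [h1, h2, lintegral_tsum fun μ => by fun_prop, ← ENNReal.tsum_mul_left]
  refine tsum_congr fun μ => ?_
  obtain ⟨μ, hμ⟩ := μ
  simp only
  -- only nonnegative `μ` occur; otherwise `μ ^ m` would be a junk value
  have h0 : 0 ≤ μ := by
    by_contra h
    exact hμ (eq_zero_of_mem_closedEigenspace_of_neg (not_le.1 h)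
      (Submodule.starProjection_apply_mem _ f))
  have h3 : ∀ s : ℝ, ENNReal.ofReal (s ^ (-1 - m)) * ENNReal.ofReal
      (s * μ / (1 + s * μ) * ‖(closedEigenspace Ω μ).starProjection f‖ ^ 2) =
      (ENNReal.ofReal (s ^ (-1 - m)) * ENNReal.ofReal (s * μ / (1 + s * μ))) *
        ENNReal.ofReal (‖(closedEigenspace Ω μ).starProjection f‖ ^ 2) := fun s => by
    rw [ENNReal.ofReal_mul' (by positivity), mul_assoc]
  simp_rw [h3]
  rw [lintegral_mul_const' _ _ ENNReal.ofReal_ne_top, ENNReal.ofReal_mul' (by positivity),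
    ← mul_assoc]
  congr 1
  rcases h0.eq_or_lt with rfl | h0
  · simp [Real.zero_rpow hm0.ne']
  · rw [lintegral_Ioi_rpow_mul_comp_mul h0 (fun s => ENNReal.ofReal (s / (1 + s))), mul_comm]
    rfl

end Spectral

/-! ### Interior cones and negligibility of the boundary -/

section Geometry

variable {n : ℕ} {Ω : Set (EuclideanSpace ℝ (Fin n))}

local notation "𝔼" => EuclideanSpace ℝ (Fin n)

/-- The uniform interior cone property: near each point of the closure, moving from any point of
the closure by a small positive multiple of any vector of a fixed ball leads into `Ω`. -/
theorem IsBoundedSmoothDomain.exists_cone (hΩ : IsBoundedSmoothDomain Ω) {x₀ : 𝔼}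
    (hx₀ : x₀ ∈ closure Ω) : ∃ (ν : 𝔼) (δ r : ℝ), 0 < δ ∧ 0 < r ∧ r ≤ 1 ∧
      ∀ y ∈ closure Ω, dist y x₀ < r → ∀ t, 0 < t → t < r → ∀ z, dist z ν ≤ δ → y + t • z ∈ Ω := by
  by_cases hin : x₀ ∈ Ω
  · obtain ⟨r, hr, hball⟩ := Metric.isOpen_iff.1 hΩ.isOpen x₀ hin
    refine ⟨0, 1, min (r / 2) 1, one_pos, by positivity, min_le_right _ _,
      fun y _ hy t ht0 ht z hz => hball ?_⟩
    rw [dist_zero_right] at hz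
    rw [Metric.mem_ball, dist_eq_norm, add_sub_right_comm]
    have h1 : ‖y - x₀‖ < r / 2 := by
      rw [← dist_eq_norm]; exact hy.trans_le (min_le_left _ _)
    have h2 : ‖t • z‖ < r / 2 := by
      rw [norm_smul, Real.norm_of_nonneg ht0.le]
      nlinarith [ht.trans_le (min_le_left (r / 2) 1)]
    linarith [norm_add_le (y - x₀) (t • z)]
  · obtain ⟨ρ, hρ, hρ0, hL, hiff⟩ := hΩ.smooth_boundary x₀
      ⟨hx₀, fun h => hin (hΩ.isOpen.interior_eq ▸ h)⟩
    set L := fderiv ℝ ρ x₀ with hLdef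
    obtain ⟨ν, hν⟩ : ∃ ν, L ν = -1 := by
      obtain ⟨w, hw⟩ : ∃ w, L w ≠ 0 := by
        by_contra! h
        exact hL (ContinuousLinearMap.ext h)
      exact ⟨(-(L w)⁻¹) • w, by simp [hw]⟩
    -- `ν` decreases `ρ` at unit rate; `δ` makes `dρ` at most `-3/4` on the ball about `ν`, and `c`
    -- bounds the error of the linearisation by `t / 4`
    set δ : ℝ := 1 / (4 * (‖L‖ + 1)) with hδ
    have hδ0 : 0 < δ := by positivity
    set c : ℝ := 1 / (4 * (‖ν‖ + δ + 1)) with hc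
    have hc0 : 0 < c := by positivity
    have hstrict : HasStrictFDerivAt ρ L x₀ :=
      hρ.contDiffAt.hasStrictFDerivAt (by simp)
    have h1 := hstrict.isLittleO.def hc0
    obtain ⟨r₁, hr₁, h1⟩ := Metric.eventually_nhds_iff.1 h1
    obtain ⟨r₂, hr₂, h2⟩ := Metric.eventually_nhds_iff.1 hiff
    -- points of the closure are in `{ρ ≤ 0}`
    have hle : ∀ y ∈ closure Ω, dist y x₀ < r₂ → ρ y ≤ 0 := by
      intro y hy hyr
      by_contra! hpos
      have hnhds : Metric.ball x₀ r₂ ∩ {w | 0 < ρ w} ∈ 𝓝 y :=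
        inter_mem (Metric.isOpen_ball.mem_nhds hyr)
          ((isOpen_lt continuous_const hρ.continuous).mem_nhds hpos)
      obtain ⟨w, ⟨hw1, hw2⟩, hwΩ⟩ := mem_closure_iff_nhds.1 hy _ hnhds
      exact absurd ((h2 hw1).1 hwΩ) (not_lt.2 (le_of_lt hw2))
    set R : ℝ := min r₁ r₂ with hR
    have hR0 : 0 < R := lt_min hr₁ hr₂
    have hd : 0 < 2 * (‖ν‖ + δ + 1) := by positivity
    refine ⟨ν, δ, min (R / (2 * (‖ν‖ + δ + 1))) 1, hδ0, by positivity, min_le_right _ _,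
      fun y hy hyr t ht0 ht z hz => ?_⟩
    have ht' : t * (2 * (‖ν‖ + δ + 1)) < R :=
      (lt_div_iff₀ hd).1 (ht.trans_le (min_le_left _ _))
    have hyR : dist y x₀ * (2 * (‖ν‖ + δ + 1)) < R :=
      (lt_div_iff₀ hd).1 (hyr.trans_le (min_le_left _ _))
    have hzn : ‖z‖ ≤ ‖ν‖ + δ := by
      have := norm_sub_norm_le z ν
      rw [dist_eq_norm] at hz
      linarith
    have htz : ‖t • z‖ ≤ t * (‖ν‖ + δ) := by
      rw [norm_smul, Real.norm_of_nonneg ht0.le]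
      gcongr
    have hy1 : dist y x₀ < R := by
      nlinarith [dist_nonneg (x := y) (y := x₀), norm_nonneg ν]
    have hy2 : dist (y + t • z) x₀ < R := by
      have h3 := dist_triangle (y + t • z) y x₀
      rw [dist_self_add_left] at h3
      nlinarith [dist_nonneg (x := y) (y := x₀), norm_nonneg ν]
    have hmem : dist (y + t • z, y) (x₀, x₀) < r₁ :=
      max_lt (hy2.trans_le (min_le_left _ _)) (hy1.trans_le (min_le_left _ _))
    have h4 := h1 hmem
    simp only [add_sub_cancel_left, map_smul, smul_eq_mul] at h4
    have h5 : L z ≤ -1 + 1 / 4 := by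
      have h6 : L (z - ν) ≤ ‖L‖ * δ := (le_abs_self _).trans ((L.le_opNorm _).trans (by
        gcongr; rwa [← dist_eq_norm]))
      have h7 : ‖L‖ * δ ≤ 1 / 4 := by
        rw [hδ, mul_one_div, div_le_div_iff₀ (by positivity) (by norm_num)]
        linarith
      rw [map_sub, hν] at h6
      linarith
    have h8 : c * ‖t • z‖ ≤ t * (1 / 4) := by
      calc c * ‖t • z‖ ≤ c * (t * (‖ν‖ + δ)) := by gcongr
        _ = t * (c * (‖ν‖ + δ)) := by ring
        _ ≤ t * (1 / 4) := by
          gcongr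
          rw [hc, one_div_mul_eq_div, div_le_div_iff₀ (by positivity) (by norm_num)]
          linarith
    have h9 := (abs_le.1 (h4.trans h8)).2
    refine (h2 (hy2.trans_le (min_le_right _ _))).2 ?_
    nlinarith [hle y hy (hy1.trans_le (min_le_right _ _))]

open scoped Pointwise in
/-- Near each of its points the boundary is disjoint from its translates along the cone axis;
infinitely many disjoint translates of a set of positive measure do not fit in a bounded region. -/
theorem IsBoundedSmoothDomain.volume_frontier (hΩ : IsBoundedSmoothDomain Ω) :
    volume (frontier Ω) = 0 := by
  refine measure_null_of_locally_null _ fun x₀ hx₀ => ?_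
  obtain ⟨ν, δ, r, hδ, hr, -, hcone⟩ := hΩ.exists_cone (frontier_subset_closure hx₀)
  refine ⟨frontier Ω ∩ Metric.ball x₀ r,
    inter_mem_nhdsWithin _ (Metric.ball_mem_nhds _ hr), ?_⟩
  have ht : ∀ k : ℕ, 0 < r / (k + 2) ∧ r / (k + 2) < r := fun k =>
    ⟨by positivity, div_lt_self hr (by linarith [k.cast_nonneg (α := ℝ)])⟩
  refine Measure.addHaar_eq_zero_of_disjoint_translates volume (fun k : ℕ => (r / (k + 2)) • ν)
    ?_ ?_ (isClosed_frontier.measurableSet.inter measurableSet_ball)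
  · refine (Metric.isBounded_closedBall (x := (0 : 𝔼)) (r := r * ‖ν‖)).subset ?_
    rintro _ ⟨k, rfl⟩
    rw [mem_closedBall_zero_iff, norm_smul, Real.norm_of_nonneg (ht k).1.le]
    gcongr
    exact (ht k).2.le
  · -- the difference of two translation vectors is a positive multiple of `±ν`
    have key : ∀ j k : ℕ, j < k → Disjoint
        (({(r / ((j : ℝ) + 2)) • ν} : Set 𝔼) + frontier Ω ∩ Metric.ball x₀ r)
        (({(r / ((k : ℝ) + 2)) • ν} : Set 𝔼) + frontier Ω ∩ Metric.ball x₀ r) := by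
      intro j k hjk
      rw [Set.disjoint_left]
      rintro _ ⟨_, rfl, a, ⟨ha, har⟩, rfl⟩ ⟨_, rfl, b, ⟨hb, -⟩, hab⟩
      have hlt : r / ((k : ℝ) + 2) < r / ((j : ℝ) + 2) := by
        have : (j : ℝ) < k := by exact_mod_cast hjk
        gcongr
      have hb' : a + (r / ((j : ℝ) + 2) - r / ((k : ℝ) + 2)) • ν = b := by
        simp only at hab
        rw [sub_smul, eq_comm, ← add_right_inj ((r / ((k : ℝ) + 2)) • ν), hab]
        abel
      have := hcone a (frontier_subset_closure ha) har _ (sub_pos.2 hlt)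
        (by linarith [(ht j).2, (ht k).1]) ν (by simpa using hδ.le)
      rw [hb'] at this
      exact hb.2 (hΩ.isOpen.interior_eq.symm ▸ this)
    intro j k hjk
    rcases hjk.lt_or_gt with h | h
    · exact key j k h
    · exact (key k j h).symm

end Geometry

/-! ### Cutoffs and mollifiers dominated by Gaussians -/

section Mollification

variable {n : ℕ}

local notation "𝔼" => EuclideanSpace ℝ (Fin n)

theorem enorm_sq_eq_ofReal_sq (y : ℝ) : ‖y‖ₑ ^ 2 = ENNReal.ofReal (y ^ 2) := by
  rw [Real.enorm_eq_ofReal_abs, ← ENNReal.ofReal_pow (abs_nonneg _), sq_abs]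

/-- A factor `‖z‖²` is absorbed by doubling the scale of the Gaussian, at the cost of a factor `s`.
-/
theorem norm_sq_mul_heatKernel_le {s : ℝ} (hs : 0 < s) (z : 𝔼) :
    ‖z‖ ^ 2 * heatKernel s z ≤
      2 / Real.pi * 2 ^ (Module.finrank ℝ 𝔼 / 2 : ℝ) * s * heatKernel (2 * s) z := by
  have hpi := Real.pi_pos
  set a : ℝ := Real.pi / (2 * s) * ‖z‖ ^ 2 with ha
  have ha0 : 0 ≤ a := by positivity
  have h1 : a * Real.exp (-a) ≤ 1 := by
    rw [Real.exp_neg, ← div_eq_mul_inv, div_le_one (Real.exp_pos _)]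
    linarith [Real.add_one_le_exp a]
  have e1 : Real.exp (-(Real.pi / s) * ‖z‖ ^ 2) = Real.exp (-a) * Real.exp (-a) := by
    rw [← Real.exp_add]; congr 1; rw [ha]; field_simp; ring
  have e2 : Real.exp (-(Real.pi / (2 * s)) * ‖z‖ ^ 2) = Real.exp (-a) := by
    rw [ha, neg_mul]
  have e3 : ‖z‖ ^ 2 = 2 / Real.pi * s * a := by rw [ha]; field_simp
  have e4 : (2 * s) ^ (-(Module.finrank ℝ 𝔼 / 2 : ℝ)) =
      (2 ^ (Module.finrank ℝ 𝔼 / 2 : ℝ))⁻¹ * s ^ (-(Module.finrank ℝ 𝔼 / 2 : ℝ)) := by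
    rw [Real.mul_rpow zero_le_two hs.le, Real.rpow_neg zero_le_two]
  rw [heatKernel, heatKernel, e1, e2, e4]
  have hpos : (0 : ℝ) < 2 ^ (Module.finrank ℝ 𝔼 / 2 : ℝ) := by positivity
  calc ‖z‖ ^ 2 * (s ^ (-(Module.finrank ℝ 𝔼 / 2 : ℝ)) * (Real.exp (-a) * Real.exp (-a)))
      = 2 / Real.pi * s * s ^ (-(Module.finrank ℝ 𝔼 / 2 : ℝ)) * Real.exp (-a) *
        (a * Real.exp (-a)) := by rw [e3]; ring
    _ ≤ 2 / Real.pi * s * s ^ (-(Module.finrank ℝ 𝔼 / 2 : ℝ)) * Real.exp (-a) * 1 := by gcongr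
    _ = _ := by field_simp

/-- Multiplying by a Lipschitz cutoff costs a multiple of `s` in the energy at scale `s`. -/
theorem heatEnergy_mul_le {u χ : 𝔼 → ℝ} (hu : Measurable u) {K : NNReal}
    (hχ : LipschitzWith K χ) (hχ1 : ∀ x, |χ x| ≤ 1) {s : ℝ} (hs : 0 < s) :
    heatEnergy (fun x => χ x * u x) s ≤ 2 * heatEnergy u s +
      ENNReal.ofReal (2 * K ^ 2 * (2 / Real.pi * 2 ^ (Module.finrank ℝ 𝔼 / 2 : ℝ))) *
        (∫⁻ x, ‖u x‖ₑ ^ 2) * ENNReal.ofReal s := by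
  have hχm : Measurable χ := hχ.continuous.measurable
  set c : ℝ := 2 / Real.pi * 2 ^ (Module.finrank ℝ 𝔼 / 2 : ℝ) with hc
  have hc0 : 0 ≤ c := by positivity
  have htrans : ∀ z, transEnergy (fun x => χ x * u x) z ≤
      2 * transEnergy u z + ENNReal.ofReal (2 * K ^ 2 * ‖z‖ ^ 2) * ∫⁻ x, ‖u x‖ₑ ^ 2 := by
    intro z
    rw [transEnergy, transEnergy, ← lintegral_const_mul _ (by fun_prop),
      ← lintegral_const_mul _ (by fun_prop), ← lintegral_add_left (by fun_prop)]
    refine lintegral_mono fun x => ?_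
    have e2 : ∀ a : ℝ≥0∞, 2 * a = ENNReal.ofReal 2 * a := fun a => by simp
    rw [enorm_sq_eq_ofReal_sq, enorm_sq_eq_ofReal_sq, enorm_sq_eq_ofReal_sq,
      e2, ← ENNReal.ofReal_mul zero_le_two,
      ← ENNReal.ofReal_mul (by positivity), ← ENNReal.ofReal_add (by positivity) (by positivity)]
    refine ENNReal.ofReal_le_ofReal ?_
    have h1 : |χ (x + z) - χ x| ≤ K * ‖z‖ := by
      have := hχ.dist_le_mul (x + z) x
      rwa [Real.dist_eq, dist_self_add_left] at this
    have h2 : (χ (x + z) - χ x) ^ 2 ≤ K ^ 2 * ‖z‖ ^ 2 := by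
      rw [← mul_pow, ← sq_abs]; gcongr
    have h3 : χ (x + z) ^ 2 ≤ 1 := by
      rw [← sq_abs]; exact pow_le_one₀ (abs_nonneg _) (hχ1 _)
    calc (χ (x + z) * u (x + z) - χ x * u x) ^ 2
        = (χ (x + z) * (u (x + z) - u x) + (χ (x + z) - χ x) * u x) ^ 2 := by ring
      _ ≤ 2 * (χ (x + z) * (u (x + z) - u x)) ^ 2 + 2 * ((χ (x + z) - χ x) * u x) ^ 2 := by
        nlinarith [sq_nonneg (χ (x + z) * (u (x + z) - u x) - (χ (x + z) - χ x) * u x)]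
      _ = 2 * (χ (x + z) ^ 2 * (u (x + z) - u x) ^ 2) +
          2 * ((χ (x + z) - χ x) ^ 2 * u x ^ 2) := by ring
      _ ≤ 2 * (1 * (u (x + z) - u x) ^ 2) + 2 * ((K ^ 2 * ‖z‖ ^ 2) * u x ^ 2) := by gcongr
      _ = _ := by ring
  have hk := measurable_heatKernel_right (V := 𝔼) s
  have hk2 := measurable_heatKernel_right (V := 𝔼) (2 * s)
  calc heatEnergy (fun x => χ x * u x) s
      ≤ ∫⁻ z : 𝔼, (2 * (ENNReal.ofReal (heatKernel s z) * transEnergy u z) +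
        ENNReal.ofReal (2 * K ^ 2 * c * s) * (∫⁻ x, ‖u x‖ₑ ^ 2) *
          ENNReal.ofReal (heatKernel (2 * s) z)) := by
        refine lintegral_mono fun z => ?_
        refine (mul_le_mul_right (htrans z) _).trans ?_
        rw [mul_add]
        refine add_le_add (le_of_eq (by ring)) ?_
        rw [← mul_assoc, mul_right_comm (ENNReal.ofReal (2 * K ^ 2 * c * s)),
          ← ENNReal.ofReal_mul (heatKernel_pos hs z).le, ← ENNReal.ofReal_mul (by positivity)]
        refine mul_le_mul_left (ENNReal.ofReal_le_ofReal ?_) _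
        have := norm_sq_mul_heatKernel_le hs z
        calc heatKernel s z * (2 * K ^ 2 * ‖z‖ ^ 2)
            = 2 * K ^ 2 * (‖z‖ ^ 2 * heatKernel s z) := by ring
          _ ≤ 2 * K ^ 2 * (c * s * heatKernel (2 * s) z) := by gcongr
          _ = _ := by ring
    _ = 2 * heatEnergy u s + ENNReal.ofReal (2 * K ^ 2 * c * s) * (∫⁻ x, ‖u x‖ₑ ^ 2) := by
        rw [lintegral_add_right _ (by fun_prop),
          lintegral_const_mul _ (show Measurable fun z : 𝔼 => ENNReal.ofReal (heatKernel s z) *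
            transEnergy u z from hk.ennreal_ofReal.mul (measurable_transEnergy hu)),
          lintegral_const_mul _ (by fun_prop), lintegral_heatKernel (by positivity), mul_one]
        rfl
    _ = _ := by
        rw [ENNReal.ofReal_mul (by positivity)]
        ring

/-- Mollifying with a kernel dominated by the Gaussian at scale `s` moves a function by at most its
energy at that scale.  Vector-valued kernels also cover the gradient of the mollification. -/
theorem lintegral_enorm_integral_sub_smul_sq_le {F : Type*} [NormedAddCommGroup F]
    [NormedSpace ℝ F] {v : 𝔼 → ℝ} (hv : Measurable v) {G : 𝔼 → F} {s : ℝ} (hs : 0 < s)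
    {B : ℝ≥0∞} (hG : ∀ w, ‖G w‖ₑ ≤ B * ENNReal.ofReal (heatKernel s w)) :
    ∫⁻ x, ‖∫ w, (v (x - w) - v x) • G w‖ₑ ^ 2 ≤ B ^ 2 * heatEnergy v s := by
  have hk := measurable_heatKernel_right (V := 𝔼) s
  have hpt : ∀ x, ‖∫ w, (v (x - w) - v x) • G w‖ₑ ^ 2 ≤
      B * ∫⁻ w, B * ENNReal.ofReal (heatKernel s w) * ‖v (x - w) - v x‖ₑ ^ 2 := by
    intro x
    calc ‖∫ w, (v (x - w) - v x) • G w‖ₑ ^ 2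
        ≤ (∫⁻ w, ‖(v (x - w) - v x) • G w‖ₑ) ^ 2 := by
          gcongr; exact enorm_integral_le_lintegral_enorm _
      _ ≤ (∫⁻ w, B * ENNReal.ofReal (heatKernel s w) * ‖v (x - w) - v x‖ₑ) ^ 2 := by
          gcongr with w
          rw [enorm_smul, mul_comm]
          gcongr
          exact hG w
      _ ≤ _ := by
          refine (lintegral_mul_sq_le (by fun_prop) (by fun_prop)).trans (le_of_eq ?_)
          rw [lintegral_const_mul _ (by fun_prop), lintegral_heatKernel hs, mul_one]
  refine (lintegral_mono hpt).trans (le_of_eq ?_)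
  have hm : Measurable (fun p : 𝔼 × 𝔼 => B * ENNReal.ofReal (heatKernel s p.2) *
      ‖v (p.1 - p.2) - v p.1‖ₑ ^ 2) :=
    ((hk.comp measurable_snd).ennreal_ofReal.const_mul B).mul (by fun_prop)
  rw [lintegral_const_mul _ hm.lintegral_prod_right', lintegral_lintegral_swap hm.aemeasurable,
    ← lintegral_neg_eq_self]
  have e : ∀ w : 𝔼, ∫⁻ x, B * ENNReal.ofReal (heatKernel s (-w)) * ‖v (x - -w) - v x‖ₑ ^ 2 =
      B * (ENNReal.ofReal (heatKernel s w) * transEnergy v w) := by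
    intro w
    rw [lintegral_const_mul _ (by fun_prop), mul_assoc]
    simp [heatKernel, transEnergy]
  simp_rw [e]
  rw [lintegral_const_mul _ (show Measurable fun z : 𝔼 => ENNReal.ofReal (heatKernel s z) *
    transEnergy v z from hk.ennreal_ofReal.mul (measurable_transEnergy hv)), ← mul_assoc, sq]
  rfl

theorem exists_normalised_bump (ν : 𝔼) {δ : ℝ} (hδ : 0 < δ) : ∃ η : 𝔼 → ℝ,
    ContDiff ℝ ∞ η ∧ HasCompactSupport η ∧ (∀ y, η y ≠ 0 → dist y ν ≤ δ) ∧ ∫ y, η y = 1 := by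
  let φ : ContDiffBump ν := ⟨δ / 2, δ, by positivity, by linarith⟩
  refine ⟨φ.normed volume, φ.contDiff_normed, φ.hasCompactSupport_normed, fun y hy => ?_,
    φ.integral_normed⟩
  have h := subset_tsupport _ (Function.mem_support.2 hy)
  rwa [φ.tsupport_normed_eq] at h

/-- A continuous function with compact support is dominated by a Gaussian. -/
theorem exists_norm_le_gaussian {F : Type*} [NormedAddCommGroup F] [NormedSpace ℝ F] {η : 𝔼 → F}
    (hη : Continuous η) (hc : HasCompactSupport η) :
    ∃ B : ℝ, 0 ≤ B ∧ ∀ y, ‖η y‖ ≤ B * Real.exp (-(Real.pi * ‖y‖ ^ 2)) := by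
  obtain ⟨B, hB⟩ := Continuous.bounded_above_of_compact_support
    (f := fun y => Real.exp (Real.pi * ‖y‖ ^ 2) • η y) (by fun_prop) hc.smul_left
  refine ⟨B, (norm_nonneg _).trans (hB 0), fun y => ?_⟩
  have h := hB y
  rw [norm_smul, Real.norm_of_nonneg (Real.exp_pos _).le] at h
  rw [Real.exp_neg, ← div_eq_mul_inv, le_div_iff₀ (Real.exp_pos _), mul_comm]
  exact h

theorem heatKernel_sq {t : ℝ} (ht : 0 < t) (w : 𝔼) :
    heatKernel (t ^ 2) w = (t ^ n)⁻¹ * Real.exp (-(Real.pi * ‖t⁻¹ • w‖ ^ 2)) := by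
  have h1 : (t ^ 2) ^ (-(Module.finrank ℝ 𝔼 / 2 : ℝ)) = (t ^ n)⁻¹ := by
    rw [finrank_euclideanSpace, Fintype.card_fin, ← Real.rpow_natCast t 2, ← Real.rpow_mul ht.le,
      ← Real.rpow_natCast t n, ← Real.rpow_neg ht.le]
    congr 1
    push_cast
    ring
  rw [heatKernel, h1, norm_smul, norm_inv, Real.norm_of_nonneg ht.le]
  congr 2
  field_simp

/-- A family of smooth approximate identities at all scales `t`, supported in the truncated cone
generated by a fixed ball and dominated by Gaussians. -/
theorem exists_cone_mollifier (ν : 𝔼) {δ : ℝ} (hδ : 0 < δ) : ∃ B : ℝ, 0 ≤ B ∧ ∀ t : ℝ, 0 < t →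
    ∃ g : 𝔼 → ℝ, ContDiff ℝ ∞ g ∧ HasCompactSupport g ∧
      (∀ w, g w ≠ 0 → ∃ z, dist z ν ≤ δ ∧ w = t • z) ∧ ∫ w, g w = 1 ∧
      (∀ w, ‖g w‖ ≤ B * heatKernel (t ^ 2) w) ∧
      (∀ w, t * ‖fderiv ℝ g w‖ ≤ B * heatKernel (t ^ 2) w) := by
  obtain ⟨η, hηs, hηc, hsupp, hint⟩ := exists_normalised_bump ν hδ
  obtain ⟨B₁, hB₁, hη₁⟩ := exists_norm_le_gaussian hηs.continuous hηc
  obtain ⟨B₂, hB₂, hη₂⟩ := exists_norm_le_gaussian (hηs.continuous_fderiv (by simp))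
    (hηc.fderiv (𝕜 := ℝ))
  refine ⟨max B₁ B₂, le_max_of_le_left hB₁, fun t ht =>
    ⟨fun w => (t ^ n)⁻¹ * η (t⁻¹ • w), ?_, ?_, ?_, ?_, ?_, ?_⟩⟩
  · exact contDiff_const.mul (hηs.comp (contDiff_const_smul _))
  · exact (hηc.comp_homeomorph (Homeomorph.smulOfNeZero t⁻¹ (inv_ne_zero ht.ne'))).mul_left
  · intro w hw
    exact ⟨t⁻¹ • w, hsupp _ (right_ne_zero_of_mul hw), by rw [smul_inv_smul₀ ht.ne']⟩
  · rw [integral_const_mul, Measure.integral_comp_inv_smul_of_nonneg _ _ ht.le, hint,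
      finrank_euclideanSpace, Fintype.card_fin, smul_eq_mul, mul_one,
      inv_mul_cancel₀ (by positivity)]
  · intro w
    rw [heatKernel_sq ht, norm_mul, Real.norm_of_nonneg (by positivity : 0 ≤ (t ^ n)⁻¹),
      mul_left_comm]
    gcongr
    exact (hη₁ _).trans (by gcongr; exact le_max_left _ _)
  · intro w
    have hd : fderiv ℝ (fun w => (t ^ n)⁻¹ * η (t⁻¹ • w)) w =
        (t ^ n)⁻¹ • t⁻¹ • fderiv ℝ η (t⁻¹ • w) := by
      rw [← fderiv_comp_smul]
      exact fderiv_const_mul ((hηs.differentiable (by simp)).comp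
        (differentiable_id.const_smul t⁻¹) w) _
    rw [heatKernel_sq ht, hd, norm_smul, norm_smul,
      Real.norm_of_nonneg (by positivity : 0 ≤ (t ^ n)⁻¹),
      Real.norm_of_nonneg (by positivity : 0 ≤ t⁻¹), mul_left_comm, mul_inv_cancel_left₀ ht.ne',
      mul_left_comm]
    gcongr
    exact (hη₂ _).trans (by gcongr; exact le_max_right _ _)

end Mollification

/-! ### Finiteness of the Navier form -/

section NavierFinite

variable {n : ℕ} {Ω : Set (EuclideanSpace ℝ (Fin n))} {s : ℝ}

local notation "𝔼" => EuclideanSpace ℝ (Fin n)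

/-- The variational upper bound: `1 - (1 - sΔ)⁻¹` has the form
`f ↦ min (‖f - v‖² + s ‖∇v‖²)`. -/
theorem resolventEnergy_le_of_isTestFunction (hs : 0 ≤ s) {u : 𝔼 → ℝ}
    (hu : MemLp u 2 (volume.restrict Ω)) {ψ : 𝔼 → ℝ} (hψ : IsTestFunction Ω ψ) :
    resolventEnergy Ω (hu.toLp u) s ≤
      (∫⁻ x, ‖ψ x - u x‖ₑ ^ 2) + ENNReal.ofReal s * ∫⁻ x, ‖gradient ψ x‖ₑ ^ 2 := by
  have h := norm_inl_sub_sq (s := s) (hu.toLp u) (hψ.toPair_mem s)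
  have e1 : (L2Pair.inl Ω (hu.toLp u) - hψ.toPair s).fst = hu.toLp u - hψ.memLp.toLp ψ := rfl
  have e2 : (L2Pair.inl Ω (hu.toLp u) - hψ.toPair s).snd =
      0 - Real.sqrt s • hψ.memLp_gradient.toLp (gradient ψ) := rfl
  rw [L2Pair.norm_sq_eq, e1, e2, zero_sub, norm_neg, norm_smul,
    Real.norm_of_nonneg (Real.sqrt_nonneg s), mul_pow, Real.sq_sqrt hs] at h
  have h1 : ENNReal.ofReal (‖hu.toLp u - hψ.memLp.toLp ψ‖ ^ 2) ≤ ∫⁻ x, ‖ψ x - u x‖ₑ ^ 2 := by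
    rw [norm_sub_rev, ENNReal.ofReal_pow (norm_nonneg _), ← eLpNorm_sub_eq_norm, eLpNorm_two_sq]
    refine le_trans (le_of_eq (lintegral_congr_ae ?_)) (setLIntegral_le_lintegral Ω _)
    filter_upwards [hu.coeFn_toLp] with x hx
    rw [hx]
  rw [lintegral_gradient_eq hψ, ← ENNReal.ofReal_mul hs]
  refine (ENNReal.ofReal_le_ofReal (le_of_le_of_eq ?_ h.symm)).trans
    (ENNReal.ofReal_add_le.trans (add_le_add h1 le_rfl))
  exact le_add_of_nonneg_right (sq_nonneg _)

theorem resolventEnergy_le (f : L2 Ω ℝ) (s : ℝ) :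
    resolventEnergy Ω f s ≤ ENNReal.ofReal (‖f‖ ^ 2) :=
  ENNReal.ofReal_le_ofReal (by linarith [inner_resolvent_self_nonneg (s := s) f])

/-- The parallelogram inequality for a nonnegative quadratic form. -/
theorem resolventEnergy_add_le (f g : L2 Ω ℝ) (s : ℝ) : resolventEnergy Ω (f + g) s ≤
    2 * resolventEnergy Ω f s + 2 * resolventEnergy Ω g s := by
  have hf := inner_resolvent_self_le (s := s) f
  have hg := inner_resolvent_self_le (s := s) g
  have hfg := inner_resolvent_self_le (s := s) (f - g)
  have e2 : ∀ a : ℝ≥0∞, 2 * a = ENNReal.ofReal 2 * a := fun a => by simp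
  rw [resolventEnergy, resolventEnergy, resolventEnergy, e2, e2, ← ENNReal.ofReal_mul zero_le_two,
    ← ENNReal.ofReal_mul zero_le_two, ← ENNReal.ofReal_add (by linarith) (by linarith)]
  refine ENNReal.ofReal_le_ofReal ?_
  rw [norm_sub_sq_real, map_sub, inner_sub_left, inner_sub_right, inner_sub_right] at hfg
  rw [norm_add_sq_real, map_add, inner_add_left, inner_add_right, inner_add_right]
  linarith

open scoped Convolution in
/-- If `v` lives on a compact set from which a truncated cone of directions leads into `Ω`,
mollifying `v` along this cone at scale `√s` gives a test function on `Ω`. -/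
theorem exists_resolventEnergy_le_heatEnergy {v : 𝔼 → ℝ} (hv : Measurable v) (hv2 : MemLp v 2)
    {K : Set 𝔼} (hK : IsCompact K) (hvK : ∀ x, v x ≠ 0 → x ∈ K) {ν : 𝔼} {δ r : ℝ} (hδ : 0 < δ)
    (hcone : ∀ y ∈ K, ∀ t, 0 < t → t < r → ∀ z, dist z ν ≤ δ → y + t • z ∈ Ω) :
    ∃ C : ℝ≥0∞, C ≠ ⊤ ∧ ∀ s, 0 < s → Real.sqrt s < r →
      resolventEnergy Ω ((hv2.restrict Ω).toLp v) s ≤ C * heatEnergy v s := by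
  obtain ⟨B, hB, hg⟩ := exists_cone_mollifier ν hδ
  refine ⟨2 * ENNReal.ofReal B ^ 2, by finiteness, fun s hs hsr => ?_⟩
  have ht : 0 < Real.sqrt s := Real.sqrt_pos.2 hs
  obtain ⟨g, hgs, hgc, hgsupp, hgint, hgB, hgB'⟩ := hg _ ht
  rw [Real.sq_sqrt hs.le] at hgB hgB'
  set t := Real.sqrt s with htdef
  have hloc : LocallyIntegrable v := hv2.locallyIntegrable one_le_two
  set ψ : 𝔼 → ℝ := g ⋆[ContinuousLinearMap.mul ℝ ℝ, volume] v with hψdef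
  have hψx : ∀ x, ψ x = ∫ w, g w * v (x - w) := fun x => rfl
  have hconv : ∀ x, Integrable (fun w => g w * v (x - w)) := fun x =>
    hgc.convolutionExists_left (ContinuousLinearMap.mul ℝ ℝ) hgs.continuous hloc x
  have hgi : Integrable g := hgs.continuous.integrable_of_hasCompactSupport hgc
  have hT : IsCompact ((fun p : 𝔼 × 𝔼 => p.1 + t • p.2) '' (K ×ˢ Metric.closedBall ν δ)) :=
    (hK.prod (isCompact_closedBall ν δ)).image (by fun_prop)
  have hsupp : Function.support ψ ⊆
      (fun p : 𝔼 × 𝔼 => p.1 + t • p.2) '' (K ×ˢ Metric.closedBall ν δ) := by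
    intro x hx
    obtain ⟨w, hw⟩ : ∃ w, g w * v (x - w) ≠ 0 := by
      by_contra! h
      exact hx (by simp [hψx, h])
    obtain ⟨z, hz, rfl⟩ := hgsupp w (left_ne_zero_of_mul hw)
    exact ⟨(x - t • z, z), ⟨hvK _ (right_ne_zero_of_mul hw), hz⟩, sub_add_cancel _ _⟩
  have hψ : IsTestFunction Ω ψ := by
    refine ⟨hgc.contDiff_convolution_left _ hgs hloc,
      HasCompactSupport.of_support_subset_isCompact hT hsupp,
      (closure_minimal hsupp hT.isClosed).trans ?_⟩
    rintro _ ⟨⟨y, z⟩, ⟨hy, hz⟩, rfl⟩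
    exact hcone y hy t ht hsr z hz
  have hdiff : ∀ x, ψ x - v x = ∫ w, (v (x - w) - v x) • g w := by
    intro x
    have h1 : ∀ w, (v (x - w) - v x) • g w = g w * v (x - w) - v x * g w := fun w => by
      rw [smul_eq_mul]; ring
    simp_rw [h1]
    rw [integral_sub (hconv x) (hgi.const_mul _), integral_const_mul, hgint, mul_one, hψx]
  have hderiv : ∀ x, fderiv ℝ ψ x = ∫ w, (v (x - w) - v x) • fderiv ℝ g w := by
    intro x
    -- the gradient of the kernel has integral zero, so that `v x` can be subtracted from `v`
    have h1 := hgc.hasFDerivAt_convolution_left (ContinuousLinearMap.mul ℝ ℝ)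
      (hgs.of_le (by simp)) (hloc.sub (locallyIntegrable_const (v x))) x
    have h2 : (g ⋆[ContinuousLinearMap.mul ℝ ℝ, volume] (v - fun _ => v x)) =
        fun y => ψ y - v x := by
      funext y
      have h3 : ∀ w, g w * (v (y - w) - v x) = g w * v (y - w) - v x * g w := fun w => by ring
      change ∫ w, g w * (v (y - w) - v x) = _
      simp_rw [h3]
      rw [integral_sub (hconv y) (hgi.const_mul _), integral_const_mul, hgint, mul_one, hψx]
    rw [h2] at h1
    have h4 := h1.fderiv
    rw [fderiv_sub_const] at h4
    rw [h4, convolution_def]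
    refine integral_congr_ae (ae_of_all _ fun w => ?_)
    ext e
    simp [ContinuousLinearMap.precompL_apply, mul_comm, sub_mul]
  have hb1 : ∫⁻ x, ‖ψ x - v x‖ₑ ^ 2 ≤ ENNReal.ofReal B ^ 2 * heatEnergy v s := by
    simp_rw [hdiff]
    refine lintegral_enorm_integral_sub_smul_sq_le hv hs fun w => ?_
    rw [← ofReal_norm, ← ENNReal.ofReal_mul hB]
    exact ENNReal.ofReal_le_ofReal (hgB w)
  have hb2 : ∫⁻ x, ‖gradient ψ x‖ₑ ^ 2 ≤ ENNReal.ofReal (B / t) ^ 2 * heatEnergy v s := by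
    simp_rw [← ofReal_norm, norm_gradient_eq, ofReal_norm, hderiv]
    refine lintegral_enorm_integral_sub_smul_sq_le hv hs fun w => ?_
    rw [← ofReal_norm, ← ENNReal.ofReal_mul (by positivity)]
    refine ENNReal.ofReal_le_ofReal ?_
    rw [div_mul_eq_mul_div, le_div_iff₀ ht, mul_comm]
    exact hgB' w
  have hst : ENNReal.ofReal s * ENNReal.ofReal (B / t) ^ 2 = ENNReal.ofReal B ^ 2 := by
    rw [← ENNReal.ofReal_pow (by positivity), ← ENNReal.ofReal_mul hs.le,
      ← ENNReal.ofReal_pow hB, div_pow, Real.sq_sqrt hs.le, mul_div_cancel₀ _ hs.ne']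
  calc _ ≤ _ := resolventEnergy_le_of_isTestFunction hs.le (hv2.restrict Ω) hψ
    _ ≤ ENNReal.ofReal B ^ 2 * heatEnergy v s +
        ENNReal.ofReal s * (ENNReal.ofReal (B / t) ^ 2 * heatEnergy v s) := by gcongr
    _ = _ := by rw [← mul_assoc, hst]; ring

theorem lintegral_resolventEnergy_add_lt_top (hΩ : IsOpen Ω) (hb : Bornology.IsBounded Ω) {m : ℝ}
    {f g : L2 Ω ℝ}
    (hf : ∫⁻ s in Set.Ioi (0 : ℝ), ENNReal.ofReal (s ^ (-1 - m)) * resolventEnergy Ω f s < ⊤)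
    (hg : ∫⁻ s in Set.Ioi (0 : ℝ), ENNReal.ofReal (s ^ (-1 - m)) * resolventEnergy Ω g s < ⊤) :
    ∫⁻ s in Set.Ioi (0 : ℝ), ENNReal.ofReal (s ^ (-1 - m)) * resolventEnergy Ω (f + g) s < ⊤ := by
  have hm := aemeasurable_resolventEnergy hΩ hb f
  calc _ ≤ ∫⁻ s in Set.Ioi (0 : ℝ), (2 * (ENNReal.ofReal (s ^ (-1 - m)) * resolventEnergy Ω f s) +
        2 * (ENNReal.ofReal (s ^ (-1 - m)) * resolventEnergy Ω g s)) := by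
        refine lintegral_mono fun s => ?_
        refine (mul_le_mul_right (resolventEnergy_add_le f g s) _).trans (le_of_eq (by ring))
    _ < ⊤ := by
        rw [lintegral_add_left' (by fun_prop), lintegral_const_mul' _ _ (by finiteness),
          lintegral_const_mul' _ _ (by finiteness)]
        finiteness

/-- A localised piece `χ u` has finite Navier energy when a common cone of directions leads from its
support into `Ω`. Mollification handles `√s < r`; at larger scales the trivial bound by `‖χ u‖²` is
enough. -/
theorem lintegral_resolventEnergy_mul_lt_top {m : ℝ} (hm0 : 0 < m) (hm1 : m < 1) {u : 𝔼 → ℝ}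
    (hu : Measurable u) (hu2 : MemLp u 2) (hfin : gagliardo m u ≠ ⊤) {χ : 𝔼 → ℝ}
    (hχ : ContDiff ℝ ∞ χ) (hχc : HasCompactSupport χ) (hχ1 : ∀ x, |χ x| ≤ 1)
    (hχu : MemLp (fun x => χ x * u x) 2)
    {K : Set 𝔼} (hK : IsCompact K) (hvK : ∀ x, χ x * u x ≠ 0 → x ∈ K) {ν : 𝔼} {δ r : ℝ}
    (hδ : 0 < δ) (hr : 0 < r) (hr1 : r ≤ 1)
    (hcone : ∀ y ∈ K, ∀ t, 0 < t → t < r → ∀ z, dist z ν ≤ δ → y + t • z ∈ Ω) :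
    ∫⁻ s in Set.Ioi (0 : ℝ), ENNReal.ofReal (s ^ (-1 - m)) *
      resolventEnergy Ω ((hχu.restrict Ω).toLp _) s < ⊤ := by
  obtain ⟨L, hL⟩ := hχ.lipschitzWith_of_hasCompactSupport hχc (by simp)
  obtain ⟨C, hC, hle⟩ := exists_resolventEnergy_le_heatEnergy
    (hχ.continuous.measurable.mul hu) hχu hK hvK hδ hcone
  set D : ℝ≥0∞ := ENNReal.ofReal (2 * L ^ 2 * (2 / Real.pi *
    2 ^ (Module.finrank ℝ 𝔼 / 2 : ℝ))) * ∫⁻ x, ‖u x‖ₑ ^ 2 with hD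
  have hu3 : ∫⁻ x, ‖u x‖ₑ ^ 2 < ⊤ := by
    rw [← eLpNorm_two_sq]; exact ENNReal.pow_lt_top hu2.2
  have hDtop : D ≠ ⊤ := by rw [hD]; finiteness
  set f := (hχu.restrict Ω).toLp (fun x => χ x * u x) with hf
  set A : ℝ≥0∞ := ENNReal.ofReal (‖f‖ ^ 2 / r ^ 2) with hA
  have hbound : ∀ s ∈ Set.Ioi (0 : ℝ), ENNReal.ofReal (s ^ (-1 - m)) * resolventEnergy Ω f s ≤
      (2 * C) * (ENNReal.ofReal (s ^ (-1 - m)) * heatEnergy u s) +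
        (C * D + A) * (ENNReal.ofReal (s ^ (-1 - m)) * ENNReal.ofReal (min 1 s)) := by
    intro s hs
    have hs0 : 0 < s := hs
    have key : resolventEnergy Ω f s ≤
        (2 * C) * heatEnergy u s + (C * D + A) * ENNReal.ofReal (min 1 s) := by
      rcases lt_or_ge (Real.sqrt s) r with hsr | hsr
      · have hs1 : s ≤ 1 := by
          have := (Real.sqrt_lt' hr).1 hsr
          nlinarith
        rw [min_eq_right hs1]
        calc _ ≤ C * heatEnergy (fun x => χ x * u x) s := hle s hs0 hsr
          _ ≤ C * (2 * heatEnergy u s + D * ENNReal.ofReal s) := by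
            gcongr; exact heatEnergy_mul_le hu hL hχ1 hs0
          _ = (2 * C) * heatEnergy u s + C * D * ENNReal.ofReal s := by ring
          _ ≤ _ := by gcongr; exact le_self_add
      · have hrs : r ^ 2 ≤ min 1 s :=
          le_min (pow_le_one₀ hr.le hr1) ((Real.le_sqrt' hr).1 hsr)
        calc _ ≤ ENNReal.ofReal (‖f‖ ^ 2) := resolventEnergy_le f s
          _ ≤ A * ENNReal.ofReal (min 1 s) := by
            rw [hA, ← ENNReal.ofReal_mul (by positivity)]
            refine ENNReal.ofReal_le_ofReal ?_
            calc ‖f‖ ^ 2 = ‖f‖ ^ 2 / r ^ 2 * r ^ 2 := by field_simp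
              _ ≤ _ := by gcongr
          _ ≤ (C * D + A) * ENNReal.ofReal (min 1 s) := by gcongr; exact le_add_self
          _ ≤ _ := le_add_self
    calc _ ≤ ENNReal.ofReal (s ^ (-1 - m)) *
        ((2 * C) * heatEnergy u s + (C * D + A) * ENNReal.ofReal (min 1 s)) := by gcongr
      _ = _ := by ring
  have hmin := lintegral_Ioi_rpow_mul_min_lt_top hm0 hm1
  have hgag : ∫⁻ s in Set.Ioi (0 : ℝ), ENNReal.ofReal (s ^ (-1 - m)) * heatEnergy u s < ⊤ :=
    hfin.lt_top
  refine (setLIntegral_mono' measurableSet_Ioi hbound).trans_lt ?_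
  rw [lintegral_add_right _ (by fun_prop), lintegral_const_mul' _ _ (by finiteness),
    lintegral_const_mul' _ _ (by finiteness)]
  finiteness

open scoped Manifold in
/-- On a smooth bounded domain, finite Gagliardo energy of the extension by zero gives a finite
Navier form. -/
theorem navierForm_lt_top (hΩ : IsBoundedSmoothDomain Ω) {m : ℝ} (hm0 : 0 < m) (hm1 : m < 1)
    {u : 𝔼 → ℝ} (hu : Measurable u) (hu2 : MemLp u 2) (h0 : ∀ x, x ∉ closure Ω → u x = 0)
    (hfin : gagliardo m u ≠ ⊤) : navierForm m Ω u < ⊤ := by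
  suffices h : ∫⁻ s in Set.Ioi (0 : ℝ), ENNReal.ofReal (s ^ (-1 - m)) *
      resolventEnergy Ω ((hu2.restrict Ω).toLp u) s < ⊤ by
    rw [← navierConst_mul_navierForm hΩ.isOpen hΩ.isBounded hm0] at h
    exact ENNReal.lt_top_of_mul_ne_top_right h.ne (navierConst_ne_zero m)
  have hcompact : IsCompact (closure Ω) := hΩ.isBounded.isCompact_closure
  choose ν δ r hδ hr hr1 hcone using fun x : closure Ω => hΩ.exists_cone x.2
  obtain ⟨T, hT⟩ := hcompact.elim_finite_subcover (fun x : closure Ω => Metric.ball (x : 𝔼) (r x))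
    (fun _ => Metric.isOpen_ball)
    fun x hx => Set.mem_iUnion.2 ⟨⟨x, hx⟩, Metric.mem_ball_self (hr _)⟩
  obtain ⟨χ, hχ⟩ := SmoothPartitionOfUnity.exists_isSubordinate 𝓘(ℝ, 𝔼) isClosed_closure
    (fun i : T => Metric.ball ((i : closure Ω) : 𝔼) (r i)) (fun _ => Metric.isOpen_ball)
    (hT.trans (by simp [Set.iUnion_subtype]))
  have hχs : ∀ i, ContDiff ℝ ∞ (χ i) := fun i => (χ i).contMDiff.contDiff
  have hχc : ∀ i, HasCompactSupport (χ i) := fun i =>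
    (Metric.isBounded_ball.subset (hχ i)).isCompact_closure.of_isClosed_subset
      (isClosed_tsupport _) subset_closure
  have hχ1 : ∀ i x, |χ i x| ≤ 1 := fun i x => by
    rw [abs_of_nonneg (χ.nonneg i x)]; exact χ.le_one i x
  have hχu : ∀ i, MemLp (fun x => χ i x * u x) 2 := fun i =>
    hu2.of_le ((hχs i).continuous.measurable.mul hu).aestronglyMeasurable (ae_of_all _ fun x => by
      rw [norm_mul]; exact mul_le_of_le_one_left (norm_nonneg _) (hχ1 i x))
  have hsum : (hu2.restrict Ω).toLp u =
      ∑ i, ((hχu i).restrict Ω).toLp (fun x => χ i x * u x) := by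
    refine Lp.ext ?_
    have hall := (Finset.eventually_all (l := ae (volume.restrict Ω)) Finset.univ).2
      fun i _ => ((hχu i).restrict Ω).coeFn_toLp
    filter_upwards [hall, (hu2.restrict Ω).coeFn_toLp, Lp.coeFn_finsetSum Finset.univ
      (fun i => ((hχu i).restrict Ω).toLp (fun x => χ i x * u x))] with x h1 h2 h3
    rw [h2, h3, Finset.sum_apply, Finset.sum_congr rfl h1, ← Finset.sum_mul]
    by_cases hx : x ∈ closure Ω
    · rw [← finsum_eq_sum_of_fintype, χ.sum_eq_one hx, one_mul]
    · rw [h0 x hx, mul_zero]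
  rw [hsum]
  refine Finset.sum_induction _ (fun f : L2 Ω ℝ => ∫⁻ s in Set.Ioi (0 : ℝ),
    ENNReal.ofReal (s ^ (-1 - m)) * resolventEnergy Ω f s < ⊤)
    (fun f g => lintegral_resolventEnergy_add_lt_top hΩ.isOpen hΩ.isBounded)
    (by simp [resolventEnergy]) fun i _ => ?_
  refine lintegral_resolventEnergy_mul_lt_top hm0 hm1 hu hu2 hfin (hχs i) (hχc i) (hχ1 i) (hχu i)
    (hcompact.inter_right (isClosed_tsupport (χ i))) (fun x hx => ?_) (hδ i) (hr i) (hr1 i)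
    fun y hy => hcone i y hy.1 (hχ i hy.2)
  refine ⟨?_, subset_tsupport _ (left_ne_zero_of_mul hx)⟩
  by_contra h
  exact right_ne_zero_of_mul hx (h0 x h)

end NavierFinite

/-! ### Positivity of the resolvent -/

section Positivity

variable {n : ℕ} {Ω : Set (EuclideanSpace ℝ (Fin n))} {s : ℝ}

local notation "𝔼" => EuclideanSpace ℝ (Fin n)

theorem gradient_comp_real {ψ : 𝔼 → ℝ} {F : ℝ → ℝ} {F' : ℝ} {x : 𝔼}
    (hF : HasDerivAt F F' (ψ x)) (hψ : DifferentiableAt ℝ ψ x) :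
    gradient (fun x => F (ψ x)) x = F' • gradient ψ x := by
  have h : HasFDerivAt (fun x => F (ψ x)) (F' • fderiv ℝ ψ x) x :=
    hF.comp_hasFDerivAt x hψ.hasFDerivAt
  simp only [gradient]
  rw [h.fderiv, map_smul]

theorem IsTestFunction.comp_real {ψ : 𝔼 → ℝ} (hψ : IsTestFunction Ω ψ) {F : ℝ → ℝ}
    (hF : ContDiff ℝ ∞ F) (h0 : F 0 = 0) : IsTestFunction Ω (fun x => F (ψ x)) where
  contDiff := hF.comp hψ.contDiff
  hasCompactSupport := hψ.hasCompactSupport.comp_left h0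
  tsupport_subset := (tsupport_comp_subset h0 ψ).trans hψ.tsupport_subset

/-- The derivative of the smooth approximation `√(y² + ε²) - ε` of `|y|`, which vanishes at `0` and
is `1`-Lipschitz. -/
theorem hasDerivAt_sqrt_sq_add {ε : ℝ} (hε : 0 < ε) (y : ℝ) :
    HasDerivAt (fun y => Real.sqrt (y ^ 2 + ε ^ 2) - ε) (y / Real.sqrt (y ^ 2 + ε ^ 2)) y := by
  have h := (((hasDerivAt_pow 2 y).add_const (ε ^ 2)).sqrt (by positivity)).sub_const ε
  refine h.congr_deriv ?_
  rw [show ((2 : ℕ) : ℝ) * y ^ (2 - 1) = 2 * y by norm_num, mul_div_mul_left _ _ two_ne_zero]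

/-- The resolvent is positivity preserving: replacing a competitor `ψ` by a smooth approximation of
`|ψ|` does not increase the functional `‖f - ψ‖² + s ‖∇ψ‖²` when `0 ≤ f`. -/
theorem abs_resolvent_eq (hb : Bornology.IsBounded Ω) {f : L2 Ω ℝ} (hf : |f| = f) :
    |resolvent₀ Ω s f| = resolvent₀ Ω s f := by
  have : IsFiniteMeasure (volume.restrict Ω) := ⟨by
    rw [Measure.restrict_apply_univ]; exact hb.measure_lt_top⟩
  obtain ⟨ψ, h, hψ⟩ := exists_seq_of_mem_formDomain (resolventPair_mem (s := s) f)
  have hv := tendsto_fst_of_toPair hψ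
  have hG := tendsto_snd_of_toPair hψ
  rw [resolventPair_fst] at hv
  set v := resolvent₀ Ω s f with hvdef
  set ε : ℕ → ℝ := fun k => 1 / ((k : ℝ) + 1) with hεdef
  have hε : ∀ k, 0 < ε k := fun k => by positivity
  have hεlim : Tendsto ε atTop (𝓝 0) := tendsto_one_div_add_atTop_nhds_zero_nat
  have hF : ∀ k, IsTestFunction Ω (fun x => Real.sqrt (ψ k x ^ 2 + ε k ^ 2) - ε k) := fun k => by
    refine (h k).comp_real (F := fun y => Real.sqrt (y ^ 2 + ε k ^ 2) - ε k) ?_ ?_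
    · have := hε k
      exact (((contDiff_id.pow 2).add contDiff_const).sqrt fun y => by
        simp only [id]; positivity).sub contDiff_const
    · simp [Real.sqrt_sq (hε k).le]
  have hgrad : ∀ k, ‖(hF k).memLp_gradient.toLp (gradient _)‖ ≤
      ‖(h k).memLp_gradient.toLp (gradient (ψ k))‖ := by
    intro k
    refine Lp.norm_le_norm_of_ae_le ?_
    filter_upwards [(hF k).memLp_gradient.coeFn_toLp, (h k).memLp_gradient.coeFn_toLp] with x h1 h2
    rw [h1, h2, gradient_comp_real (hasDerivAt_sqrt_sq_add (hε k) _)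
      ((h k).contDiff.differentiable (by simp) x), norm_smul]
    refine mul_le_of_le_one_left (norm_nonneg _) ?_
    have hpos : 0 < Real.sqrt (ψ k x ^ 2 + ε k ^ 2) :=
      Real.sqrt_pos.2 (by have := hε k; positivity)
    rw [norm_div, Real.norm_of_nonneg hpos.le, div_le_one hpos]
    exact Real.abs_le_sqrt (by linarith [sq_nonneg (ε k)])
  have habs : ∀ k, ‖(hF k).memLp.toLp _ - |(h k).memLp.toLp (ψ k)|‖ ≤
      ε k * ‖Lp.const 2 (volume.restrict Ω) (1 : ℝ)‖ := by
    intro k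
    refine Lp.norm_le_mul_norm_of_ae_le_mul ?_
    filter_upwards [(hF k).memLp.coeFn_toLp, (h k).memLp.coeFn_toLp,
      Lp.coeFn_abs ((h k).memLp.toLp (ψ k)),
      Lp.coeFn_sub ((hF k).memLp.toLp _) |(h k).memLp.toLp (ψ k)|,
      Lp.coeFn_const 2 (volume.restrict Ω) (1 : ℝ)] with x h1 h2 h3 h4 h5
    rw [h4, Pi.sub_apply, h1, h3, h2, h5, Function.const_apply, norm_one, mul_one, Real.norm_eq_abs,
      abs_le]
    have h6 : |ψ k x| ≤ Real.sqrt (ψ k x ^ 2 + ε k ^ 2) :=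
      Real.abs_le_sqrt (by linarith [sq_nonneg (ε k)])
    have h7 : Real.sqrt (ψ k x ^ 2 + ε k ^ 2) ≤ |ψ k x| + ε k :=
      Real.sqrt_le_iff.2 ⟨by have := hε k; positivity, by
        nlinarith [sq_abs (ψ k x), mul_nonneg (abs_nonneg (ψ k x)) (hε k).le]⟩
    have := hε k
    constructor <;> linarith
  have hlim : Tendsto (fun k => (hF k).memLp.toLp _) atTop (𝓝 |v|) := by
    rw [tendsto_iff_norm_sub_tendsto_zero] at hv ⊢
    refine squeeze_zero (fun _ => norm_nonneg _) (fun k => ?_)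
      (by simpa using (hεlim.mul_const ‖Lp.const 2 (volume.restrict Ω) (1 : ℝ)‖).add hv)
    calc _ = ‖((hF k).memLp.toLp _ - |(h k).memLp.toLp (ψ k)|) +
          (|(h k).memLp.toLp (ψ k)| - |v|)‖ := by rw [sub_add_sub_cancel]
      _ ≤ _ := (norm_add_le _ _).trans (add_le_add (habs k) (norm_abs_sub_abs _ _))
  -- by the Pythagorean identity the excess energy of the competitor controls its distance to `v`
  have hmain : ∀ k, ‖v - (hF k).memLp.toLp _‖ ^ 2 ≤
      ‖f - (hF k).memLp.toLp _‖ ^ 2 - ‖f - v‖ ^ 2 +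
        (‖Real.sqrt s • (h k).memLp_gradient.toLp (gradient (ψ k))‖ ^ 2 -
          ‖(resolventPair Ω s f).snd‖ ^ 2) := by
    intro k
    have h1 := norm_inl_sub_sq (s := s) f ((hF k).toPair_mem s)
    have h2 := norm_inl_sub_sq (s := s) f (resolventPair_mem f)
    have e1 : (L2Pair.inl Ω f - (hF k).toPair s).fst = f - (hF k).memLp.toLp _ := rfl
    have e2 : (L2Pair.inl Ω f - (hF k).toPair s).snd =
      0 - Real.sqrt s • (hF k).memLp_gradient.toLp (gradient _) := rfl
    have e3 : (resolventPair Ω s f - (hF k).toPair s).fst = v - (hF k).memLp.toLp _ := rfl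
    have e4 : (L2Pair.inl Ω f - resolventPair Ω s f).fst = f - v := rfl
    have e5 : (L2Pair.inl Ω f - resolventPair Ω s f).snd = 0 - (resolventPair Ω s f).snd := rfl
    rw [L2Pair.norm_sq_eq, L2Pair.norm_sq_eq (resolventPair Ω s f - _), e1, e2, e3, zero_sub,
      norm_neg] at h1
    rw [L2Pair.norm_sq_eq, e4, e5, zero_sub, norm_neg, sub_self, norm_zero] at h2
    have h3 : ‖Real.sqrt s • (hF k).memLp_gradient.toLp (gradient _)‖ ^ 2 ≤
        ‖Real.sqrt s • (h k).memLp_gradient.toLp (gradient (ψ k))‖ ^ 2 := by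
      rw [norm_smul, norm_smul]
      gcongr
      exact hgrad k
    nlinarith [sq_nonneg ‖(resolventPair Ω s f - (hF k).toPair s).snd‖]
  have h0 : ‖v - |v|‖ ^ 2 ≤ ‖f - |v|‖ ^ 2 - ‖f - v‖ ^ 2 +
      (‖(resolventPair Ω s f).snd‖ ^ 2 - ‖(resolventPair Ω s f).snd‖ ^ 2) :=
    le_of_tendsto_of_tendsto' ((hlim.const_sub v).norm.pow 2)
      ((((hlim.const_sub f).norm.pow 2).sub_const _).add ((hG.norm.pow 2).sub_const _)) hmain
  have h1 : ‖f - |v|‖ ≤ ‖f - v‖ := by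
    calc ‖f - |v|‖ = ‖|f| - |v|‖ := by rw [hf]
      _ ≤ _ := norm_abs_sub_abs _ _
  have h2 : ‖f - |v|‖ ^ 2 ≤ ‖f - v‖ ^ 2 := by gcongr
  have h3 : ‖v - |v|‖ ^ 2 = 0 := le_antisymm (by linarith) (sq_nonneg _)
  exact (sub_eq_zero.1 (norm_eq_zero.1 (pow_eq_zero_iff two_ne_zero |>.1 h3))).symm

/-- Convergence of integrals `∫ bₖ ⟪G, Hₖ⟫` with bounded factors `bₖ` converging almost everywhere
and `Hₖ` converging in `L²`. -/
theorem tendsto_integral_mul_inner {α F : Type*} [MeasurableSpace α] {μ : Measure α}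
    [NormedAddCommGroup F] [InnerProductSpace ℝ F] (G : Lp F 2 μ) {H : ℕ → Lp F 2 μ}
    {H₀ : Lp F 2 μ} (hH : Tendsto H atTop (𝓝 H₀)) {b : ℕ → α → ℝ} {b₀ : α → ℝ} {M : ℝ}
    (hb : ∀ k, AEStronglyMeasurable (b k) μ) (hM : ∀ k x, |b k x| ≤ M)
    (hlim : ∀ᵐ x ∂μ, Tendsto (fun k => b k x) atTop (𝓝 (b₀ x))) :
    Tendsto (fun k => ∫ x, b k x * inner ℝ (G x) (H k x) ∂μ) atTop
      (𝓝 (∫ x, b₀ x * inner ℝ (G x) (H₀ x) ∂μ)) := by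
  have hmem : ∀ k, MemLp (fun x => b k x • G x) 2 μ := fun k =>
    (Lp.memLp G).of_le_mul (c := M) ((hb k).smul (Lp.aestronglyMeasurable G))
      (ae_of_all _ fun x => by rw [norm_smul]; gcongr; exact hM k x)
  have e : ∀ k (K : Lp F 2 μ), inner ℝ ((hmem k).toLp _) K =
      ∫ x, b k x * inner ℝ (G x) (K x) ∂μ := by
    intro k K
    rw [L2.inner_def]
    refine integral_congr_ae ?_
    filter_upwards [(hmem k).coeFn_toLp] with x hx
    rw [hx, real_inner_smul_left]
  have hbound : ∀ k, ‖(hmem k).toLp _‖ ≤ M * ‖G‖ := fun k => by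
    refine Lp.norm_le_mul_norm_of_ae_le_mul ?_
    filter_upwards [(hmem k).coeFn_toLp] with x hx
    rw [hx, norm_smul]
    gcongr
    exact hM k x
  have h1 : Tendsto (fun k => inner ℝ ((hmem k).toLp _) (H k - H₀)) atTop (𝓝 0) := by
    rw [tendsto_iff_norm_sub_tendsto_zero] at hH
    refine squeeze_zero_norm (fun k => (norm_inner_le_norm _ _).trans
      (mul_le_mul_of_nonneg_right (hbound k) (norm_nonneg _))) ?_
    simpa using hH.const_mul (M * ‖G‖)
  have h2 : Tendsto (fun k => ∫ x, b k x * inner ℝ (G x) (H₀ x) ∂μ) atTop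
      (𝓝 (∫ x, b₀ x * inner ℝ (G x) (H₀ x) ∂μ)) := by
    have hi := L2.integrable_inner (𝕜 := ℝ) G H₀
    refine tendsto_integral_of_dominated_convergence
      (fun x => M * ‖(inner ℝ (G x) (H₀ x) : ℝ)‖)
      (fun k => (hb k).mul hi.aestronglyMeasurable) (hi.norm.const_mul M)
      (fun k => ae_of_all _ fun x => ?_) ?_
    · rw [norm_mul]
      gcongr
      exact hM k x
    · filter_upwards [hlim] with x hx
      exact hx.mul_const _
  have h3 := h1.add h2
  rw [zero_add] at h3
  refine h3.congr fun k => ?_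
  rw [inner_sub_right, e, e, sub_add_cancel]

end Positivity

/-! ### Regularised logarithms, and functions with vanishing weak gradient -/

section LogProfile

/-- The derivative of `logProfile ε`. -/
def logSlope (ε y : ℝ) : ℝ := (y + 2 * ε) / ((y + 2 * ε) ^ 2 + ε ^ 2)

/-- A smooth function on `ℝ` vanishing at `0` which for small `ε` behaves like `log (1 + y / ε)` on
`y ≥ 0`.  Divided by `log (1 / ε)`, it tends to the indicator of `y > 0` as `ε → 0`. -/
def logProfile (ε y : ℝ) : ℝ := (Real.log ((y + 2 * ε) ^ 2 + ε ^ 2) - Real.log (5 * ε ^ 2)) / 2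

/-- The derivative of `logSlope ε`. -/
def logCurvature (ε y : ℝ) : ℝ := (ε ^ 2 - (y + 2 * ε) ^ 2) / ((y + 2 * ε) ^ 2 + ε ^ 2) ^ 2

variable {ε : ℝ}

theorem logProfile_zero (ε : ℝ) : logProfile ε 0 = 0 := by
  rw [logProfile, show (0 + 2 * ε) ^ 2 + ε ^ 2 = 5 * ε ^ 2 by ring, sub_self, zero_div]

theorem hasDerivAt_logProfile (hε : 0 < ε) (y : ℝ) :
    HasDerivAt (logProfile ε) (logSlope ε y) y := by
  have h1 : HasDerivAt (fun y => (y + 2 * ε) ^ 2 + ε ^ 2) (2 * (y + 2 * ε)) y := by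
    have := (((hasDerivAt_id y).add_const (2 * ε)).pow 2).add_const (ε ^ 2)
    refine this.congr_deriv ?_
    simp
  have h2 := ((h1.log (by positivity)).sub_const (Real.log (5 * ε ^ 2))).div_const 2
  refine h2.congr_deriv ?_
  rw [logSlope]
  field_simp

theorem hasDerivAt_logSlope (hε : 0 < ε) (y : ℝ) :
    HasDerivAt (logSlope ε) (logCurvature ε y) y := by
  have h1 : HasDerivAt (fun y => (y + 2 * ε) ^ 2 + ε ^ 2) (2 * (y + 2 * ε)) y := by
    have := (((hasDerivAt_id y).add_const (2 * ε)).pow 2).add_const (ε ^ 2)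
    refine this.congr_deriv ?_
    simp
  have h2 := ((hasDerivAt_id y).add_const (2 * ε)).div h1 (by positivity)
  refine h2.congr_deriv ?_
  rw [logCurvature]
  congr 1
  simp only [id]
  ring

theorem contDiff_logProfile (hε : 0 < ε) : ContDiff ℝ ∞ (logProfile ε) := by
  have h : ContDiff ℝ ∞ (fun y : ℝ => (y + 2 * ε) ^ 2 + ε ^ 2) := by fun_prop
  exact ((h.log fun y => by positivity).sub contDiff_const).div_const 2

theorem contDiff_logSlope (hε : 0 < ε) : ContDiff ℝ ∞ (logSlope ε) := by
  have h : ContDiff ℝ ∞ (fun y : ℝ => (y + 2 * ε) ^ 2 + ε ^ 2) := by fun_prop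
  have h' : ContDiff ℝ ∞ (fun y : ℝ => y + 2 * ε) := by fun_prop
  exact h'.div h fun y => by positivity

theorem continuous_logCurvature (hε : 0 < ε) : Continuous (logCurvature ε) := by
  unfold logCurvature
  exact Continuous.div (by fun_prop) (by fun_prop) fun y => by positivity

theorem abs_logSlope_le (hε : 0 < ε) (y : ℝ) : |logSlope ε y| ≤ 1 / ε := by
  rw [logSlope, abs_div, abs_of_pos (by positivity : 0 < (y + 2 * ε) ^ 2 + ε ^ 2),
    div_le_div_iff₀ (by positivity) hε]
  nlinarith [sq_nonneg (|y + 2 * ε| - ε), sq_abs (y + 2 * ε), abs_nonneg (y + 2 * ε),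
    sq_nonneg (y + 2 * ε), sq_nonneg ε]

theorem abs_logCurvature_le (hε : 0 < ε) (y : ℝ) : |logCurvature ε y| ≤ 1 / ε ^ 2 := by
  have hpos : 0 < (y + 2 * ε) ^ 2 + ε ^ 2 := by positivity
  rw [logCurvature, abs_div, abs_of_pos (pow_pos hpos 2), div_le_div_iff₀ (by positivity)
    (by positivity), one_mul]
  have h1 : |ε ^ 2 - (y + 2 * ε) ^ 2| ≤ (y + 2 * ε) ^ 2 + ε ^ 2 := by
    rw [abs_le]; constructor <;> nlinarith [sq_nonneg (y + 2 * ε), sq_nonneg ε]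
  calc |ε ^ 2 - (y + 2 * ε) ^ 2| * ε ^ 2
      ≤ ((y + 2 * ε) ^ 2 + ε ^ 2) * ((y + 2 * ε) ^ 2 + ε ^ 2) := by
        gcongr
        linarith [sq_nonneg (y + 2 * ε)]
    _ = _ := by ring

/-- Quantitative concavity. For the logarithm itself the second derivative is minus the square of
the first. -/
theorem logCurvature_le (hε : 0 < ε) {y : ℝ} (hy : 0 ≤ y) :
    logCurvature ε y ≤ -(1 / 2) * logSlope ε y ^ 2 := by
  rw [logCurvature, logSlope, div_pow, mul_div_assoc', div_le_div_iff_of_pos_right (by positivity)]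
  nlinarith [mul_nonneg hy hε.le, sq_nonneg y]

theorem mul_logSlope_le (hε : 0 < ε) {y : ℝ} (hy : 0 ≤ y) : y * logSlope ε y ≤ 1 := by
  rw [logSlope, mul_div_assoc', div_le_one (by positivity)]
  nlinarith [mul_nonneg hy hε.le, sq_nonneg ε]

theorem logSlope_nonneg (hε : 0 < ε) {y : ℝ} (hy : 0 ≤ y) : 0 ≤ logSlope ε y := by
  rw [logSlope]; positivity

theorem logProfile_nonneg (hε : 0 < ε) {y : ℝ} (hy : 0 ≤ y) : 0 ≤ logProfile ε y := by
  refine div_nonneg (sub_nonneg.2 (Real.log_le_log (by positivity) ?_)) zero_le_two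
  nlinarith [mul_nonneg hy hε.le, sq_nonneg y]

theorem logProfile_exp_eq (j y : ℝ) : logProfile (Real.exp (-j)) y =
    Real.log ((y + 2 * Real.exp (-j)) ^ 2 + Real.exp (-j) ^ 2) / 2 - Real.log 5 / 2 + j := by
  rw [logProfile, Real.log_mul (by norm_num) (by positivity), Real.log_pow, Real.log_exp]
  push_cast
  ring

/-- The bound which, divided by `j = log (1 / ε)`, dominates the convergence to the indicator. -/
theorem logProfile_exp_le {j y : ℝ} (hj : 0 ≤ j) (hy : 0 ≤ y) :
    logProfile (Real.exp (-j)) y ≤ j + y := by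
  set ε := Real.exp (-j) with hε
  have hε0 : 0 < ε := Real.exp_pos _
  have hε1 : ε ≤ 1 := Real.exp_le_one_iff.2 (by linarith)
  have h1 : Real.log ((y + 2 * ε) ^ 2 + ε ^ 2) ≤ Real.log 5 + 2 * Real.log (y + 1) := by
    have h2 : (2 : ℝ) * Real.log (y + 1) = Real.log ((y + 1) ^ 2) := by
      rw [Real.log_pow]; norm_num
    rw [h2, ← Real.log_mul (by norm_num) (by positivity)]
    refine Real.log_le_log (by positivity) ?_
    nlinarith [mul_nonneg hy hε0.le, mul_nonneg hy (sub_nonneg.2 hε1), sq_nonneg y]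
  have h3 : Real.log (y + 1) ≤ y := by
    linarith [Real.log_le_sub_one_of_pos (by positivity : 0 < y + 1)]
  rw [hε, logProfile_exp_eq, ← hε]
  linarith

theorem tendsto_logProfile_div {y : ℝ} (hy : 0 ≤ y) :
    Tendsto (fun k : ℕ => logProfile (Real.exp (-((k : ℝ) + 1))) y / ((k : ℝ) + 1)) atTop
      (𝓝 ((Set.Ioi (0 : ℝ)).indicator 1 y)) := by
  rcases hy.eq_or_lt with rfl | hy
  · simp [logProfile_zero]
  · rw [Set.indicator_of_mem (Set.mem_Ioi.2 hy), Pi.one_apply]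
    have hk : Tendsto (fun k : ℕ => (k : ℝ) + 1) atTop atTop :=
      tendsto_atTop_add_const_right _ _ tendsto_natCast_atTop_atTop
    have hε : Tendsto (fun k : ℕ => Real.exp (-((k : ℝ) + 1))) atTop (𝓝 0) :=
      Real.tendsto_exp_neg_atTop_nhds_zero.comp hk
    have h1 : Tendsto (fun k : ℕ => Real.log ((y + 2 * Real.exp (-((k : ℝ) + 1))) ^ 2 +
        Real.exp (-((k : ℝ) + 1)) ^ 2) / 2 - Real.log 5 / 2) atTop
        (𝓝 (Real.log ((y + 2 * 0) ^ 2 + 0 ^ 2) / 2 - Real.log 5 / 2)) := by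
      refine Tendsto.sub_const (Tendsto.div_const (Tendsto.log ?_ (by positivity)) _) _
      exact (((hε.const_mul 2).const_add y).pow 2).add (hε.pow 2)
    have h2 := (h1.div_atTop hk).add_const 1
    rw [zero_add] at h2
    refine h2.congr fun k => ?_
    rw [logProfile_exp_eq]
    field_simp

end LogProfile

section WeaklyConstant

variable {n : ℕ} {Ω : Set (EuclideanSpace ℝ (Fin n))}

local notation "𝔼" => EuclideanSpace ℝ (Fin n)

open scoped Convolution in
/-- Mollifiers supported in balls of radius less than `r` shrinking to the origin. -/
theorem exists_mollifier_seq {r : ℝ} (hr : 0 < r) : ∃ f : ℕ → 𝔼 → ℝ, (∀ k, ContDiff ℝ ∞ (f k)) ∧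
    (∀ k, HasCompactSupport (f k)) ∧ (∀ k y, f k y ≠ 0 → ‖y‖ ≤ r / ((k : ℝ) + 2)) ∧
    ∀ w : 𝔼 → ℝ, LocallyIntegrable w → ∀ᵐ x, Tendsto
      (fun k => (f k ⋆[ContinuousLinearMap.lsmul ℝ ℝ, volume] w) x) atTop (𝓝 (w x)) := by
  have hpos : ∀ k : ℕ, 0 < r / ((k : ℝ) + 2) := fun k => by positivity
  let φ : ℕ → ContDiffBump (0 : 𝔼) := fun k =>
    ⟨r / (k + 2) / 2, r / (k + 2), half_pos (hpos k), half_lt_self (hpos k)⟩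
  refine ⟨fun k => (φ k).normed volume, fun k => (φ k).contDiff_normed,
    fun k => (φ k).hasCompactSupport_normed, fun k y hy => ?_, fun w hw => ?_⟩
  · have h1 := subset_tsupport _ (Function.mem_support.2 hy)
    rwa [(φ k).tsupport_normed_eq, mem_closedBall_zero_iff] at h1
  · refine ContDiffBump.ae_convolution_tendsto_right_of_locallyIntegrable (K := 2) ?_
      (Eventually.of_forall fun k => ?_) hw
    · exact tendsto_const_nhds.div_atTop
        (tendsto_atTop_add_const_right _ _ tendsto_natCast_atTop_atTop)
    · change r / ((k : ℝ) + 2) ≤ 2 * (r / (k + 2) / 2)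
      linarith

open scoped Convolution in
/-- Differentiation of a mollification falls on the kernel. -/
theorem hasFDerivAt_convolution_apply {f w : 𝔼 → ℝ} (L : ℝ →L[ℝ] ℝ →L[ℝ] ℝ) (hf : ContDiff ℝ ∞ f)
    (hc : HasCompactSupport f) (hw : LocallyIntegrable w) (x : 𝔼) :
    DifferentiableAt ℝ (f ⋆[L, volume] w) x ∧ ∀ e, fderiv ℝ (f ⋆[L, volume] w) x e =
      ∫ y, L (fderiv ℝ f (x - y) e) (w y) := by
  have hd := hc.hasFDerivAt_convolution_left L (hf.of_le (by simp)) hw x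
  refine ⟨hd.differentiableAt, fun e => ?_⟩
  have hex : Integrable (fun t => (L.precompL 𝔼 (fderiv ℝ f t)) (w (x - t))) :=
    (hc.fderiv (𝕜 := ℝ)).convolutionExists_left (L.precompL 𝔼)
      (hf.continuous_fderiv (by simp)) hw x
  rw [hd.fderiv, convolution_def, ContinuousLinearMap.integral_apply hex,
    ← integral_sub_left_eq_self _ volume x]
  refine integral_congr_ae (ae_of_all _ fun y => ?_)
  simp only [ContinuousLinearMap.precompL_apply, sub_sub_cancel]

open scoped Convolution in
/-- On a ball well inside `Ω` the mollifications have vanishing gradient, hence are constant. -/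
theorem exists_ae_eq_const_on_ball {w : 𝔼 → ℝ} (hw : LocallyIntegrable w) {x₀ : 𝔼} {r : ℝ}
    (hr : 0 < r) (hball : Metric.ball x₀ (2 * r) ⊆ Ω)
    (hzero : ∀ φ, IsTestFunction Ω φ → ∀ e, ∫ x, w x * fderiv ℝ φ x e = 0) :
    ∃ c, ∀ᵐ x, x ∈ Metric.ball x₀ r → w x = c := by
  have hlt : ∀ k : ℕ, r / ((k : ℝ) + 2) < r := fun k =>
    div_lt_self hr (by linarith [k.cast_nonneg (α := ℝ)])
  obtain ⟨f, hfs, hfc, hfsupp, hflim⟩ := exists_mollifier_seq (n := n) hr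
  have hlim := hflim w hw
  have hconst : ∀ k, ∃ c, ∀ x ∈ Metric.ball x₀ r,
      (f k ⋆[ContinuousLinearMap.lsmul ℝ ℝ, volume] w) x = c := by
    intro k
    have hd := hasFDerivAt_convolution_apply (ContinuousLinearMap.lsmul ℝ ℝ) (hfs k) (hfc k) hw
    refine Metric.isOpen_ball.exists_is_const_of_fderiv_eq_zero
      (convex_ball x₀ r).isPreconnected (fun x _ => (hd x).1.differentiableWithinAt)
      fun x hx => ?_
    rw [Pi.zero_apply]
    ext e
    rw [(hd x).2 e, _root_.zero_apply]
    -- `y ↦ f (x - y)` is a test function on `Ω`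
    have htest : IsTestFunction Ω (fun y => f k (x - y)) := by
      have hsupp : Function.support (fun y => f k (x - y)) ⊆
          Metric.closedBall x (r / ((k : ℝ) + 2)) := by
        intro y hy
        rw [Metric.mem_closedBall, dist_eq_norm, norm_sub_rev]
        exact hfsupp k _ hy
      refine ⟨(hfs k).comp (contDiff_const.sub contDiff_id),
        HasCompactSupport.of_support_subset_isCompact (isCompact_closedBall _ _) hsupp,
        (closure_minimal hsupp Metric.isClosed_closedBall).trans fun y hy => hball ?_⟩
      have h2 := dist_triangle y x x₀
      rw [Metric.mem_closedBall] at hy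
      rw [Metric.mem_ball] at hx ⊢
      linarith [hlt k]
    have h3 := hzero _ htest e
    have hderiv : ∀ y, fderiv ℝ (fun y => f k (x - y)) y e = -(fderiv ℝ (f k) (x - y) e) := by
      intro y
      have h4 : HasFDerivAt (fun y => f k (x - y))
          ((fderiv ℝ (f k) (x - y)).comp (-ContinuousLinearMap.id ℝ 𝔼)) y :=
        (((hfs k).differentiable (by simp)) (x - y)).hasFDerivAt.comp y
          ((hasFDerivAt_id y).const_sub x)
      rw [h4.fderiv]
      simp
    simp_rw [hderiv, mul_neg] at h3
    rw [integral_neg, neg_eq_zero] at h3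
    rw [← h3]
    refine integral_congr_ae (ae_of_all _ fun y => ?_)
    simp [mul_comm]
  choose c hc using hconst
  by_cases hne : ∀ᵐ x, x ∉ Metric.ball x₀ r
  · exact ⟨0, hne.mono fun x hx h => absurd h hx⟩
  · obtain ⟨x₁, hx₁, hx₁l⟩ := ((not_eventually.1 hne).and_eventually hlim).exists
    refine ⟨w x₁, hlim.mono fun x hx hxb => tendsto_nhds_unique hx ?_⟩
    refine hx₁l.congr fun k => ?_
    rw [hc k x hxb, hc k x₁ (not_not.1 hx₁)]

/-- A locally integrable function whose weak gradient vanishes on a connected open set is almost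
everywhere constant there. -/
theorem exists_ae_eq_const_of_integral_mul_fderiv_eq_zero (hΩ : IsOpen Ω) (hconn : IsPreconnected Ω)
    {w : 𝔼 → ℝ} (hw : LocallyIntegrable w)
    (hzero : ∀ φ, IsTestFunction Ω φ → ∀ e, ∫ x, w x * fderiv ℝ φ x e = 0) :
    ∃ c, ∀ᵐ x, x ∈ Ω → w x = c := by
  have hloc : ∀ x ∈ Ω, ∃ c, ∃ r > 0, ∀ᵐ y, y ∈ Metric.ball x r → w y = c := by
    intro x hx
    obtain ⟨r, hr, hball⟩ := Metric.isOpen_iff.1 hΩ x hx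
    obtain ⟨c, hc⟩ := exists_ae_eq_const_on_ball hw (half_pos hr)
      (by rwa [mul_div_cancel₀ r two_ne_zero]) hzero
    exact ⟨c, r / 2, half_pos hr, hc⟩
  rcases Ω.eq_empty_or_nonempty with rfl | ⟨x₁, hx₁⟩
  · exact ⟨0, by simp⟩
  obtain ⟨c, r₁, hr₁, hc⟩ := hloc x₁ hx₁
  -- the sets of points near which `w` is almost everywhere equal to `a` are open and pairwise
  -- disjoint
  set S : ℝ → Set 𝔼 := fun a => {x | ∃ r > 0, ∀ᵐ y, y ∈ Metric.ball x r → w y = a} with hS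
  have hSopen : ∀ a, IsOpen (S a) := by
    intro a
    refine Metric.isOpen_iff.2 fun x ⟨r, hr, hx⟩ => ⟨r, hr, fun y hy => ?_⟩
    refine ⟨r - dist y x, sub_pos.2 hy, hx.mono fun z hz hzy => hz ?_⟩
    rw [Metric.mem_ball] at *
    linarith [dist_triangle z y x]
  have hdisj : ∀ a b x, x ∈ S a → x ∈ S b → a = b := by
    rintro a b x ⟨r, hr, ha⟩ ⟨r', hr', hb⟩
    have hpos := Metric.measure_ball_pos (volume : Measure 𝔼) x (lt_min hr hr')
    obtain ⟨y, hy, h1, h2⟩ := ((frequently_ae_mem_iff.2 hpos.ne').and_eventually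
      (ha.and hb)).exists
    rw [← h1 (Metric.ball_subset_ball (min_le_left _ _) hy),
      h2 (Metric.ball_subset_ball (min_le_right _ _) hy)]
  have hsub : Ω ⊆ S c := by
    have h := IsPreconnected.subset_or_subset (hSopen c)
      (isOpen_iUnion fun a : {a // a ≠ c} => hSopen a)
      (Set.disjoint_left.2 fun x h1 h2 => by
        obtain ⟨a, ha⟩ := Set.mem_iUnion.1 h2
        exact a.2 (hdisj _ _ x ha h1))
      (fun x hx => by
        obtain ⟨a, ha⟩ := hloc x hx
        by_cases hac : a = c
        · exact Or.inl (hac ▸ ha)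
        · exact Or.inr (Set.mem_iUnion.2 ⟨⟨a, hac⟩, ha⟩)) hconn
    rcases h with h | h
    · exact h
    · obtain ⟨a, ha⟩ := Set.mem_iUnion.1 (h hx₁)
      exact absurd (hdisj _ _ x₁ ha ⟨r₁, hr₁, hc⟩) a.2
  refine ⟨c, ?_⟩
  have hnull : volume {x | x ∈ Ω ∧ w x ≠ c} = 0 := by
    refine measure_null_of_locally_null _ fun x hx => ?_
    obtain ⟨r, hr, h⟩ := hsub hx.1
    refine ⟨{x | x ∈ Ω ∧ w x ≠ c} ∩ Metric.ball x r,
      inter_mem_nhdsWithin _ (Metric.ball_mem_nhds _ hr), measure_mono_null ?_ (ae_iff.1 h)⟩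
    rintro y ⟨⟨-, h1⟩, h2⟩ h3
    exact h1 (h3 h2)
  rw [ae_iff]
  refine measure_mono_null (fun x hx => ?_) hnull
  have hx' : ¬(x ∈ Ω → w x = c) := hx
  exact Classical.not_imp.1 hx'

end WeaklyConstant

/-! ### The strong maximum principle -/

section StrictPositivity

variable {n : ℕ} {Ω : Set (EuclideanSpace ℝ (Fin n))} {s : ℝ}

local notation "𝔼" => EuclideanSpace ℝ (Fin n)

theorem ae_nonneg_of_abs_eq {f : L2 Ω ℝ} (hf : |f| = f) : ∀ᵐ x ∂(volume.restrict Ω), 0 ≤ f x := by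
  have h := Lp.coeFn_abs f
  rw [hf] at h
  filter_upwards [h] with x hx
  rw [hx]
  exact abs_nonneg _

/-- The resolvent solves `f - v = -s Δ v` weakly, and is a limit of test functions, both in
`H¹(Ω)` and almost everywhere. -/
theorem exists_gradient_resolvent (hs : 0 < s) (f : L2 Ω ℝ) :
    ∃ (G : L2 Ω 𝔼) (ψ : ℕ → 𝔼 → ℝ) (h : ∀ k, IsTestFunction Ω (ψ k)),
      Tendsto (fun k => (h k).memLp.toLp (ψ k)) atTop (𝓝 (resolvent₀ Ω s f)) ∧
      Tendsto (fun k => (h k).memLp_gradient.toLp (gradient (ψ k))) atTop (𝓝 G) ∧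
      (∀ᵐ x ∂(volume.restrict Ω),
        Tendsto (fun k => ψ k x) atTop (𝓝 (resolvent₀ Ω s f x))) ∧
      ∀ (φ : 𝔼 → ℝ) (hφ : IsTestFunction Ω φ), inner ℝ (f - resolvent₀ Ω s f) (hφ.memLp.toLp φ) =
        s * inner ℝ G (hφ.memLp_gradient.toLp (gradient φ)) := by
  have hs' : Real.sqrt s ≠ 0 := (Real.sqrt_pos.2 hs).ne'
  obtain ⟨ψ, h, hψ⟩ := exists_seq_of_mem_formDomain (resolventPair_mem (s := s) f)
  have h1 := tendsto_fst_of_toPair hψ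
  have h2 := (tendsto_snd_of_toPair hψ).const_smul (Real.sqrt s)⁻¹
  simp only [inv_smul_smul₀ hs'] at h2
  rw [resolventPair_fst] at h1
  obtain ⟨ns, hns, hae⟩ := (tendstoInMeasure_of_tendsto_Lp h1).exists_seq_tendsto_ae
  refine ⟨(Real.sqrt s)⁻¹ • (resolventPair Ω s f).snd, fun k => ψ (ns k), fun k => h (ns k),
    h1.comp hns.tendsto_atTop, h2.comp hns.tendsto_atTop, ?_, fun φ hφ => ?_⟩
  · have hall := ae_all_iff.2 fun k => (h (ns k)).memLp.coeFn_toLp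
    filter_upwards [hae, hall] with x h3 h4
    simpa only [h4] using h3
  · rw [inner_sub_resolvent f hφ, real_inner_smul_left, ← mul_assoc]
    congr 1
    rw [eq_mul_inv_iff_mul_eq₀ hs', Real.mul_self_sqrt hs.le]

theorem integrable_mul_inner {α F : Type*} [MeasurableSpace α] {μ : Measure α}
    [NormedAddCommGroup F] [InnerProductSpace ℝ F] (G H : Lp F 2 μ) {b : α → ℝ} {M : ℝ}
    (hb : AEStronglyMeasurable b μ) (hM : ∀ x, |b x| ≤ M) :
    Integrable (fun x => b x * inner ℝ (G x) (H x)) μ := by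
  have hi := L2.integrable_inner (𝕜 := ℝ) G H
  refine (hi.norm.const_mul M).mono' (hb.mul hi.aestronglyMeasurable) (ae_of_all _ fun x => ?_)
  rw [norm_mul]
  gcongr
  exact hM x

theorem IsTestFunction.exists_abs_le {χ : 𝔼 → ℝ} (hχ : IsTestFunction Ω χ) :
    ∃ M, 0 ≤ M ∧ ∀ x, |χ x| ≤ M := by
  obtain ⟨M, hM⟩ := hχ.contDiff.continuous.bounded_above_of_compact_support hχ.hasCompactSupport
  exact ⟨M, (norm_nonneg _).trans (hM 0), hM⟩

variable {f v : L2 Ω ℝ} {G : L2 Ω (EuclideanSpace ℝ (Fin n))}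
  {ψ : ℕ → EuclideanSpace ℝ (Fin n) → ℝ} (h : ∀ k, IsTestFunction Ω (ψ k)) {ε : ℝ}

theorem IsTestFunction.logSlope_mul_sq {ψ χ : 𝔼 → ℝ} (hψ : IsTestFunction Ω ψ)
    (hχ : IsTestFunction Ω χ) (hε : 0 < ε) :
    IsTestFunction Ω (fun x => logSlope ε (ψ x) * χ x ^ 2) := by
  have h2 := hχ.comp_real (F := fun y => y ^ 2) (contDiff_id.pow 2) (by norm_num)
  exact ⟨((contDiff_logSlope hε).comp hψ.contDiff).mul h2.contDiff, h2.hasCompactSupport.mul_left,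
    (tsupport_mul_subset_right (f := fun x => logSlope ε (ψ x))).trans h2.tsupport_subset⟩

theorem gradient_logSlope_mul_sq {ψ χ : 𝔼 → ℝ} (hψ : IsTestFunction Ω ψ)
    (hχ : IsTestFunction Ω χ) (hε : 0 < ε) (x : 𝔼) :
    gradient (fun x => logSlope ε (ψ x) * χ x ^ 2) x =
      (logCurvature ε (ψ x) * χ x ^ 2) • gradient ψ x +
        (2 * χ x * logSlope ε (ψ x)) • gradient χ x := by
  have h1 : HasFDerivAt (fun x => logSlope ε (ψ x)) (logCurvature ε (ψ x) • fderiv ℝ ψ x) x :=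
    (hasDerivAt_logSlope hε _).comp_hasFDerivAt x
      (hψ.contDiff.differentiable (by simp) x).hasFDerivAt
  have h2 : HasFDerivAt (fun x => χ x ^ 2) ((2 * χ x) • fderiv ℝ χ x) x := by
    have h0 : HasFDerivAt (fun x => χ x ^ 2) (((2 : ℕ) * χ x ^ (2 - 1)) • fderiv ℝ χ x) x :=
      (hasDerivAt_pow 2 (χ x)).comp_hasFDerivAt x
        (hχ.contDiff.differentiable (by simp) x).hasFDerivAt
    simpa using h0
  have h3 := (h1.mul h2).fderiv
  simp only [gradient]
  rw [show (fun x => logSlope ε (ψ x) * χ x ^ 2) =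
    (fun x => logSlope ε (ψ x)) * (fun x => χ x ^ 2) from rfl, h3, map_add, map_smul, map_smul,
    map_smul, map_smul, smul_smul, smul_smul, add_comm]
  congr 2 <;> ring

/-- The weak equation tested against `χ² / v`, suitably regularised. -/
theorem integral_logSlope_mul_inner (hG : Tendsto
      (fun k => (h k).memLp_gradient.toLp (gradient (ψ k))) atTop (𝓝 G))
    (hae : ∀ᵐ x ∂(volume.restrict Ω), Tendsto (fun k => ψ k x) atTop (𝓝 (v x)))
    (heq : ∀ (φ : 𝔼 → ℝ) (hφ : IsTestFunction Ω φ), inner ℝ (f - v) (hφ.memLp.toLp φ) =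
      s * inner ℝ G (hφ.memLp_gradient.toLp (gradient φ)))
    (hε : 0 < ε) {χ : 𝔼 → ℝ} (hχ : IsTestFunction Ω χ) :
    ∫ x in Ω, logSlope ε (v x) * χ x * inner ℝ ((f - v) x) (hχ.memLp.toLp χ x) =
      s * ((∫ x in Ω, logCurvature ε (v x) * χ x ^ 2 * inner ℝ (G x) (G x)) +
        ∫ x in Ω, 2 * χ x * logSlope ε (v x) *
          inner ℝ (G x) (hχ.memLp_gradient.toLp (gradient χ) x)) := by
  obtain ⟨M, hM0, hM⟩ := hχ.exists_abs_le
  have hχc := hχ.contDiff.continuous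
  have hsc := (contDiff_logSlope hε).continuous
  have hcc := continuous_logCurvature hε
  have hψc : ∀ k, Continuous (ψ k) := fun k => (h k).contDiff.continuous
  have hb1 : ∀ k, AEStronglyMeasurable (fun x => logSlope ε (ψ k x) * χ x) (volume.restrict Ω) :=
    fun k => ((hsc.comp (hψc k)).mul hχc).aestronglyMeasurable
  have hb2 : ∀ k, AEStronglyMeasurable (fun x => logCurvature ε (ψ k x) * χ x ^ 2)
      (volume.restrict Ω) := fun k => ((hcc.comp (hψc k)).mul (hχc.pow 2)).aestronglyMeasurable
  have hb3 : ∀ k, AEStronglyMeasurable (fun x => 2 * χ x * logSlope ε (ψ k x))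
      (volume.restrict Ω) := fun k =>
    ((continuous_const.mul hχc).mul (hsc.comp (hψc k))).aestronglyMeasurable
  have hM1 : ∀ k x, |logSlope ε (ψ k x) * χ x| ≤ 1 / ε * M := fun k x => by
    rw [abs_mul]
    exact mul_le_mul (abs_logSlope_le hε _) (hM x) (abs_nonneg _) (by positivity)
  have hM2 : ∀ k x, |logCurvature ε (ψ k x) * χ x ^ 2| ≤ 1 / ε ^ 2 * M ^ 2 := fun k x => by
    rw [abs_mul, abs_pow]
    exact mul_le_mul (abs_logCurvature_le hε _) (pow_le_pow_left₀ (abs_nonneg _) (hM x) 2)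
      (by positivity) (by positivity)
  have hM3 : ∀ k x, |2 * χ x * logSlope ε (ψ k x)| ≤ 2 * (1 / ε * M) := fun k x => by
    rw [mul_assoc, abs_mul, abs_two, mul_comm (χ x)]
    exact mul_le_mul_of_nonneg_left (hM1 k x) zero_le_two
  have l1 : Tendsto (fun k => ∫ x in Ω, logSlope ε (ψ k x) * χ x *
      inner ℝ ((f - v) x) (hχ.memLp.toLp χ x)) atTop
      (𝓝 (∫ x in Ω, logSlope ε (v x) * χ x * inner ℝ ((f - v) x) (hχ.memLp.toLp χ x))) :=
    tendsto_integral_mul_inner (f - v) tendsto_const_nhds hb1 hM1 (hae.mono fun x hx =>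
      ((hsc.tendsto _).comp hx).mul_const _)
  have l2 : Tendsto (fun k => ∫ x in Ω, logCurvature ε (ψ k x) * χ x ^ 2 *
      inner ℝ (G x) ((h k).memLp_gradient.toLp (gradient (ψ k)) x)) atTop
      (𝓝 (∫ x in Ω, logCurvature ε (v x) * χ x ^ 2 * inner ℝ (G x) (G x))) :=
    tendsto_integral_mul_inner G hG hb2 hM2 (hae.mono fun x hx =>
      ((hcc.tendsto _).comp hx).mul_const _)
  have l3 : Tendsto (fun k => ∫ x in Ω, 2 * χ x * logSlope ε (ψ k x) *
      inner ℝ (G x) (hχ.memLp_gradient.toLp (gradient χ) x)) atTop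
      (𝓝 (∫ x in Ω, 2 * χ x * logSlope ε (v x) *
        inner ℝ (G x) (hχ.memLp_gradient.toLp (gradient χ) x))) :=
    tendsto_integral_mul_inner G tendsto_const_nhds hb3 hM3 (hae.mono fun x hx =>
      ((hsc.tendsto _).comp hx).const_mul _)
  refine tendsto_nhds_unique l1 (((l2.add l3).const_mul s).congr fun k => ?_)
  have htest := (h k).logSlope_mul_sq hχ hε
  have e := heq _ htest
  rw [inner_toLp_eq, inner_toLp_eq] at e
  have e1 : ∫ x in Ω, inner ℝ ((f - v) x) (logSlope ε (ψ k x) * χ x ^ 2) =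
      ∫ x in Ω, logSlope ε (ψ k x) * χ x * inner ℝ ((f - v) x) (hχ.memLp.toLp χ x) := by
    refine integral_congr_ae ?_
    filter_upwards [hχ.memLp.coeFn_toLp] with x hx
    rw [hx]
    simp only [RCLike.inner_apply, conj_trivial]
    ring
  have e2 : ∫ x in Ω, inner ℝ (G x) (gradient (fun x => logSlope ε (ψ k x) * χ x ^ 2) x) =
      ∫ x in Ω, (logCurvature ε (ψ k x) * χ x ^ 2 *
        inner ℝ (G x) ((h k).memLp_gradient.toLp (gradient (ψ k)) x) +
        2 * χ x * logSlope ε (ψ k x) *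
          inner ℝ (G x) (hχ.memLp_gradient.toLp (gradient χ) x)) := by
    refine integral_congr_ae ?_
    filter_upwards [(h k).memLp_gradient.coeFn_toLp, hχ.memLp_gradient.coeFn_toLp] with x h1 h2
    rw [h1, h2, gradient_logSlope_mul_sq (h k) hχ hε, inner_add_right, real_inner_smul_right,
      real_inner_smul_right]
  rw [e1, e2, integral_add (integrable_mul_inner _ _ (hb2 k) (hM2 k))
    (integrable_mul_inner _ _ (hb3 k) (hM3 k))] at e
  exact e.symm

/-- A Caccioppoli inequality: the logarithm of a nonnegative supersolution has locally bounded
energy. -/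
theorem integral_sq_logSlope_le (hs : 0 < s) (hG : Tendsto
      (fun k => (h k).memLp_gradient.toLp (gradient (ψ k))) atTop (𝓝 G))
    (hae : ∀ᵐ x ∂(volume.restrict Ω), Tendsto (fun k => ψ k x) atTop (𝓝 (v x)))
    (heq : ∀ (φ : 𝔼 → ℝ) (hφ : IsTestFunction Ω φ), inner ℝ (f - v) (hφ.memLp.toLp φ) =
      s * inner ℝ G (hφ.memLp_gradient.toLp (gradient φ)))
    (hf0 : ∀ᵐ x ∂(volume.restrict Ω), 0 ≤ f x) (hv0 : ∀ᵐ x ∂(volume.restrict Ω), 0 ≤ v x)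
    (hε : 0 < ε) {χ : 𝔼 → ℝ} (hχ : IsTestFunction Ω χ) :
    Integrable (fun x => (χ x * logSlope ε (v x)) ^ 2 * ‖G x‖ ^ 2) (volume.restrict Ω) ∧
    ∫ x in Ω, (χ x * logSlope ε (v x)) ^ 2 * ‖G x‖ ^ 2 ≤
      4 / s * (∫ x in Ω, χ x ^ 2) + 16 * ∫ x in Ω, ‖gradient χ x‖ ^ 2 := by
  obtain ⟨M, hM0, hM⟩ := hχ.exists_abs_le
  have hχm : AEStronglyMeasurable χ (volume.restrict Ω) :=
    hχ.contDiff.continuous.aestronglyMeasurable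
  have hsm : AEStronglyMeasurable (fun x => logSlope ε (v x)) (volume.restrict Ω) :=
    (contDiff_logSlope hε).continuous.comp_aestronglyMeasurable (Lp.aestronglyMeasurable v)
  have hcm : AEStronglyMeasurable (fun x => logCurvature ε (v x)) (volume.restrict Ω) :=
    (continuous_logCurvature hε).comp_aestronglyMeasurable (Lp.aestronglyMeasurable v)
  have hM1 : ∀ x, |logSlope ε (v x) * χ x| ≤ 1 / ε * M := fun x => by
    rw [abs_mul]
    exact mul_le_mul (abs_logSlope_le hε _) (hM x) (abs_nonneg _) (by positivity)
  have hi1 : Integrable (fun x => logSlope ε (v x) * χ x *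
      inner ℝ ((f - v) x) (hχ.memLp.toLp χ x)) (volume.restrict Ω) :=
    integrable_mul_inner (f - v) (hχ.memLp.toLp χ) (hsm.mul hχm) hM1
  have hi2 : Integrable (fun x => logCurvature ε (v x) * χ x ^ 2 * inner ℝ (G x) (G x))
      (volume.restrict Ω) :=
    integrable_mul_inner G G (hcm.mul (hχm.pow 2)) (M := 1 / ε ^ 2 * M ^ 2) fun x => by
      rw [abs_mul, abs_pow]
      exact mul_le_mul (abs_logCurvature_le hε _) (pow_le_pow_left₀ (abs_nonneg _) (hM x) 2)
        (by positivity) (by positivity)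
  have hi3 : Integrable (fun x => 2 * χ x * logSlope ε (v x) *
      inner ℝ (G x) (hχ.memLp_gradient.toLp (gradient χ) x)) (volume.restrict Ω) :=
    integrable_mul_inner G _ ((hχm.const_mul 2).mul hsm) (M := 2 * (1 / ε * M)) fun x => by
      rw [mul_assoc, abs_mul, abs_two, mul_comm (χ x)]
      exact mul_le_mul_of_nonneg_left (hM1 x) zero_le_two
  have hi4 : Integrable (fun x => (χ x * logSlope ε (v x)) ^ 2 * ‖G x‖ ^ 2)
      (volume.restrict Ω) := by
    simp_rw [← real_inner_self_eq_norm_sq]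
    refine integrable_mul_inner G G ((hχm.mul hsm).pow 2) (M := (1 / ε * M) ^ 2) fun x => ?_
    rw [abs_pow, mul_comm (χ x)]
    exact pow_le_pow_left₀ (abs_nonneg _) (hM1 x) 2
  have hi5 : Integrable (fun x => χ x ^ 2) (volume.restrict Ω) := hχ.memLp.integrable_sq
  have hi6 : Integrable (fun x => ‖gradient χ x‖ ^ 2) (volume.restrict Ω) :=
    hχ.memLp_gradient.norm.integrable_sq
  refine ⟨hi4, ?_⟩
  have hid := integral_logSlope_mul_inner h hG hae heq hε hχ
  have hlow : -(∫ x in Ω, χ x ^ 2) ≤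
      ∫ x in Ω, logSlope ε (v x) * χ x * inner ℝ ((f - v) x) (hχ.memLp.toLp χ x) := by
    rw [← integral_neg]
    refine integral_mono_ae hi5.neg hi1 ?_
    filter_upwards [hf0, hv0, hχ.memLp.coeFn_toLp, Lp.coeFn_sub f v] with x h1 h2 h3 h4
    rw [h3, h4]
    simp only [RCLike.inner_apply, conj_trivial, Pi.sub_apply]
    have h5 := mul_logSlope_le hε h2
    have h6 := logSlope_nonneg hε h2
    nlinarith [mul_nonneg (mul_nonneg h6 h1) (sq_nonneg (χ x)),
      mul_le_mul_of_nonneg_right h5 (sq_nonneg (χ x))]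
  -- the good term comes from concavity; Young's inequality absorbs half of it
  have hup : (∫ x in Ω, logCurvature ε (v x) * χ x ^ 2 * inner ℝ (G x) (G x)) +
      ∫ x in Ω, 2 * χ x * logSlope ε (v x) *
        inner ℝ (G x) (hχ.memLp_gradient.toLp (gradient χ) x) ≤
      -(1 / 4) * (∫ x in Ω, (χ x * logSlope ε (v x)) ^ 2 * ‖G x‖ ^ 2) +
        4 * ∫ x in Ω, ‖gradient χ x‖ ^ 2 := by
    rw [← integral_add hi2 hi3, ← integral_const_mul, ← integral_const_mul,
      ← integral_add (hi4.const_mul _) (hi6.const_mul _)]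
    refine integral_mono_ae (hi2.add hi3) ((hi4.const_mul _).add (hi6.const_mul _)) ?_
    filter_upwards [hv0, hχ.memLp_gradient.coeFn_toLp] with x h1 h2
    rw [h2, real_inner_self_eq_norm_sq]
    have h3 : logCurvature ε (v x) * (χ x ^ 2 * ‖G x‖ ^ 2) ≤
        -(1 / 2) * logSlope ε (v x) ^ 2 * (χ x ^ 2 * ‖G x‖ ^ 2) :=
      mul_le_mul_of_nonneg_right (logCurvature_le hε h1) (by positivity)
    have h4 : χ x * logSlope ε (v x) * inner ℝ (G x) (gradient χ x) ≤
        |χ x * logSlope ε (v x)| * (‖G x‖ * ‖gradient χ x‖) := by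
      refine (le_abs_self _).trans ?_
      rw [abs_mul]
      gcongr
      exact abs_real_inner_le_norm _ _
    nlinarith [sq_nonneg (|χ x * logSlope ε (v x)| * ‖G x‖ - 4 * ‖gradient χ x‖),
      sq_abs (χ x * logSlope ε (v x))]
  rw [hid] at hlow
  have h1 := mul_le_mul_of_nonneg_left hup hs.le
  have h2 : s / 4 * (∫ x in Ω, (χ x * logSlope ε (v x)) ^ 2 * ‖G x‖ ^ 2) ≤
      s / 4 * (4 / s * (∫ x in Ω, χ x ^ 2) + 16 * ∫ x in Ω, ‖gradient χ x‖ ^ 2) := by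
    rw [mul_add, ← mul_assoc, show s / 4 * (4 / s) = 1 by field_simp]
    linarith
  exact le_of_mul_le_mul_left h2 (by positivity)

/-- The chain rule: `logSlope ε v • G` is the weak gradient of `logProfile ε v`. -/
theorem integral_logProfile_mul_fderiv (hb : Bornology.IsBounded Ω)
    (hv : Tendsto (fun k => (h k).memLp.toLp (ψ k)) atTop (𝓝 v)) (hG : Tendsto
      (fun k => (h k).memLp_gradient.toLp (gradient (ψ k))) atTop (𝓝 G))
    (hae : ∀ᵐ x ∂(volume.restrict Ω), Tendsto (fun k => ψ k x) atTop (𝓝 (v x)))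
    (hε : 0 < ε) {φ : 𝔼 → ℝ} (hφ : IsTestFunction Ω φ) (e : 𝔼) :
    ∫ x in Ω, logProfile ε (v x) * fderiv ℝ φ x e =
      -∫ x in Ω, logSlope ε (v x) * φ x * inner ℝ e (G x) := by
  have : IsFiniteMeasure (volume.restrict Ω) := ⟨by
    rw [Measure.restrict_apply_univ]; exact hb.measure_lt_top⟩
  obtain ⟨M, hM0, hM⟩ := hφ.exists_abs_le
  have hφc := hφ.contDiff.continuous
  have hsc := (contDiff_logSlope hε).continuous
  have hdc : Continuous (fun x => fderiv ℝ φ x e) :=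
    (hφ.contDiff.continuous_fderiv (by simp)).clm_apply continuous_const
  have hdsupp : HasCompactSupport (fun x => fderiv ℝ φ x e) :=
    (hφ.hasCompactSupport.fderiv (𝕜 := ℝ)).comp_left (g := fun A : 𝔼 →L[ℝ] ℝ => A e) (by simp)
  have hd0 : ∀ x, x ∉ Ω → fderiv ℝ φ x e = 0 := fun x hx => by
    rw [fderiv_eq_inner_gradient, hφ.gradient_eq_zero_of_notMem hx, inner_zero_left]
  have hdL : MemLp (fun x => fderiv ℝ φ x e) 2 (volume.restrict Ω) :=
    hdc.memLp_of_hasCompactSupport hdsupp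
  have hlip : LipschitzWith (Real.toNNReal (1 / ε)) (logProfile ε) := by
    refine lipschitzWith_of_nnnorm_deriv_le
      (fun y => (hasDerivAt_logProfile hε y).differentiableAt) fun y => ?_
    rw [(hasDerivAt_logProfile hε y).deriv, ← NNReal.coe_le_coe, coe_nnnorm,
      Real.coe_toNNReal _ (by positivity)]
    exact abs_logSlope_le hε y
  have l1 : Tendsto (fun k => ∫ x in Ω, logProfile ε (ψ k x) * fderiv ℝ φ x e) atTop
      (𝓝 (∫ x in Ω, logProfile ε (v x) * fderiv ℝ φ x e)) := by
    have h1 := (((hlip.continuous_compLp (logProfile_zero ε)).tendsto v).comp hv).inner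
      (tendsto_const_nhds (x := hdL.toLp _)) (𝕜 := ℝ)
    simp only [inner_toLp_eq] at h1
    have e1 : ∫ x in Ω, inner ℝ (hlip.compLp (logProfile_zero ε) v x) (fderiv ℝ φ x e) =
        ∫ x in Ω, logProfile ε (v x) * fderiv ℝ φ x e := by
      refine integral_congr_ae ?_
      filter_upwards [hlip.coeFn_compLp (logProfile_zero ε) v] with x hx
      rw [hx]
      simp [mul_comm]
    rw [e1] at h1
    refine h1.congr fun k => integral_congr_ae ?_
    filter_upwards [hlip.coeFn_compLp (logProfile_zero ε) ((h k).memLp.toLp (ψ k)),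
      (h k).memLp.coeFn_toLp] with x h2 h3
    simp only [Function.comp_apply] at h2 ⊢
    rw [h2, h3]
    simp [mul_comm]
  have l2 : Tendsto (fun k => ∫ x in Ω, logSlope ε (ψ k x) * φ x *
      inner ℝ (Lp.const 2 (volume.restrict Ω) e x)
        ((h k).memLp_gradient.toLp (gradient (ψ k)) x)) atTop
      (𝓝 (∫ x in Ω, logSlope ε (v x) * φ x *
        inner ℝ (Lp.const 2 (volume.restrict Ω) e x) (G x))) :=
    tendsto_integral_mul_inner _ hG (M := 1 / ε * M)
      (fun k => ((hsc.comp (h k).contDiff.continuous).mul hφc).aestronglyMeasurable)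
      (fun k x => by
        rw [abs_mul]
        exact mul_le_mul (abs_logSlope_le hε _) (hM x) (abs_nonneg _) (by positivity))
      (hae.mono fun x hx => ((hsc.tendsto _).comp hx).mul_const _)
  have e2 : ∫ x in Ω, logSlope ε (v x) * φ x *
      inner ℝ (Lp.const 2 (volume.restrict Ω) e x) (G x) =
      ∫ x in Ω, logSlope ε (v x) * φ x * inner ℝ e (G x) := by
    refine integral_congr_ae ?_
    filter_upwards [Lp.coeFn_const 2 (volume.restrict Ω) e] with x hx
    rw [hx, Function.const_apply]
  rw [e2] at l2
  refine tendsto_nhds_unique l1 (l2.neg.congr fun k => ?_)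
  -- integration by parts for the approximating test functions
  have hA := (h k).comp_real (contDiff_logProfile hε) (logProfile_zero ε)
  have hAd : ∀ x, fderiv ℝ (fun x => logProfile ε (ψ k x)) x e =
      logSlope ε (ψ k x) * inner ℝ (gradient (ψ k) x) e := fun x => by
    rw [fderiv_eq_inner_gradient, gradient_comp_real (hasDerivAt_logProfile hε _)
      ((h k).contDiff.differentiable (by simp) x), real_inner_smul_left]
  have hAdc : Continuous (fun x => fderiv ℝ (fun x => logProfile ε (ψ k x)) x e) :=
    (hA.contDiff.continuous_fderiv (by simp)).clm_apply continuous_const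
  have hparts := integral_mul_fderiv_eq_neg_fderiv_mul_of_integrable (μ := volume) (v := e)
    (f := fun x => logProfile ε (ψ k x)) (g := φ)
    ((hAdc.mul hφc).integrable_of_hasCompactSupport hφ.hasCompactSupport.mul_left)
    ((hA.contDiff.continuous.mul hdc).integrable_of_hasCompactSupport hdsupp.mul_left)
    ((hA.contDiff.continuous.mul hφc).integrable_of_hasCompactSupport
      hφ.hasCompactSupport.mul_left)
    (fun x _ => hA.contDiff.differentiable (by simp) x)
    (fun x _ => hφ.contDiff.differentiable (by simp) x)
  have r1 : ∫ x in Ω, logProfile ε (ψ k x) * fderiv ℝ φ x e =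
      ∫ x, logProfile ε (ψ k x) * fderiv ℝ φ x e :=
    setIntegral_eq_integral_of_forall_compl_eq_zero fun x hx => by rw [hd0 x hx, mul_zero]
  have r2 : ∫ x in Ω, fderiv ℝ (fun x => logProfile ε (ψ k x)) x e * φ x =
      ∫ x, fderiv ℝ (fun x => logProfile ε (ψ k x)) x e * φ x :=
    setIntegral_eq_integral_of_forall_compl_eq_zero fun x hx => by
      rw [hφ.eq_zero_of_notMem hx, mul_zero]
  rw [r1, hparts, ← r2]
  congr 1
  refine integral_congr_ae ?_
  filter_upwards [Lp.coeFn_const 2 (volume.restrict Ω) e,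
    (h k).memLp_gradient.coeFn_toLp] with x h1 h2
  rw [h1, h2, Function.const_apply, hAd, real_inner_comm]
  ring

/-- The indicator function of `{v > 0}` has vanishing weak gradient. The functions `logProfile ε v`
have gradients bounded independently of `ε`, and are divided by `log (1 / ε)` with `ε = exp (-(k +
1))`. -/
theorem integral_indicator_pos_mul_fderiv (hb : Bornology.IsBounded Ω) (hs : 0 < s)
    (hv : Tendsto (fun k => (h k).memLp.toLp (ψ k)) atTop (𝓝 v)) (hG : Tendsto
      (fun k => (h k).memLp_gradient.toLp (gradient (ψ k))) atTop (𝓝 G))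
    (hae : ∀ᵐ x ∂(volume.restrict Ω), Tendsto (fun k => ψ k x) atTop (𝓝 (v x)))
    (heq : ∀ (φ : 𝔼 → ℝ) (hφ : IsTestFunction Ω φ), inner ℝ (f - v) (hφ.memLp.toLp φ) =
      s * inner ℝ G (hφ.memLp_gradient.toLp (gradient φ)))
    (hf0 : ∀ᵐ x ∂(volume.restrict Ω), 0 ≤ f x) (hv0 : ∀ᵐ x ∂(volume.restrict Ω), 0 ≤ v x)
    {φ : 𝔼 → ℝ} (hφ : IsTestFunction Ω φ) (e : 𝔼) :
    ∫ x in Ω, (Set.Ioi (0 : ℝ)).indicator 1 (v x) * fderiv ℝ φ x e = 0 := by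
  have : IsFiniteMeasure (volume.restrict Ω) := ⟨by
    rw [Measure.restrict_apply_univ]; exact hb.measure_lt_top⟩
  set C : ℝ := (4 / s * (∫ x in Ω, φ x ^ 2) + 16 * ∫ x in Ω, ‖gradient φ x‖ ^ 2) +
    ∫ _ in Ω, ‖e‖ ^ 2 with hC
  -- a bound which does not depend on `ε`
  have hbound : ∀ ε, 0 < ε → |∫ x in Ω, logProfile ε (v x) * fderiv ℝ φ x e| ≤ C := by
    intro ε hε
    obtain ⟨hi, hle⟩ := integral_sq_logSlope_le h hs hG hae heq hf0 hv0 hε hφ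
    rw [integral_logProfile_mul_fderiv h hb hv hG hae hε hφ e, abs_neg]
    refine (abs_integral_le_integral_abs).trans ?_
    calc ∫ x in Ω, |logSlope ε (v x) * φ x * inner ℝ e (G x)|
        ≤ ∫ x in Ω, ((φ x * logSlope ε (v x)) ^ 2 * ‖G x‖ ^ 2 + ‖e‖ ^ 2) := by
          refine integral_mono_of_nonneg (ae_of_all _ fun x => abs_nonneg _)
            (hi.add (integrable_const _)) (ae_of_all _ fun x => ?_)
          have h1 := abs_real_inner_le_norm e (G x)
          have h2 : |logSlope ε (v x) * φ x| * |inner ℝ e (G x)| ≤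
              |logSlope ε (v x) * φ x| * (‖e‖ * ‖G x‖) := by gcongr
          simp only
          rw [abs_mul, mul_comm (φ x)]
          nlinarith [sq_nonneg (|logSlope ε (v x) * φ x| * ‖G x‖ - ‖e‖),
            sq_abs (logSlope ε (v x) * φ x), sq_nonneg (|logSlope ε (v x) * φ x| * ‖G x‖),
            sq_nonneg ‖e‖]
      _ ≤ C := by
          rw [integral_add hi (integrable_const _)]
          exact add_le_add hle le_rfl
  have hdc : Continuous (fun x => fderiv ℝ φ x e) :=
    (hφ.contDiff.continuous_fderiv (by simp)).clm_apply continuous_const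
  obtain ⟨D, hD⟩ := hdc.bounded_above_of_compact_support
    ((hφ.hasCompactSupport.fderiv (𝕜 := ℝ)).comp_left (g := fun A : 𝔼 →L[ℝ] ℝ => A e) (by simp))
  have l1 : Tendsto (fun k : ℕ => ∫ x in Ω, logProfile (Real.exp (-((k : ℝ) + 1))) (v x) /
      ((k : ℝ) + 1) * fderiv ℝ φ x e) atTop
      (𝓝 (∫ x in Ω, (Set.Ioi (0 : ℝ)).indicator 1 (v x) * fderiv ℝ φ x e)) := by
    have hvi : Integrable v (volume.restrict Ω) := (Lp.memLp v).integrable one_le_two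
    refine tendsto_integral_of_dominated_convergence (fun x => (1 + v x) * D) (fun k => ?_)
      (((integrable_const 1).add hvi).mul_const D) (fun k => ?_) ?_
    · exact (((contDiff_logProfile (Real.exp_pos _)).continuous.comp_aestronglyMeasurable
        (Lp.aestronglyMeasurable v)).aemeasurable.div_const _).aestronglyMeasurable.mul
        hdc.aestronglyMeasurable
    · filter_upwards [hv0] with x hx
      have hk : (0 : ℝ) < (k : ℝ) + 1 := by positivity
      rw [norm_mul]
      refine mul_le_mul ?_ (hD x) (norm_nonneg _) (by linarith)
      rw [Real.norm_of_nonneg (div_nonneg (logProfile_nonneg (Real.exp_pos _) hx) hk.le),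
        div_le_iff₀ hk]
      have := logProfile_exp_le hk.le hx
      nlinarith [mul_nonneg hx (k.cast_nonneg (α := ℝ))]
    · filter_upwards [hv0] with x hx
      exact (tendsto_logProfile_div hx).mul_const _
  refine tendsto_nhds_unique l1 (squeeze_zero_norm (a := fun k : ℕ => C / ((k : ℝ) + 1))
    (fun k => ?_) ?_)
  · have hk : (0 : ℝ) < (k : ℝ) + 1 := by positivity
    have e1 : ∀ x, logProfile (Real.exp (-((k : ℝ) + 1))) (v x) / ((k : ℝ) + 1) *
        fderiv ℝ φ x e = (logProfile (Real.exp (-((k : ℝ) + 1))) (v x) * fderiv ℝ φ x e) /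
          ((k : ℝ) + 1) := fun x => by ring
    simp_rw [e1]
    rw [integral_div, norm_div, Real.norm_of_nonneg hk.le]
    exact div_le_div_of_nonneg_right (hbound _ (Real.exp_pos _)) hk.le
  · exact tendsto_const_nhds.div_atTop
      (tendsto_atTop_add_const_right _ _ tendsto_natCast_atTop_atTop)

/-- The strong maximum principle: on a connected open set the resolvent is positivity improving. -/
theorem ae_pos_resolvent (hΩ : IsOpen Ω) (hconn : IsPreconnected Ω) (hb : Bornology.IsBounded Ω)
    (hs : 0 < s) (hf : |f| = f) (hf' : f ≠ 0) :
    ∀ᵐ x ∂(volume.restrict Ω), 0 < resolvent₀ Ω s f x := by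
  have : IsFiniteMeasure (volume.restrict Ω) := ⟨by
    rw [Measure.restrict_apply_univ]; exact hb.measure_lt_top⟩
  obtain ⟨G, ψ, h, hv, hG, hae, heq⟩ := exists_gradient_resolvent hs f
  have hv0 := ae_nonneg_of_abs_eq (abs_resolvent_eq (s := s) hb hf)
  set v := resolvent₀ Ω s f with hvdef
  set w : 𝔼 → ℝ := Ω.indicator fun x => (Set.Ioi (0 : ℝ)).indicator 1 (v x) with hw
  have hwi : Integrable w := by
    rw [hw, integrable_indicator_iff hΩ.measurableSet]
    refine (integrable_const (1 : ℝ)).mono' ?_ (ae_of_all _ fun x => ?_)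
    · exact ((measurable_one.indicator measurableSet_Ioi).comp_aemeasurable
        (Lp.aestronglyMeasurable v).aemeasurable).aestronglyMeasurable
    · by_cases hx : v x ∈ Set.Ioi (0 : ℝ) <;> simp [hx]
  obtain ⟨c, hc⟩ := exists_ae_eq_const_of_integral_mul_fderiv_eq_zero hΩ hconn
    hwi.locallyIntegrable fun φ hφ e => by
      have h0 := integral_indicator_pos_mul_fderiv h hb hs hv hG hae heq
        (ae_nonneg_of_abs_eq hf) hv0 hφ e
      rw [← integral_indicator hΩ.measurableSet] at h0
      simpa only [hw, Set.indicator_mul_left] using h0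
  have hc' : ∀ᵐ x ∂(volume.restrict Ω), (Set.Ioi (0 : ℝ)).indicator 1 (v x) = c := by
    filter_upwards [ae_restrict_of_ae hc, ae_restrict_mem hΩ.measurableSet] with x h1 hx
    have h2 := h1 hx
    rwa [hw, Set.indicator_of_mem hx] at h2
  -- either `v > 0` almost everywhere, or `v = 0` and then `f = 0`
  by_cases h1 : c = 1
  · filter_upwards [hc'] with x hx
    by_contra h2
    rw [Set.indicator_of_notMem (by simpa using h2), h1] at hx
    exact zero_ne_one hx
  · refine absurd (eq_zero_of_resolvent_eq_zero (s := s) hΩ ?_) hf'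
    refine Lp.ext ?_
    filter_upwards [hc', hv0, Lp.coeFn_zero ℝ 2 (volume.restrict Ω)] with x h2 h3 h4
    rw [h4, Pi.zero_apply]
    refine le_antisymm (not_lt.1 fun h5 => h1 ?_) h3
    rw [← h2, Set.indicator_of_mem (Set.mem_Ioi.2 h5), Pi.one_apply]

end StrictPositivity

/-! ### The forms of the absolute value -/

section Comparison

variable {n : ℕ} {Ω : Set (EuclideanSpace ℝ (Fin n))} {s : ℝ}

local notation "𝔼" => EuclideanSpace ℝ (Fin n)

theorem inner_resolvent_nonneg (hb : Bornology.IsBounded Ω) {p q : L2 Ω ℝ} (hp : |p| = p)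
    (hq : |q| = q) : 0 ≤ inner ℝ (resolvent₀ Ω s p) q := by
  rw [L2.inner_def]
  refine integral_nonneg_of_ae ?_
  filter_upwards [ae_nonneg_of_abs_eq (abs_resolvent_eq (s := s) hb hp),
    ae_nonneg_of_abs_eq hq] with x h1 h2
  exact mul_nonneg h2 h1

theorem inner_resolvent_pos (hΩ : IsOpen Ω) (hconn : IsPreconnected Ω)
    (hb : Bornology.IsBounded Ω) (hs : 0 < s) {p q : L2 Ω ℝ} (hp : |p| = p) (hp' : p ≠ 0)
    (hq : |q| = q) (hq' : q ≠ 0) : 0 < inner ℝ (resolvent₀ Ω s p) q := by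
  refine lt_of_le_of_ne (inner_resolvent_nonneg hb hp hq) fun h => hq' ?_
  have hpos := ae_pos_resolvent hΩ hconn hb hs hp hp'
  rw [L2.inner_def, eq_comm, integral_eq_zero_iff_of_nonneg_ae ?_ (L2.integrable_inner _ _)] at h
  · refine Lp.ext ?_
    filter_upwards [h, hpos, Lp.coeFn_zero ℝ 2 (volume.restrict Ω)] with x h1 h2 h3
    rw [h3, Pi.zero_apply]
    exact (mul_eq_zero.1 (h1 : q x * resolvent₀ Ω s p x = 0)).resolve_right h2.ne'
  · filter_upwards [hpos, ae_nonneg_of_abs_eq hq] with x h1 h2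
    exact mul_nonneg h2 h1.le

/-- Passing from `f` to `|f|` only changes the sign of the cross term between the positive and
negative parts. -/
theorem inner_resolvent_abs (f : L2 Ω ℝ) : inner ℝ (resolvent₀ Ω s |f|) |f| =
    inner ℝ (resolvent₀ Ω s f) f + 4 * inner ℝ (resolvent₀ Ω s f⁺) f⁻ := by
  have h : inner ℝ (resolvent₀ Ω s f⁻) f⁺ = inner ℝ (resolvent₀ Ω s f⁺) f⁻ := by
    rw [real_inner_comm]
    exact (resolvent_isSymmetric (s := s) f⁺ f⁻).symm
  have e1 : |f| = f⁺ + f⁻ := (posPart_add_negPart f).symm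
  have e2 : inner ℝ (resolvent₀ Ω s f) f = inner ℝ (resolvent₀ Ω s (f⁺ - f⁻)) (f⁺ - f⁻) := by
    rw [posPart_sub_negPart]
  rw [e1, e2]
  simp only [map_add, map_sub, inner_add_left, inner_add_right, inner_sub_left, inner_sub_right, h]
  ring

theorem resolventEnergy_abs_le (hb : Bornology.IsBounded Ω) (f : L2 Ω ℝ) (s : ℝ) :
    resolventEnergy Ω |f| s ≤ resolventEnergy Ω f s := by
  refine ENNReal.ofReal_le_ofReal ?_
  have h := inner_resolvent_nonneg (s := s) hb (abs_of_nonneg (posPart_nonneg f))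
    (abs_of_nonneg (negPart_nonneg f))
  rw [inner_resolvent_abs, norm_abs_eq_norm]
  linarith

theorem resolventEnergy_abs_lt (hΩ : IsOpen Ω) (hconn : IsPreconnected Ω)
    (hb : Bornology.IsBounded Ω) (hs : 0 < s) {f : L2 Ω ℝ} (hp : f⁺ ≠ 0) (hq : f⁻ ≠ 0) :
    resolventEnergy Ω |f| s < resolventEnergy Ω f s := by
  have h := inner_resolvent_pos hΩ hconn hb hs (abs_of_nonneg (posPart_nonneg f)) hp
    (abs_of_nonneg (negPart_nonneg f)) hq
  have h1 := inner_resolvent_self_le (s := s) |f|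
  have h2 := inner_resolvent_abs (s := s) f
  rw [norm_abs_eq_norm] at h1
  rw [resolventEnergy, resolventEnergy, norm_abs_eq_norm]
  exact (ENNReal.ofReal_lt_ofReal_iff (by linarith)).2 (by linarith)

theorem toLp_abs {u : 𝔼 → ℝ} (hu : MemLp u 2 (volume.restrict Ω))
    (hu' : MemLp (fun x => |u x|) 2 (volume.restrict Ω)) : hu'.toLp _ = |hu.toLp u| := by
  refine Lp.ext ?_
  filter_upwards [hu'.coeFn_toLp, Lp.coeFn_abs (hu.toLp u), hu.coeFn_toLp] with x h1 h2 h3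
  rw [h1, h2, h3]

theorem navierForm_congr_ae {m : ℝ} {u v : 𝔼 → ℝ} (h : u =ᵐ[volume] v) :
    navierForm m Ω u = navierForm m Ω v := by
  have h' : u =ᵐ[volume.restrict Ω] v := ae_restrict_of_ae h
  by_cases hu : MemLp u 2 (volume.restrict Ω)
  · have hv := (memLp_congr_ae h').1 hu
    rw [navierForm, navierForm, dif_pos hu, dif_pos hv, (MemLp.toLp_eq_toLp_iff hu hv).2 h']
  · rw [navierForm, navierForm, dif_neg hu, dif_neg fun hv => hu ((memLp_congr_ae h').2 hv)]

theorem navierConst_mul_navierForm_abs (hΩ : IsOpen Ω) (hb : Bornology.IsBounded Ω) {m : ℝ}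
    (hm0 : 0 < m) {u : 𝔼 → ℝ} (hu : MemLp u 2 (volume.restrict Ω)) :
    navierConst m * navierForm m Ω (fun x => |u x|) =
      ∫⁻ s in Set.Ioi (0 : ℝ), ENNReal.ofReal (s ^ (-1 - m)) *
        resolventEnergy Ω |hu.toLp u| s := by
  have hu' : MemLp (fun x => |u x|) 2 (volume.restrict Ω) := hu.abs
  rw [navierConst_mul_navierForm hΩ hb hm0 hu', toLp_abs hu]

theorem navierForm_abs_le (hΩ : IsOpen Ω) (hb : Bornology.IsBounded Ω) {m : ℝ} (hm0 : 0 < m)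
    (hm1 : m < 1) {u : 𝔼 → ℝ} (hu : MemLp u 2 (volume.restrict Ω)) :
    navierForm m Ω (fun x => |u x|) ≤ navierForm m Ω u := by
  rw [← ENNReal.mul_le_mul_iff_right (navierConst_ne_zero m) (navierConst_ne_top hm0 hm1),
    navierConst_mul_navierForm hΩ hb hm0 hu, navierConst_mul_navierForm_abs hΩ hb hm0 hu]
  exact lintegral_mono fun s => by gcongr; exact resolventEnergy_abs_le hb _ s

theorem navierForm_abs_lt (hΩ : IsOpen Ω) (hconn : IsPreconnected Ω)
    (hb : Bornology.IsBounded Ω) {m : ℝ} (hm0 : 0 < m) (hm1 : m < 1) {u : 𝔼 → ℝ}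
    (hu : MemLp u 2 (volume.restrict Ω)) (hfin : navierForm m Ω u < ⊤)
    (hp : (hu.toLp u)⁺ ≠ 0) (hq : (hu.toLp u)⁻ ≠ 0) :
    navierForm m Ω (fun x => |u x|) < navierForm m Ω u := by
  have hle := navierForm_abs_le hΩ hb hm0 hm1 hu
  rw [← ENNReal.mul_lt_mul_iff_right (navierConst_ne_zero m) (navierConst_ne_top hm0 hm1)]
  have hfin' : navierConst m * navierForm m Ω (fun x => |u x|) ≠ ⊤ :=
    ENNReal.mul_ne_top (navierConst_ne_top hm0 hm1) (hle.trans_lt hfin).ne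
  rw [navierConst_mul_navierForm_abs hΩ hb hm0 hu] at hfin' ⊢
  rw [navierConst_mul_navierForm hΩ hb hm0 hu]
  refine lintegral_strict_mono ?_ ?_ hfin' ?_
  · rw [Ne, Measure.restrict_eq_zero, Real.volume_Ioi]
    exact ENNReal.top_ne_zero
  · exact (by fun_prop : Measurable fun s : ℝ => ENNReal.ofReal (s ^ (-1 - m))).aemeasurable.mul
      (aemeasurable_resolventEnergy hΩ hb _)
  · filter_upwards [ae_restrict_mem measurableSet_Ioi] with s hs
    exact (ENNReal.mul_lt_mul_iff_right (ENNReal.ofReal_pos.2 (Real.rpow_pos_of_pos hs _)).ne'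
      ENNReal.ofReal_ne_top).2 (resolventEnergy_abs_lt hΩ hconn hb hs hp hq)

/-- Since the boundary is negligible, a function supported in the closure which is nonpositive
almost everywhere on `Ω` is nonpositive almost everywhere. -/
theorem posPart_toLp_ne_zero (hΩ : IsBoundedSmoothDomain Ω) {u : 𝔼 → ℝ}
    (hu : MemLp u 2 (volume.restrict Ω)) (h0 : ∀ᵐ x, x ∉ closure Ω → u x = 0)
    (hne : ¬ (fun x => max (u x) 0) =ᵐ[volume] 0) : (hu.toLp u)⁺ ≠ 0 := by
  intro h
  refine hne ?_
  have h1 : ∀ᵐ x ∂(volume.restrict Ω), u x ≤ 0 := by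
    filter_upwards [(Lp.coeFn_le _ _).2 (posPart_eq_zero.1 h), hu.coeFn_toLp,
      Lp.coeFn_zero ℝ 2 (volume.restrict Ω)] with x h1 h2 h3
    rwa [h2, h3] at h1
  filter_upwards [h0, (ae_restrict_iff' hΩ.isOpen.measurableSet).1 h1,
    measure_eq_zero_iff_ae_notMem.1 hΩ.volume_frontier] with x h2 h3 h4
  rw [Pi.zero_apply, max_eq_right_iff]
  by_cases hx : x ∈ closure Ω
  · exact h3 (interior_subset (by_contra fun h5 => h4 ⟨hx, h5⟩))
  · exact (h2 hx).le

theorem negPart_toLp_ne_zero (hΩ : IsBoundedSmoothDomain Ω) {u : 𝔼 → ℝ}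
    (hu : MemLp u 2 (volume.restrict Ω)) (h0 : ∀ᵐ x, x ∉ closure Ω → u x = 0)
    (hne : ¬ (fun x => max (-u x) 0) =ᵐ[volume] 0) : (hu.toLp u)⁻ ≠ 0 := by
  have h := posPart_toLp_ne_zero hΩ hu.neg (h0.mono fun x hx hx' => by
    rw [Pi.neg_apply, hx hx', neg_zero]) hne
  rwa [MemLp.toLp_neg, posPart_neg] at h

theorem volume_pos_ne_zero {u : 𝔼 → ℝ} (h : ¬ (fun x => max (u x) 0) =ᵐ[volume] 0) :
    volume {x | 0 < u x} ≠ 0 := fun h0 =>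
  h ((measure_eq_zero_iff_ae_notMem.1 h0).mono fun _ hx => max_eq_right (not_lt.1 hx))

/-- Functions in `H̃^m(Ω)` have a Borel representative vanishing outside of the closure. -/
theorem MemHTilde.exists_representative {m : ℝ} {u : 𝔼 → ℝ} (hu : MemHTilde m Ω u) :
    ∃ v : 𝔼 → ℝ, Measurable v ∧ u =ᵐ[volume] v ∧ ∀ x, x ∉ closure Ω → v x = 0 := by
  have hm := hu.1.1.1.aemeasurable
  refine ⟨(closure Ω).indicator (hm.mk u), hm.measurable_mk.indicator isClosed_closure.measurableSet,
    ?_, fun x hx => Set.indicator_of_notMem hx _⟩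
  filter_upwards [hm.ae_eq_mk, hu.2] with x h1 h2
  by_cases hx : x ∈ closure Ω
  · rw [Set.indicator_of_mem hx, h1]
  · rw [Set.indicator_of_notMem hx, h2 hx]

theorem MemHTilde.gagliardo_ne_top {m : ℝ} (hm0 : 0 < m) (hm1 : m < 1)
    (hb : Bornology.IsBounded Ω) {u : 𝔼 → ℝ} (hu : MemHTilde m Ω u) : gagliardo m u ≠ ⊤ :=
  (exists_isFracLaplacian_iff hm0 hm1 (hu.integrable_and_memLp hm0 hb).1
    (hu.integrable_and_memLp hm0 hb).2).1 hu.1.2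

theorem MemHTilde.abs {m : ℝ} (hm0 : 0 < m) (hm1 : m < 1) (hb : Bornology.IsBounded Ω)
    {u : 𝔼 → ℝ} (hu : MemHTilde m Ω u) : MemHTilde m Ω (fun x => |u x|) := by
  obtain ⟨hi, hi2⟩ := hu.integrable_and_memLp hm0 hb
  refine ⟨⟨hu.1.1.abs, (exists_isFracLaplacian_iff hm0 hm1 hi.abs hi2.abs).2 ?_⟩,
    hu.2.mono fun x hx hx' => by simp [hx hx']⟩
  exact ((gagliardo_abs_le m u).trans_lt (hu.gagliardo_ne_top hm0 hm1 hb).lt_top).ne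

theorem MemHTilde.gagliardo_eq {m : ℝ} (hm0 : 0 < m) (hm1 : m < 1) (hb : Bornology.IsBounded Ω)
    {u : 𝔼 → ℝ} (hu : MemHTilde m Ω u) :
    gagliardo m u = gagliardoConst m * ENNReal.ofReal (dirichletForm m u) :=
  gagliardo_eq_dirichletForm hm0 hm1 (hu.integrable_and_memLp hm0 hb).1
    (hu.integrable_and_memLp hm0 hb).2 hu.1.2

theorem dirichletForm_nonneg (m : ℝ) (u : 𝔼 → ℝ) : 0 ≤ dirichletForm m u :=
  integral_nonneg fun _ => by positivity

theorem dirichletForm_abs_le {m : ℝ} (hm0 : 0 < m) (hm1 : m < 1) (hb : Bornology.IsBounded Ω)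
    {u : 𝔼 → ℝ} (hu : MemHTilde m Ω u) :
    dirichletForm m (fun x => |u x|) ≤ dirichletForm m u := by
  have h := gagliardo_abs_le m u
  rwa [hu.gagliardo_eq hm0 hm1 hb, (hu.abs hm0 hm1 hb).gagliardo_eq hm0 hm1 hb,
    ENNReal.mul_le_mul_iff_right (gagliardoConst_ne_zero m) (gagliardoConst_ne_top hm0 hm1),
    ENNReal.ofReal_le_ofReal_iff (dirichletForm_nonneg m u)] at h

theorem dirichletForm_abs_lt {m : ℝ} (hm0 : 0 < m) (hm1 : m < 1) (hb : Bornology.IsBounded Ω)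
    {u : 𝔼 → ℝ} (hu : MemHTilde m Ω u) (hp : ¬ (fun x => max (u x) 0) =ᵐ[volume] 0)
    (hq : ¬ (fun x => max (-u x) 0) =ᵐ[volume] 0) :
    dirichletForm m (fun x => |u x|) < dirichletForm m u := by
  obtain ⟨v, hv, huv, -⟩ := hu.exists_representative
  have hneg : ∀ {f g : 𝔼 → ℝ}, f =ᵐ[volume] g → ¬ (fun x => max (f x) 0) =ᵐ[volume] 0 →
      volume {x | 0 < g x} ≠ 0 := fun hfg hf => volume_pos_ne_zero fun hg =>
    hf (Filter.EventuallyEq.trans (hfg.mono fun x hx => by simp only [hx]) hg)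
  have hfin := hu.gagliardo_ne_top hm0 hm1 hb
  rw [gagliardo_congr_ae huv] at hfin
  have h := gagliardo_abs_lt hv hfin (hneg huv hp)
    (by simpa using hneg (f := fun x => -u x) (g := fun x => -v x) huv.neg hq)
  rw [← gagliardo_congr_ae huv, ← gagliardo_congr_ae (u := fun x => |u x|)
    (huv.mono fun x hx => by simp only [hx]), hu.gagliardo_eq hm0 hm1 hb,
    (hu.abs hm0 hm1 hb).gagliardo_eq hm0 hm1 hb, ENNReal.mul_lt_mul_iff_right
      (gagliardoConst_ne_zero m) (gagliardoConst_ne_top hm0 hm1)] at h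
  exact (ENNReal.ofReal_lt_ofReal_iff_of_nonneg (dirichletForm_nonneg m _)).1 h

end Comparison

end

theorem theorem3 (n : ℕ) (hn : 1 ≤ n) (Ω : Set (EuclideanSpace ℝ (Fin n)))
    (hΩ : IsBoundedSmoothDomain Ω) (m : ℝ) (hm0 : 0 < m) (hm1 : m < 1)
    (u : EuclideanSpace ℝ (Fin n) → ℝ) (hu : MemHTilde m Ω u) :
    MemHTilde m Ω (fun x => |u x|) ∧
    dirichletForm m (fun x => |u x|) ≤ dirichletForm m u ∧
    navierForm m Ω u < ⊤ ∧
    navierForm m Ω (fun x => |u x|) ≤ navierForm m Ω u ∧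
    (¬ (fun x => max (u x) 0) =ᵐ[volume] 0 → ¬ (fun x => max (-u x) 0) =ᵐ[volume] 0 →
      dirichletForm m (fun x => |u x|) < dirichletForm m u ∧
      navierForm m Ω (fun x => |u x|) < navierForm m Ω u) := by
  obtain ⟨-, hu2⟩ := hu.integrable_and_memLp hm0 hΩ.isBounded
  obtain ⟨v, hv, huv, hv0⟩ := hu.exists_representative
  have hfin : navierForm m Ω u < ⊤ := by
    rw [navierForm_congr_ae huv]
    refine navierForm_lt_top hΩ hm0 hm1 hv ((memLp_congr_ae huv).1 hu2) hv0 ?_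
    rw [← gagliardo_congr_ae huv]
    exact hu.gagliardo_ne_top hm0 hm1 hΩ.isBounded
  have huΩ : MemLp u 2 (volume.restrict Ω) := hu2.restrict Ω
  exact ⟨hu.abs hm0 hm1 hΩ.isBounded, dirichletForm_abs_le hm0 hm1 hΩ.isBounded hu, hfin,
    navierForm_abs_le hΩ.isOpen hΩ.isBounded hm0 hm1 huΩ, fun hp hq =>
      ⟨dirichletForm_abs_lt hm0 hm1 hΩ.isBounded hu hp hq,
        navierForm_abs_lt hΩ.isOpen hΩ.isConnected.isPreconnected hΩ.isBounded hm0 hm1 huΩ hfin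
          (posPart_toLp_ne_zero hΩ huΩ hu.2 hp) (negPart_toLp_ne_zero hΩ huΩ hu.2 hq)⟩⟩
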